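/- Let $p$ be a prime, $\bar{\mathbb Q}_p$ an algebraic closure of $\mathbb Q_p$ with completion $\mathbb C_p$, and $K\subset\bar{\mathbb Q}_p$ a finite extension of $\mathbb Q_p$ with valuation ring $\mathcal O_K$, maximal ideal $\mathcal P_K$ and residue field of cardinality $q$. Let $\pi,\pi'$ be uniformising parameters of $\mathcal O_K$, and let $P,Q\in\mathcal O_K[[X]]$ be Lubin-Tate series with respect to $\pi$ and $\pi'$ respectively, i.e. $P(X)\equiv \pi X \bmod X^2$, $P(X)\equiv X^q \bmod \pi$, and likewise for $Q$ and $\pi'$. Let $F_P\in\mathcal O_K[[X,Y]]$ be the unique (commutative) formal group admitting $P$ as an endomorphism, $\exp_{F_P}\in K[[X]]$ the unique power series with $\exp_{F_P}(X)\equiv X\bmod X^2$ and $\exp_{F_P}(X+Y)=F_P(\exp_{F_P}(X),\exp_{F_P}(Y))$, and for $a\in\mathcal O_K$ let $[a]_P\in X\mathcal O_K[[X]]$ be the unique power series with $[a]_P(X)\equiv aX\bmod X^2$ and $P([a]_P(X))=[a]_P(P(X))$. For $x,y\in\mathbb C_p$ with $|x|,|y|<1$ write $x+_{F_P}y=F_P(x,y)$.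 Let $(\omega_i)_{i\ge1}$ be a coherent set of roots associated to $Q$: elements of $\bar{\mathbb Q}_p$ of positive valuation with $\omega_1\neq0$, $Q(\omega_1)=0$ and $Q(\omega_{i+1})=\omega_i$ for all $i\ge1$. For $m\ge1$ put $$\mathcal E_{P,m}^{Q}(X)=\exp_{F_P}\Big(\sum_{i=0}^{m-1}\frac{\omega_{m-i}\,(X^{q^i}-X^{q^{i+1}})}{\pi^i}\Big).$$ Let $n\ge1$, assume $\pi\equiv\pi'\bmod\mathcal P_K^{n+1}$, and for $0\le i\le n-1$ let $z_i\in\bar{\mathbb Q}_p$ be $0$ or a $(q-1)$-th root of unity, with $z_0\ne0$. Then $\sum_{i=0}^{n-1}z_i\pi^i\in\mathcal O_K$, the series $\mathcal E_{P,n}^Q$ converges at $1$ and $\mathcal E_{P,n-i}^Q$ converges at $z_i$ for $0\le i\le n-1$, with values of positive valuation in $\mathbb C_p$, and $$\Big[\sum_{i=0}^{n-1}z_i\pi^i\Big]_P\big(\mathcal E_{P,n}^Q(1)\big)=\mathcal E_{P,n}^Q(z_0)+_{F_P}\mathcal E_{P,n-1}^Q(z_1)+_{F_P}\cdots+_{F_P}\mathcal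 E_{P,1}^Q(z_{n-1}).$$ -/

import Mathlib

noncomputable section

namespace LubinTateExp

/-! ### Power series attached to a Lubin-Tate series -/

section Formal

variable {R : Type*} [CommRing R]

/-- `P` is a Lubin-Tate series over `R` with respect to `π` (and the residue cardinality `q`):
`P(X) ≡ π X` modulo `X ^ 2` and `P(X) ≡ X ^ q` modulo `π`. -/
structure IsLubinTateSeries (π : R) (q : ℕ) (P : PowerSeries R) : Prop where
  linear : PowerSeries.X ^ 2 ∣ P - PowerSeries.C π * PowerSeries.X
  frobenius : PowerSeries.C π ∣ P - PowerSeries.X ^ q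

/-- `F` is a commutative formal group having the power series `P` as an endomorphism:
`P(F(X, Y)) = F(P(X), P(Y))`. -/
def HasEndomorphism (F : FormalGroup R) (P : PowerSeries R) : Prop :=
  F.IsComm ∧
    PowerSeries.subst (F : MvPowerSeries (Fin 2) R) P =
      MvPowerSeries.subst
        ![PowerSeries.subst (MvPowerSeries.X (0 : Fin 2) : MvPowerSeries (Fin 2) R) P,
          PowerSeries.subst (MvPowerSeries.X (1 : Fin 2) : MvPowerSeries (Fin 2) R) P]
        (F : MvPowerSeries (Fin 2) R)

open Classical in
/-- The formal group `F_P`: the commutative formal group over `R` that admits `P` as an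
endomorphism. For a Lubin-Tate series over the valuation ring of a finite extension of `ℚ_p`
there is exactly one; the value is irrelevant when there is none. -/
def lubinTateGroup (P : PowerSeries R) : FormalGroup R :=
  if h : ∃ F : FormalGroup R, HasEndomorphism F P then h.choose else FormalGroup.𝔾ₐ

/-- `g = [a]_P`: `g` has no constant term, linear coefficient `a`, and `P(g(X)) = g(P(X))`. -/
structure IsMulSeries (P : PowerSeries R) (a : R) (g : PowerSeries R) : Prop where
  constantCoeff_eq : PowerSeries.constantCoeff g = 0
  coeff_one_eq : PowerSeries.coeff 1 g = a
  commutes : PowerSeries.subst g P = PowerSeries.subst P g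

/-- The power series `[a]_P`. For a Lubin-Tate series over the valuation ring of a finite extension
of `ℚ_p` there is exactly one series as required. -/
def mulSeries (P : PowerSeries R) (a : R) : PowerSeries R :=
  Classical.epsilon (IsMulSeries P a)

/-- `e = exp_F`: `e(X) ≡ X` modulo `X ^ 2` and `e(X + Y) = F(e(X), e(Y))`. -/
structure IsFormalExp (F : FormalGroup R) (e : PowerSeries R) : Prop where
  constantCoeff_eq : PowerSeries.constantCoeff e = 0
  coeff_one_eq : PowerSeries.coeff 1 e = 1
  map_add :
    PowerSeries.subst
        (MvPowerSeries.X (0 : Fin 2) + MvPowerSeries.X (1 : Fin 2) : MvPowerSeries (Fin 2) R) e =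
      MvPowerSeries.subst
        ![PowerSeries.subst (MvPowerSeries.X (0 : Fin 2) : MvPowerSeries (Fin 2) R) e,
          PowerSeries.subst (MvPowerSeries.X (1 : Fin 2) : MvPowerSeries (Fin 2) R) e]
        (F : MvPowerSeries (Fin 2) R)

/-- The exponential `exp_F` of a formal group. Over a field of characteristic zero and for a
commutative formal group there is exactly one series as required. -/
def formalExp (F : FormalGroup R) : PowerSeries R :=
  Classical.epsilon (IsFormalExp F)

end Formal

/-! ### Evaluation at `p`-adic complex numbers -/

section Evaluation

variable {p : ℕ} [Fact p.Prime]

/-- The value `f(x)` of a power series in one variable. -/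
def eval (f : PowerSeries ℂ_[p]) (x : ℂ_[p]) : ℂ_[p] :=
  ∑' k : ℕ, PowerSeries.coeff k f * x ^ k

/-- The power series `f` converges at `x`. -/
def ConvergesAt (f : PowerSeries ℂ_[p]) (x : ℂ_[p]) : Prop :=
  Summable fun k : ℕ => PowerSeries.coeff k f * x ^ k

/-- The value `F(x, y)` of a power series in two variables. -/
def eval₂ (F : MvPowerSeries (Fin 2) ℂ_[p]) (x y : ℂ_[p]) : ℂ_[p] :=
  ∑' d : Fin 2 →₀ ℕ, MvPowerSeries.coeff d F * (x ^ d 0 * y ^ d 1)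

/-- The sum `x 0 +_F x 1 +_F ... +_F x (n - 1)`, bracketed from the left
(and started at the neutral element `0`). -/
def formalSum (F : MvPowerSeries (Fin 2) ℂ_[p]) (x : ℕ → ℂ_[p]) : ℕ → ℂ_[p]
  | 0 => 0
  | n + 1 => eval₂ F (formalSum F x n) (x n)

end Evaluation

/-! ### Finite extensions of `ℚ_p` inside the algebraic closure -/

section Field

variable {p : ℕ} [Fact p.Prime]

/-- The valuation ring `𝒪_K = {x ∈ K : |x| ≤ 1}` of a subfield `K` of the algebraic closure
of `ℚ_p`. -/
def integerRing (K : IntermediateField ℚ_[p] (PadicAlgCl p)) : ValuationSubring K :=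
  (PadicAlgCl.valued p).v.valuationSubring.comap (algebraMap K (PadicAlgCl p))

/-- The inclusion of `𝒪_K` in `ℂ_p`. -/
def integerEmb (K : IntermediateField ℚ_[p] (PadicAlgCl p)) : integerRing K →+* ℂ_[p] :=
  ((algebraMap (PadicAlgCl p) ℂ_[p]).comp (algebraMap K (PadicAlgCl p))).comp
    (integerRing K).subtype

/-- The cardinality `q` of the residue field of `K`. -/
def residueCard (K : IntermediateField ℚ_[p] (PadicAlgCl p)) : ℕ :=
  Nat.card (IsLocalRing.ResidueField (integerRing K))

/-- `π` is a uniformising parameter of `𝒪_K`. -/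
def IsUniformiser (K : IntermediateField ℚ_[p] (PadicAlgCl p)) (π : integerRing K) : Prop :=
  IsLocalRing.maximalIdeal (integerRing K) = Ideal.span {π}

/-- `ω 1, ω 2, ...` is a coherent set of roots associated to `Q`: elements of positive valuation of
the algebraic closure of `ℚ_p` such that `ω 1 ≠ 0`, `Q(ω 1) = 0` and `Q(ω (i + 1)) = ω i`.
The entry `ω 0` plays no role. -/
structure IsCoherentRoots {K : IntermediateField ℚ_[p] (PadicAlgCl p)}
    (Q : PowerSeries (integerRing K)) (ω : ℕ → PadicAlgCl p) : Prop where
  norm_lt_one : ∀ i, 1 ≤ i → ‖ω i‖ < 1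
  ne_zero : ω 1 ≠ 0
  root : eval (Q.map (integerEmb K)) (ω 1 : ℂ_[p]) = 0
  step : ∀ i, 1 ≤ i → eval (Q.map (integerEmb K)) (ω (i + 1) : ℂ_[p]) = (ω i : ℂ_[p])

/-- The polynomial `∑_{i < n} ω_{n-i} (X ^ (q ^ i) - X ^ (q ^ (i + 1))) / π ^ i`. -/
def expArgument (q : ℕ) (π : PadicAlgCl p) (ω : ℕ → PadicAlgCl p) (n : ℕ) :
    PowerSeries (PadicAlgCl p) :=
  ∑ i ∈ Finset.range n, PowerSeries.C (ω (n - i) / π ^ i) *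
    (PowerSeries.X ^ q ^ i - PowerSeries.X ^ q ^ (i + 1))

/-- The formal group `F_P` of a series `P` over `𝒪_K`, with its coefficients read in `ℂ_p`. -/
def groupSeries {K : IntermediateField ℚ_[p] (PadicAlgCl p)} (P : PowerSeries (integerRing K)) :
    MvPowerSeries (Fin 2) ℂ_[p] :=
  (lubinTateGroup P : MvPowerSeries (Fin 2) (integerRing K)).map (integerEmb K)

/-- The exponential `exp_{F_P} ∈ K⟦X⟧` of the formal group `F_P`. -/
def lubinTateExp {K : IntermediateField ℚ_[p] (PadicAlgCl p)} (P : PowerSeries (integerRing K)) :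
    PowerSeries K :=
  formalExp ((lubinTateGroup P).map (integerRing K).subtype)

/-- The power series
`exp_{F_P} (∑_{i < n} ω_{n-i} (X ^ (q ^ i) - X ^ (q ^ (i + 1))) / π ^ i)`
over the algebraic closure of `ℚ_p`. -/
def expSeries {K : IntermediateField ℚ_[p] (PadicAlgCl p)} (π : integerRing K)
    (P : PowerSeries (integerRing K)) (ω : ℕ → PadicAlgCl p) (n : ℕ) :
    PowerSeries (PadicAlgCl p) :=
  PowerSeries.subst (expArgument (residueCard K) ((π : K) : PadicAlgCl p) ω n)
    ((lubinTateExp P).map (algebraMap K (PadicAlgCl p)))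

/-- The same power series, with its coefficients read in `ℂ_p`. -/
def expSeriesC {K : IntermediateField ℚ_[p] (PadicAlgCl p)} (π : integerRing K)
    (P : PowerSeries (integerRing K)) (ω : ℕ → PadicAlgCl p) (n : ℕ) : PowerSeries ℂ_[p] :=
  (expSeries π P ω n).map (algebraMap (PadicAlgCl p) ℂ_[p])

end Field

end LubinTateExp

end

/-! Write e for the exponential of F_P. It turns F_P into addition, and [u]_P(e(A)) = e(uA). Put A_m
= ∑_{i<m} ω_{m-i} (X^{q^i} − X^{q^{i+1}}) / π^i. If z^q = z, then z π^j A_n(X) = A_{n-j}(z X^{q^j})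
+ ∑_{i<j} z π^{j-i} ω_{n-i} (X^{q^i} − X^{q^{i+1}}). The coefficients of the last sum have norm
smaller than |π|, so e may be evaluated after putting X = 1, where the sum telescopes to 0. Hence
e(z π^j A_n) at 1 equals e(A_{n-j}) at z, and adding over j with F_P gives the formula
(`value_relation`). A_n itself is not that small, so its vanishing at 1 does not determine the value
of e(A_n) at 1.

The real content is that e(A_m) is `IsSmall`: its coefficients tend to 0 and are bounded by some r <
1. Then evaluation on the closed unit disc commutes with composition. Replace Q by Q' = Q + (π −
π')X, whose linear coefficient is π, and consider the generic argument B = ∑ Q'^{∘i}(T) (X^{q^i} −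
X^{q^{i+1}}) / π^i. With φ : T ↦ Q'(T), X ↦ X^q one has πB = φ(B) + πT(X − X^q), so y = e(B)
satisfies P(y) = F_P(φ(y), v) with v divisible by π. Since φ lifts the q-power map modulo π, an
induction on coefficients in the style of Dwork shows that y is integral
(`exists_map_eq_of_frobenius`, `exists_map_eq_subst_genericArgument`). Specializing T to a point of
the open disc gives a small series, because Q'^{∘i} / π^i converges coefficientwise
(`isSmall_subst_iterates`).

Finally, the Q'-orbit of ω_m stays within |π|^{n+1} of the chain ω_m, ..., ω_1, 0, because π ≡ π'
modulo the (n+1)-st power of the maximal ideal. Divided by π^i, the discrepancy lies in the range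
where integrality of e(πX) suffices (`isSmall_subst_chain`).

The existence of F_P and [a]_P rests on `exists_map_eq_of_subst_comm`, and uniqueness arguments on
`eq_of_subst_eq_rescale`. Both are inductions on the degree. -/

noncomputable section

namespace LubinTateExp

/-! ### Substitution modulo higher degree -/

section Truncation

variable {R S τ : Type*} [CommRing R] [CommRing S] [Algebra R S]

lemma coeff_mul_eq_zero_of_degree {f g : MvPowerSeries τ R} {d : τ →₀ ℕ}
    (hf : ∀ d', d'.degree < d.degree → MvPowerSeries.coeff d' f = 0)
    (hg : MvPowerSeries.constantCoeff g = 0) : MvPowerSeries.coeff d (f * g) = 0 := by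
  classical
  rw [MvPowerSeries.coeff_mul]
  refine Finset.sum_eq_zero fun x hx => ?_
  rw [Finset.HasAntidiagonal.mem_antidiagonal] at hx
  by_cases h : x.2 = 0
  · rw [h, MvPowerSeries.coeff_zero_eq_constantCoeff_apply, hg, mul_zero]
  · rw [hf, zero_mul]
    rw [← hx, map_add]
    have : x.2.degree ≠ 0 := fun h' => h ((Finsupp.degree_eq_zero_iff _).1 h')
    omega

/-- If `G` and `H` agree in degrees below that of `d`, the coefficients at `d` of `D(G)` and `D(H)`
differ only through the linear coefficient of `D`. -/
lemma coeff_subst_sub_coeff_subst (D : PowerSeries R) {G H : MvPowerSeries τ S}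
    (hG : MvPowerSeries.constantCoeff G = 0) (hH : MvPowerSeries.constantCoeff H = 0)
    (d : τ →₀ ℕ)
    (h : ∀ d', d'.degree < d.degree → MvPowerSeries.coeff d' G = MvPowerSeries.coeff d' H) :
    MvPowerSeries.coeff d (PowerSeries.subst G D) - MvPowerSeries.coeff d (PowerSeries.subst H D) =
      PowerSeries.coeff 1 D • (MvPowerSeries.coeff d G - MvPowerSeries.coeff d H) := by
  have hG' : PowerSeries.HasSubst G := PowerSeries.HasSubst.of_constantCoeff_zero hG
  have hH' : PowerSeries.HasSubst H := PowerSeries.HasSubst.of_constantCoeff_zero hH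
  rw [PowerSeries.coeff_subst hG', PowerSeries.coeff_subst hH', ← finsum_sub_distrib
    (PowerSeries.coeff_subst_finite hG' D d) (PowerSeries.coeff_subst_finite hH' D d),
    finsum_eq_single _ 1]
  · simp [smul_sub]
  · intro k hk
    rw [← smul_sub]
    rcases Nat.lt_or_ge k 1 with h0 | h1
    · obtain rfl : k = 0 := by omega
      simp
    · obtain ⟨k, rfl⟩ : ∃ j, k = j + 2 := ⟨k - 2, by omega⟩
      -- For k ≥ 2, G^k − H^k is G − H times a sum without constant term, so it vanishes through the
      -- degree of d.
      rw [← map_sub, ← (Commute.all G H).mul_geom_sum₂, coeff_mul_eq_zero_of_degree, smul_zero]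
      · intro d' hd'
        rw [map_sub, h d' hd', sub_self]
      · rw [map_sum]
        refine Finset.sum_eq_zero fun i hi => ?_
        rw [map_mul, map_pow, map_pow, hG, hH]
        rcases Nat.eq_zero_or_pos i with rfl | hi0
        · simp
        · rw [zero_pow hi0.ne', zero_mul]

lemma coeff_subst_of_degree_eq_one (D : PowerSeries R) {G : MvPowerSeries τ S}
    (hG : MvPowerSeries.constantCoeff G = 0) (d : τ →₀ ℕ) (hd : d.degree = 1)
    (hD : PowerSeries.constantCoeff D = 0) :
    MvPowerSeries.coeff d (PowerSeries.subst G D) =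
      PowerSeries.coeff 1 D • MvPowerSeries.coeff d G := by
  have := coeff_subst_sub_coeff_subst D hG (H := 0) (by simp) d (fun d' hd' => by
    rw [hd, Nat.lt_one_iff, Finsupp.degree_eq_zero_iff] at hd'
    subst hd'
    simpa using hG)
  rw [PowerSeries.subst_zero_of_constantCoeff_zero hD] at this
  simpa using this

/-- A series `G` with `D(G) = G(λ X)` is determined by its linear part. -/
theorem eq_of_subst_eq_rescale {L : Type*} [Field L] {D : PowerSeries L} {c : L}
    (hD : PowerSeries.coeff 1 D = c) (hc : ∀ j, 2 ≤ j → c ^ j ≠ c) {G H : MvPowerSeries τ L}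
    (hG : MvPowerSeries.constantCoeff G = 0) (hH : MvPowerSeries.constantCoeff H = 0)
    (hGD : PowerSeries.subst G D = MvPowerSeries.rescale (fun _ => c) G)
    (hHD : PowerSeries.subst H D = MvPowerSeries.rescale (fun _ => c) H)
    (hlin : ∀ d, d.degree = 1 → MvPowerSeries.coeff d G = MvPowerSeries.coeff d H) : G = H := by
  suffices h : ∀ r, ∀ d : τ →₀ ℕ, d.degree = r →
      MvPowerSeries.coeff d G = MvPowerSeries.coeff d H by
    ext d; exact h _ d rfl
  intro r
  induction r using Nat.strong_induction_on with
  | _ r ih =>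
    intro d hd
    rcases Nat.lt_or_ge r 2 with hr | hr
    · interval_cases r
      · obtain rfl := (Finsupp.degree_eq_zero_iff d).1 hd
        simp [hG, hH]
      · exact hlin d hd
    -- The difference of D(G) and D(H) at d is c (G_d − H_d) by truncation and c^r (G_d − H_d) by
    -- the functional equation.
    · have := coeff_subst_sub_coeff_subst D hG hH d (fun d' hd' => ih _ (hd ▸ hd') d' rfl)
      rw [hGD, hHD, MvPowerSeries.coeff_rescale, MvPowerSeries.coeff_rescale, hD,
        Finsupp.prod, Finset.prod_pow_eq_pow_sum, smul_eq_mul] at this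
      rw [← Finsupp.degree_apply, hd] at this
      have h2 : (c ^ r - c) * (MvPowerSeries.coeff d G - MvPowerSeries.coeff d H) = 0 := by
        linear_combination this
      exact sub_eq_zero.1 ((mul_eq_zero.1 h2).resolve_left (sub_ne_zero.2 (hc r hr)))

lemma hasSubst_X_mul [Finite τ] (u : τ → MvPowerSeries τ R) :
    MvPowerSeries.HasSubst fun i => MvPowerSeries.X i * u i :=
  MvPowerSeries.hasSubst_of_constantCoeff_zero fun i => by simp

/-- The monomial of exponent d' becomes itself times a power series, so it reaches d only if d' ≤ d,
and lower degrees are absent by hypothesis. Thus to leading order X ↦ P(X) acts like scaling by c.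
-/
lemma coeff_subst_X_mul [Finite τ] {u : τ → MvPowerSeries τ R} {c : R}
    (hu : ∀ i, MvPowerSeries.constantCoeff (u i) = c) {f : MvPowerSeries τ R} {d : τ →₀ ℕ}
    (hf : ∀ d', d'.degree < d.degree → MvPowerSeries.coeff d' f = 0) :
    MvPowerSeries.coeff d (MvPowerSeries.subst (fun i => MvPowerSeries.X i * u i) f) =
      c ^ d.degree * MvPowerSeries.coeff d f := by
  classical
  have key : ∀ d' : τ →₀ ℕ, (d'.prod fun s e => (MvPowerSeries.X s * u s) ^ e) =
      MvPowerSeries.monomial d' 1 * d'.prod fun s e => u s ^ e := by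
    intro d'
    rw [MvPowerSeries.monomial_one_eq, ← Finsupp.prod_mul]
    simp only [mul_pow]
  rw [MvPowerSeries.coeff_subst (hasSubst_X_mul u), finsum_eq_single _ d]
  · rw [key, MvPowerSeries.coeff_monomial_mul, if_pos le_rfl, tsub_self,
      MvPowerSeries.coeff_zero_eq_constantCoeff_apply, map_finsuppProd]
    simp only [map_pow, hu, Finsupp.prod, Finset.prod_pow_eq_pow_sum, smul_eq_mul, one_mul]
    rw [Finsupp.degree_apply, mul_comm]
  · intro d' hd'
    rcases Nat.lt_or_ge d'.degree d.degree with h | h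
    · rw [hf d' h, zero_smul]
    · rw [key, MvPowerSeries.coeff_monomial_mul, if_neg, smul_zero]
      intro hle
      obtain ⟨x, rfl⟩ := exists_add_of_le hle
      rw [map_add] at h
      have : x.degree = 0 := by omega
      rw [Finsupp.degree_eq_zero_iff] at this
      simp [this] at hd'

end Truncation

/-! ### The Lubin-Tate integrality lemma -/

section Integrality

variable {O L k τ : Type*} [CommRing O] [CommRing k] [Field L] {ι : O →+* L} {ρ : O →+* k}

lemma exists_subst_X_eq_mul {R : Type*} [CommRing R] {P : PowerSeries R}
    (hP : PowerSeries.constantCoeff P = 0) (i : τ) :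
    ∃ u : MvPowerSeries τ R, PowerSeries.subst (MvPowerSeries.X i) P = MvPowerSeries.X i * u ∧
      MvPowerSeries.constantCoeff u = PowerSeries.coeff 1 P := by
  classical
  obtain ⟨P', rfl⟩ := PowerSeries.X_dvd_iff.2 hP
  have hX : PowerSeries.HasSubst (MvPowerSeries.X i : MvPowerSeries τ R) := PowerSeries.HasSubst.X i
  refine ⟨PowerSeries.subst (MvPowerSeries.X i) P', ?_, ?_⟩
  · rw [PowerSeries.subst_mul hX, PowerSeries.subst_X hX]
  · rw [← MvPowerSeries.coeff_zero_eq_constantCoeff_apply, PowerSeries.coeff_subst_single]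
    simp [PowerSeries.coeff_succ_X_mul]

/-- Over a ring of exponential characteristic `p`, raising to the power `q = p ^ f` is the
substitution `X ↦ X ^ q` together with the `q`-power map on coefficients. -/
lemma map_iterateFrobenius_subst_X_pow [Finite τ] (p f : ℕ) [ExpChar k p]
    (H : MvPowerSeries τ k) :
    MvPowerSeries.map (iterateFrobenius k p f)
      (MvPowerSeries.subst (fun i => MvPowerSeries.X i ^ p ^ f) H) = H ^ p ^ f := by
  rw [← MvPowerSeries.map_iterateFrobenius_expand p (expChar_ne_zero k p) H f,
    MvPowerSeries.expand, MvPowerSeries.coe_substAlgHom]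

/-- The Lubin-Tate integrality lemma: a series over the field `L` commuting with the Lubin-Tate
series `P` and with integral linear part is integral. -/
theorem exists_map_eq_of_subst_comm [Finite τ] (hι : Function.Injective ι) {π : O} (hπ0 : π ≠ 0)
    (hρ : ∀ a, ρ a = 0 ↔ π ∣ a) (hu : ∀ j, IsUnit (1 - π ^ (j + 1))) {p f : ℕ} [ExpChar k p]
    (hk : ∀ c : k, c ^ p ^ f = c) {P : PowerSeries O} (hP0 : PowerSeries.constantCoeff P = 0)
    (hP1 : PowerSeries.coeff 1 P = π) (hPk : P.map ρ = PowerSeries.X ^ p ^ f)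
    {G : MvPowerSeries τ L} (hG0 : MvPowerSeries.constantCoeff G = 0)
    (hG1 : ∀ d, d.degree = 1 → MvPowerSeries.coeff d G ∈ ι.range)
    (hG : PowerSeries.subst G (P.map ι) =
      MvPowerSeries.subst (fun i => PowerSeries.subst (MvPowerSeries.X i) (P.map ι)) G) :
    ∃ H : MvPowerSeries τ O, H.map ι = G := by
  classical
  suffices h : ∀ r, ∀ d : τ →₀ ℕ, d.degree = r → MvPowerSeries.coeff d G ∈ ι.range by
    choose H hH using fun d => h _ d rfl
    exact ⟨fun d => H d, by ext d; exact hH d⟩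
  intro r
  induction r using Nat.strong_induction_on with
  | _ r ih =>
  intro d hd
  rcases Nat.lt_or_ge r 2 with hr | hr
  · interval_cases r
    · obtain rfl := (Finsupp.degree_eq_zero_iff d).1 hd
      exact ⟨0, by simp [hG0]⟩
    · exact hG1 d hd
  -- An integral lift H of the part of G of degree below r, with 0 in all other degrees.
  have hex : ∀ d' : τ →₀ ℕ, ∃ a, (d'.degree < r → ι a = MvPowerSeries.coeff d' G) ∧
      (¬ d'.degree < r → a = 0) := by
    intro d'
    by_cases hd' : d'.degree < r
    · obtain ⟨a, ha⟩ := ih _ hd' d' rfl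
      exact ⟨a, fun _ => ha, fun h => absurd hd' h⟩
    · exact ⟨0, fun h => absurd h hd', fun _ => rfl⟩
  choose h hh hh0 using hex
  set H : MvPowerSeries τ O := fun d => h d with hHdef
  have hHc : ∀ d', MvPowerSeries.coeff d' H = h d' := fun _ => rfl
  have hHG : ∀ d' : τ →₀ ℕ, d'.degree < d.degree →
      MvPowerSeries.coeff d' (H.map ι) = MvPowerSeries.coeff d' G := by
    intro d' hd'
    rw [MvPowerSeries.coeff_map, hHc, hh d' (hd ▸ hd')]
  have hH0 : MvPowerSeries.constantCoeff H = 0 := by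
    apply hι
    have := hHG 0 (by rw [hd]; simp; omega)
    simpa [hG0] using this
  have hHι0 : MvPowerSeries.constantCoeff (H.map ι) = 0 := by simp [hH0]
  have hHd : MvPowerSeries.coeff d (H.map ι) = 0 := by
    rw [MvPowerSeries.coeff_map, hHc, hh0 d (by omega), map_zero]
  have hX : ∀ i, PowerSeries.HasSubst (MvPowerSeries.X i : MvPowerSeries τ O) :=
    fun i => PowerSeries.HasSubst.X i
  -- the substitution `X ↦ P(X)`
  have hPι0 : PowerSeries.constantCoeff (P.map ι) = 0 := by
    rw [← PowerSeries.coeff_zero_eq_constantCoeff_apply, PowerSeries.coeff_map,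
      PowerSeries.coeff_zero_eq_constantCoeff_apply, hP0, map_zero]
  choose u hu1 hu2 using fun i : τ => exists_subst_X_eq_mul hPι0 i
  choose w hw1 hw2 using fun i : τ => exists_subst_X_eq_mul (P := P) hP0 i
  -- Passing from G to H changes the coefficient at d of P(G) by π G_d, and that of G(P(X)) by π^r
  -- G_d.
  have e1 := coeff_subst_sub_coeff_subst (P.map ι) hG0 hHι0 d (fun d' hd' => (hHG d' hd').symm)
  rw [hG, hHd, sub_zero, PowerSeries.coeff_map, hP1, smul_eq_mul] at e1
  simp only [hu1] at e1
  have e2 := coeff_subst_X_mul (u := u) (c := ι π) (fun i => by rw [hu2 i]; simp [hP1])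
    (f := G - H.map ι) (d := d) (fun d' hd' => by rw [map_sub, hHG d' hd', sub_self])
  rw [MvPowerSeries.subst_sub (hasSubst_X_mul u), map_sub, map_sub, hHd, sub_zero, hd] at e2
  have hsub : MvPowerSeries.HasSubst
      fun i => PowerSeries.subst (MvPowerSeries.X i : MvPowerSeries τ O) P := by
    simp only [hw1]
    exact hasSubst_X_mul w
  have e3 : (MvPowerSeries.subst (fun i => PowerSeries.subst (MvPowerSeries.X i) P) H).map ι =
      MvPowerSeries.subst (fun i => MvPowerSeries.X i * u i) (H.map ι) := by
    rw [MvPowerSeries.map_subst hsub]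
    congr 1
    ext1 i
    rw [PowerSeries.map_subst (hX i), MvPowerSeries.map_X, hu1]
  have e4 : (PowerSeries.subst H P).map ι = PowerSeries.subst (H.map ι) (P.map ι) :=
    PowerSeries.map_subst (PowerSeries.HasSubst.of_constantCoeff_zero hH0) P
  -- The commutation defect of H at d. Over L it equals (π^r − π) G_d. Over the residue ring P(H)
  -- and H(P(X)) both reduce to H^q, so π divides it. Cancelling π and the unit 1 − π^{r-1} makes
  -- G_d integral.
  set a : O := MvPowerSeries.coeff d (PowerSeries.subst H P) -
    MvPowerSeries.coeff d
      (MvPowerSeries.subst (fun i => PowerSeries.subst (MvPowerSeries.X i) P) H) with ha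
  have hρa : ρ a = 0 := by
    have hk' : iterateFrobenius k p f = RingHom.id k := by
      ext c; simp [iterateFrobenius_def, hk]
    have h1 : (PowerSeries.subst H P).map ρ = (H.map ρ) ^ p ^ f := by
      have hHρ : PowerSeries.HasSubst (H.map ρ) :=
        PowerSeries.HasSubst.of_constantCoeff_zero (by simp [hH0])
      rw [PowerSeries.map_subst (PowerSeries.HasSubst.of_constantCoeff_zero hH0), hPk,
        PowerSeries.subst_pow hHρ, PowerSeries.subst_X hHρ]
    have h2 : (MvPowerSeries.subst (fun i => PowerSeries.subst (MvPowerSeries.X i) P) H).map ρ =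
        (H.map ρ) ^ p ^ f := by
      rw [MvPowerSeries.map_subst hsub, ← map_iterateFrobenius_subst_X_pow, hk',
        MvPowerSeries.map_id, RingHom.id_apply]
      congr 1
      ext1 i
      have hXk : PowerSeries.HasSubst (MvPowerSeries.X i : MvPowerSeries τ k) :=
        PowerSeries.HasSubst.X i
      rw [PowerSeries.map_subst (hX i), MvPowerSeries.map_X, hPk, PowerSeries.subst_pow hXk,
        PowerSeries.subst_X hXk]
    rw [ha, map_sub, ← MvPowerSeries.coeff_map, ← MvPowerSeries.coeff_map, h1, h2, sub_self]
  obtain ⟨b, hb⟩ := (hρ a).1 hρa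
  have hιa : ι a = ι π ^ r * MvPowerSeries.coeff d G - ι π * MvPowerSeries.coeff d G := by
    rw [ha, map_sub, ← MvPowerSeries.coeff_map, ← MvPowerSeries.coeff_map, e3, e4]
    linear_combination e2 - e1
  have hιπ : ι π ≠ 0 := fun h0 => hπ0 (hι (by simpa using h0))
  obtain ⟨v, hv⟩ := (hu (r - 2))
  refine ⟨-(↑v⁻¹ * b), ?_⟩
  have hv' : ι ↑v⁻¹ * (1 - ι π ^ (r - 1)) = 1 := by
    have : (↑v⁻¹ : O) * (1 - π ^ (r - 1)) = 1 := by
      rw [show r - 1 = r - 2 + 1 by omega, ← hv, Units.inv_mul]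
    simpa using congrArg ι this
  have h3 : ι b = -(1 - ι π ^ (r - 1)) * MvPowerSeries.coeff d G := by
    apply mul_left_cancel₀ hιπ
    rw [← map_mul, ← hb, hιa]
    obtain ⟨r, rfl⟩ : ∃ s, r = s + 1 := ⟨r - 1, by omega⟩
    simp only [Nat.add_sub_cancel]
    ring
  rw [map_neg, map_mul, h3]
  linear_combination MvPowerSeries.coeff d G * hv'

end Integrality

/-! ### Rules for composing substitutions -/

section Substitution

variable {R τ υ : Type*} [CommRing R]

lemma mvSubst_subst {a : MvPowerSeries τ R} (ha : PowerSeries.HasSubst a)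
    {b : τ → MvPowerSeries υ R} (hb : MvPowerSeries.HasSubst b) (f : PowerSeries R) :
    MvPowerSeries.subst b (PowerSeries.subst a f) =
      PowerSeries.subst (MvPowerSeries.subst b a) f := by
  rw [PowerSeries.subst_def, PowerSeries.subst_def,
    MvPowerSeries.subst_comp_subst_apply ha.const hb]

lemma subst_mvSubst {a : τ → PowerSeries R} (ha : MvPowerSeries.HasSubst a)
    {b : MvPowerSeries υ R} (hb : PowerSeries.HasSubst b) (f : MvPowerSeries τ R) :
    PowerSeries.subst b (MvPowerSeries.subst a f) =
      MvPowerSeries.subst (fun i => PowerSeries.subst b (a i)) f := by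
  rw [PowerSeries.subst_def, MvPowerSeries.subst_comp_subst_apply ha hb.const]
  rfl

lemma hasSubst_pair {f g : MvPowerSeries υ R} (hf : MvPowerSeries.constantCoeff f = 0)
    (hg : MvPowerSeries.constantCoeff g = 0) : MvPowerSeries.HasSubst ![f, g] :=
  MvPowerSeries.hasSubst_of_constantCoeff_zero fun i => by fin_cases i <;> simpa

lemma mvSubst_pair {f g : MvPowerSeries υ R} {a b : MvPowerSeries τ R}
    (ha : MvPowerSeries.constantCoeff a = 0) (hb : MvPowerSeries.constantCoeff b = 0)
    {c : τ → MvPowerSeries υ R} (hc : MvPowerSeries.HasSubst c)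
    (hf : MvPowerSeries.subst c a = f) (hg : MvPowerSeries.subst c b = g)
    (F : MvPowerSeries (Fin 2) R) :
    MvPowerSeries.subst c (MvPowerSeries.subst ![a, b] F) = MvPowerSeries.subst ![f, g] F := by
  rw [MvPowerSeries.subst_comp_subst_apply (hasSubst_pair ha hb) hc]
  congr 1
  ext1 i
  fin_cases i <;> simp [hf, hg]

lemma map_pair {S : Type*} [CommRing S] (h : R →+* S) {a b : MvPowerSeries τ R}
    (ha : MvPowerSeries.constantCoeff a = 0) (hb : MvPowerSeries.constantCoeff b = 0)
    (F : MvPowerSeries (Fin 2) R) :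
    (MvPowerSeries.subst ![a, b] F).map h = MvPowerSeries.subst ![a.map h, b.map h] (F.map h) := by
  rw [MvPowerSeries.map_subst (hasSubst_pair ha hb)]
  congr 1
  ext1 i
  fin_cases i <;> simp

lemma coeff_subst_eq_sum {S : Type*} [CommRing S] [Algebra R S] {a : PowerSeries S}
    (ha : PowerSeries.constantCoeff a = 0) (f : PowerSeries R) (n : ℕ) :
    PowerSeries.coeff n (PowerSeries.subst a f) =
      ∑ k ∈ Finset.range (n + 1), PowerSeries.coeff k f • PowerSeries.coeff n (a ^ k) := by
  rw [PowerSeries.coeff_subst' (PowerSeries.HasSubst.of_constantCoeff_zero' ha)]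
  refine finsum_eq_sum_of_support_subset _ fun k hk => ?_
  simp only [Finset.coe_range, Set.mem_Iio]
  by_contra hlt
  refine hk ?_
  have : PowerSeries.X ^ k ∣ a ^ k := pow_dvd_pow_of_dvd (PowerSeries.X_dvd_iff.2 ha) k
  simp only [PowerSeries.X_pow_dvd_iff.1 this n (by omega), smul_zero]

lemma coeff_pow_self {a : PowerSeries R} (ha : PowerSeries.constantCoeff a = 0) (n : ℕ) :
    PowerSeries.coeff n (a ^ n) = PowerSeries.coeff 1 a ^ n := by
  obtain ⟨b, rfl⟩ := PowerSeries.X_dvd_iff.2 ha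
  rw [mul_pow, show PowerSeries.coeff n (PowerSeries.X ^ n * b ^ n) =
    PowerSeries.coeff (0 + n) (PowerSeries.X ^ n * b ^ n) by rw [zero_add],
    PowerSeries.coeff_X_pow_mul, show (1 : ℕ) = 0 + 1 from rfl, PowerSeries.coeff_succ_X_mul]
  simp

end Substitution

/-! ### Logarithm and exponential linearizing a series -/

section Logarithm

variable {L : Type*} [Field L]

/-- The coefficients of the logarithm of a series `P ≡ c X`. -/
def logCoeff (c : L) (P : PowerSeries L) : ℕ → L
  | j => if j = 1 then 1 else
      (∑ k : Fin j, logCoeff c P k * PowerSeries.coeff j (P ^ (k : ℕ))) / (c - c ^ j)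

/-- Since the coefficient of X^n in P^n is c^n, the equation l(P) = c l reads (c − c^n) l_n =
∑_{k<n} l_k [X^n] P^k. It determines l_n for n ≥ 2 and is vacuous at n = 1, which leaves the
normalization l_1 = 1 free. -/
theorem exists_log {c : L} (hc : ∀ j, 2 ≤ j → c ^ j ≠ c) {P : PowerSeries L}
    (hP0 : PowerSeries.constantCoeff P = 0) (hP1 : PowerSeries.coeff 1 P = c) :
    ∃ l : PowerSeries L, PowerSeries.constantCoeff l = 0 ∧ PowerSeries.coeff 1 l = 1 ∧
      PowerSeries.subst P l = c • l := by
  have h0 : logCoeff c P 0 = 0 := by rw [logCoeff]; simp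
  have h1 : logCoeff c P 1 = 1 := by rw [logCoeff]; simp
  refine ⟨PowerSeries.mk (logCoeff c P), ?_, by simp [h1], ?_⟩
  · rw [← PowerSeries.coeff_zero_eq_constantCoeff_apply, PowerSeries.coeff_mk, h0]
  ext n
  rw [coeff_subst_eq_sum hP0, Finset.sum_range_succ, coeff_pow_self hP0, hP1]
  simp only [PowerSeries.coeff_mk, smul_eq_mul, map_smul]
  rcases Nat.lt_or_ge n 2 with hn | hn
  · interval_cases n
    · simp [h0]
    · simp [h0, h1]
  · have h2 : c - c ^ n ≠ 0 := sub_ne_zero.2 (hc n hn).symm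
    have h3 := logCoeff.eq_1 c P n
    rw [if_neg (by omega), eq_div_iff h2, Fin.sum_univ_eq_sum_range
      (fun k => logCoeff c P k * PowerSeries.coeff n (P ^ k)) n] at h3
    rw [← h3]
    ring

/-- A pair of inverse series `e`, `l` that conjugate `P` to the multiplication by `c`. -/
structure IsExpLog (c : L) (P e l : PowerSeries L) : Prop where
  exp_zero : PowerSeries.constantCoeff e = 0
  exp_one : PowerSeries.coeff 1 e = 1
  log_zero : PowerSeries.constantCoeff l = 0
  log_one : PowerSeries.coeff 1 l = 1
  exp_log : PowerSeries.subst l e = PowerSeries.X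
  log_exp : PowerSeries.subst e l = PowerSeries.X
  subst_log : PowerSeries.subst P l = c • l
  subst_exp : PowerSeries.subst e P = PowerSeries.rescale c e

lemma rescale_eq_subst_smul {R : Type*} [CommRing R] (c : R) (f : PowerSeries R) :
    PowerSeries.rescale c f = PowerSeries.subst (c • PowerSeries.X : PowerSeries R) f :=
  PowerSeries.rescale_eq_subst c f

/-- Take e to be the compositional inverse of l. Then l(P(e(X))) = c l(e(X)) = cX, and applying e
gives P(e(X)) = e(cX). -/
theorem exists_isExpLog {c : L} (hc : ∀ j, 2 ≤ j → c ^ j ≠ c) {P : PowerSeries L}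
    (hP0 : PowerSeries.constantCoeff P = 0) (hP1 : PowerSeries.coeff 1 P = c) :
    ∃ e l : PowerSeries L, IsExpLog c P e l := by
  obtain ⟨l, hl0, hl1, hl⟩ := exists_log hc hP0 hP1
  have hu : IsUnit (PowerSeries.coeff 1 l) := by rw [hl1]; exact isUnit_one
  set e := l.substInvOfIsUnit hu with he
  have he0 : PowerSeries.constantCoeff e = 0 := by simp [he]
  have hes : PowerSeries.HasSubst e := PowerSeries.HasSubst.of_constantCoeff_zero' he0
  have hls : PowerSeries.HasSubst l := PowerSeries.HasSubst.of_constantCoeff_zero' hl0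
  have hPs : PowerSeries.HasSubst P := PowerSeries.HasSubst.of_constantCoeff_zero' hP0
  have hel : PowerSeries.subst l e = PowerSeries.X := l.subst_substInvOfIsUnit_left hl0 hu
  have hle : PowerSeries.subst e l = PowerSeries.X := l.subst_substInvOfIsUnit_right hl0 hu
  have hPe0 : PowerSeries.constantCoeff (PowerSeries.subst e P) = 0 :=
    PowerSeries.constantCoeff_subst_eq_zero he0 P hP0
  have hPe : PowerSeries.HasSubst (PowerSeries.subst e P : PowerSeries L) :=
    PowerSeries.HasSubst.of_constantCoeff_zero' hPe0
  refine ⟨e, l, he0, by simp [he, hl1], hl0, hl1, hel, hle, hl, ?_⟩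
  rw [rescale_eq_subst_smul]
  have h1 : PowerSeries.subst (PowerSeries.subst e P) l = c • (PowerSeries.X : PowerSeries L) := by
    rw [← PowerSeries.subst_comp_subst_apply hPs hes, hl, PowerSeries.subst_smul hes, hle]
  rw [← h1, ← PowerSeries.subst_comp_subst_apply hls hPe, hel, PowerSeries.subst_X hPe]

end Logarithm

/-! ### The group law e(l(X) + l(Y)) over the field -/

section Group

open MvPowerSeries in
lemma eq_single_of_degree_eq_one {d : Fin 2 →₀ ℕ} (hd : d.degree = 1) :
    d = Finsupp.single 0 1 ∨ d = Finsupp.single 1 1 := by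
  rw [Finsupp.degree_eq_sum, Fin.sum_univ_two] at hd
  have : (d 0 = 1 ∧ d 1 = 0) ∨ (d 0 = 0 ∧ d 1 = 1) := by omega
  rcases this with ⟨h0, h1⟩ | ⟨h0, h1⟩
  · left; ext i; fin_cases i <;> simp [h0, h1]
  · right; ext i; fin_cases i <;> simp [h0, h1]

lemma coeff_X_add_X {R : Type*} [CommRing R] {d : Fin 2 →₀ ℕ} (hd : d.degree = 1) :
    MvPowerSeries.coeff d (MvPowerSeries.X 0 + MvPowerSeries.X 1 : MvPowerSeries (Fin 2) R) = 1 := by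
  rcases eq_single_of_degree_eq_one hd with rfl | rfl <;>
    simp [MvPowerSeries.coeff_index_single_X]

lemma coeff_formalGroup {R : Type*} [CommRing R] (F : FormalGroup R) {d : Fin 2 →₀ ℕ}
    (hd : d.degree = 1) : MvPowerSeries.coeff d F.toPowerSeries = 1 := by
  rcases eq_single_of_degree_eq_one hd with rfl | rfl
  · exact F.lin_coeff_X
  · exact F.lin_coeff_Y

variable {R τ : Type*} [CommRing R]

lemma constantCoeff_subst_X {a : PowerSeries R} (ha : PowerSeries.constantCoeff a = 0) (i : τ) :
    MvPowerSeries.constantCoeff (PowerSeries.subst (MvPowerSeries.X i : MvPowerSeries τ R) a) = 0 :=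
  PowerSeries.constantCoeff_subst_eq_zero (by simp) a ha

/-- The series `e(l(X) + l(Y))`. -/
def conjAdd (e l : PowerSeries R) : MvPowerSeries (Fin 2) R :=
  PowerSeries.subst (PowerSeries.subst (MvPowerSeries.X 0 : MvPowerSeries (Fin 2) R) l +
    PowerSeries.subst (MvPowerSeries.X 1 : MvPowerSeries (Fin 2) R) l) e

lemma subst_conjAdd {e l : PowerSeries R} (hl : PowerSeries.constantCoeff l = 0)
    {a b : MvPowerSeries τ R} (ha : MvPowerSeries.constantCoeff a = 0)
    (hb : MvPowerSeries.constantCoeff b = 0) :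
    MvPowerSeries.subst ![a, b] (conjAdd e l) =
      PowerSeries.subst (PowerSeries.subst a l + PowerSeries.subst b l) e := by
  have hab := hasSubst_pair ha hb
  have h0 : PowerSeries.HasSubst (PowerSeries.subst (MvPowerSeries.X 0 : MvPowerSeries (Fin 2) R) l +
      PowerSeries.subst (MvPowerSeries.X 1 : MvPowerSeries (Fin 2) R) l) :=
    PowerSeries.HasSubst.of_constantCoeff_zero (by simp [constantCoeff_subst_X hl])
  rw [conjAdd, mvSubst_subst h0 hab, MvPowerSeries.subst_add hab,
    mvSubst_subst (PowerSeries.HasSubst.X 0) hab, mvSubst_subst (PowerSeries.HasSubst.X 1) hab,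
    MvPowerSeries.subst_X hab, MvPowerSeries.subst_X hab]
  rfl

variable {L : Type*} [Field L] {c : L} {P e l : PowerSeries L}

namespace IsExpLog

variable (h : IsExpLog c P e l)
include h

lemma log_exp_apply {a : MvPowerSeries τ L} (ha : MvPowerSeries.constantCoeff a = 0) :
    PowerSeries.subst (PowerSeries.subst a e) l = a := by
  have ha' := PowerSeries.HasSubst.of_constantCoeff_zero ha
  rw [← PowerSeries.subst_comp_subst_apply
    (PowerSeries.HasSubst.of_constantCoeff_zero' h.exp_zero) ha', h.log_exp,
    PowerSeries.subst_X ha']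

lemma subst_exp_apply {a : MvPowerSeries τ L} (ha : MvPowerSeries.constantCoeff a = 0) :
    PowerSeries.subst (PowerSeries.subst a e) P = PowerSeries.subst (c • a) e := by
  have ha' := PowerSeries.HasSubst.of_constantCoeff_zero ha
  rw [← PowerSeries.subst_comp_subst_apply
    (PowerSeries.HasSubst.of_constantCoeff_zero' h.exp_zero) ha', h.subst_exp,
    rescale_eq_subst_smul, PowerSeries.subst_comp_subst_apply (PowerSeries.HasSubst.smul_X' c) ha',
    PowerSeries.subst_smul ha', PowerSeries.subst_X ha']

lemma subst_log_apply {a : MvPowerSeries τ L} (hP : PowerSeries.constantCoeff P = 0)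
    (ha : MvPowerSeries.constantCoeff a = 0) :
    PowerSeries.subst (PowerSeries.subst a P) l = c • PowerSeries.subst a l := by
  have ha' := PowerSeries.HasSubst.of_constantCoeff_zero ha
  rw [← PowerSeries.subst_comp_subst_apply
    (PowerSeries.HasSubst.of_constantCoeff_zero' hP) ha', h.subst_log,
    PowerSeries.subst_smul ha']

lemma constantCoeff_conjAdd : MvPowerSeries.constantCoeff (conjAdd e l) = 0 :=
  PowerSeries.constantCoeff_subst_eq_zero (by simp [constantCoeff_subst_X h.log_zero]) _ h.exp_zero

lemma coeff_conjAdd {d : Fin 2 →₀ ℕ} (hd : d.degree = 1) :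
    MvPowerSeries.coeff d (conjAdd e l) = 1 := by
  rw [conjAdd, coeff_subst_of_degree_eq_one e (by simp [constantCoeff_subst_X h.log_zero]) d hd
    h.exp_zero, map_add, coeff_subst_of_degree_eq_one l (by simp) d hd h.log_zero,
    coeff_subst_of_degree_eq_one l (by simp) d hd h.log_zero, h.exp_one, h.log_one, one_smul,
    one_smul, one_smul, ← map_add, coeff_X_add_X hd]

/-- Under l both bracketings become l(a) + l(b) + l(d). -/
lemma subst_subst_conjAdd {a b d : MvPowerSeries τ L} (ha : MvPowerSeries.constantCoeff a = 0)
    (hb : MvPowerSeries.constantCoeff b = 0) (hd : MvPowerSeries.constantCoeff d = 0) :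
    MvPowerSeries.subst ![MvPowerSeries.subst ![a, b] (conjAdd e l), d] (conjAdd e l) =
      MvPowerSeries.subst ![a, MvPowerSeries.subst ![b, d] (conjAdd e l)] (conjAdd e l) := by
  have h0 : ∀ {f : MvPowerSeries τ L}, MvPowerSeries.constantCoeff f = 0 →
      MvPowerSeries.constantCoeff (PowerSeries.subst f l) = 0 := fun hf =>
    PowerSeries.constantCoeff_subst_eq_zero hf _ h.log_zero
  have h1 : ∀ {f g : MvPowerSeries τ L}, MvPowerSeries.constantCoeff f = 0 →
      MvPowerSeries.constantCoeff g = 0 → MvPowerSeries.constantCoeff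
        (PowerSeries.subst (PowerSeries.subst f l + PowerSeries.subst g l) e) = 0 := fun hf hg =>
    PowerSeries.constantCoeff_subst_eq_zero (by simp [h0 hf, h0 hg]) _ h.exp_zero
  rw [subst_conjAdd h.log_zero ha hb, subst_conjAdd h.log_zero hb hd,
    subst_conjAdd h.log_zero (h1 ha hb) hd, subst_conjAdd h.log_zero ha (h1 hb hd),
    h.log_exp_apply (by simp [h0 ha, h0 hb]), h.log_exp_apply (by simp [h0 hb, h0 hd]), add_assoc]

/-- In the coordinate l the series P is multiplication by c, which is additive. This is the
commutation that the integrality lemma requires. -/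
lemma subst_conjAdd_eq (hP : PowerSeries.constantCoeff P = 0) :
    PowerSeries.subst (conjAdd e l) P =
      MvPowerSeries.subst (fun i => PowerSeries.subst (MvPowerSeries.X i) P) (conjAdd e l) := by
  have h2 : (fun i : Fin 2 => PowerSeries.subst (MvPowerSeries.X i : MvPowerSeries (Fin 2) L) P) =
      ![PowerSeries.subst (MvPowerSeries.X 0) P, PowerSeries.subst (MvPowerSeries.X 1) P] := by
    ext1 i; fin_cases i <;> rfl
  rw [h2, subst_conjAdd h.log_zero (constantCoeff_subst_X hP 0) (constantCoeff_subst_X hP 1),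
    h.subst_log_apply hP (by simp), h.subst_log_apply hP (by simp), conjAdd,
    h.subst_exp_apply (by simp [constantCoeff_subst_X h.log_zero]), smul_add]

end IsExpLog

end Group

/-! ### Integral models of the group and of its endomorphisms -/

section Existence

variable {O L k : Type*} [CommRing O] [Field L] [CommRing k] {ι : O →+* L} {ρ : O →+* k}

/-- Existence of the Lubin-Tate formal group. -/
theorem exists_hasEndomorphism (hι : Function.Injective ι) {π : O} (hπ0 : π ≠ 0)
    (hρ : ∀ a, ρ a = 0 ↔ π ∣ a) (hu : ∀ j, IsUnit (1 - π ^ (j + 1))) {p f : ℕ} [ExpChar k p]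
    (hk : ∀ c : k, c ^ p ^ f = c) {P : PowerSeries O} (hP0 : PowerSeries.constantCoeff P = 0)
    (hP1 : PowerSeries.coeff 1 P = π) (hPk : P.map ρ = PowerSeries.X ^ p ^ f)
    {e l : PowerSeries L} (h : IsExpLog (ι π) (P.map ι) e l) :
    ∃ F : FormalGroup O, HasEndomorphism F P := by
  have hPι0 : PowerSeries.constantCoeff (P.map ι) = 0 := by
    rw [← PowerSeries.coeff_zero_eq_constantCoeff_apply, PowerSeries.coeff_map,
      PowerSeries.coeff_zero_eq_constantCoeff_apply, hP0, map_zero]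
  -- The series e(l(X) + l(Y)) commutes with P and has linear part X + Y, so it descends to O. The
  -- group axioms then descend by injectivity of ι.
  obtain ⟨F, hF⟩ := exists_map_eq_of_subst_comm hι hπ0 hρ hu hk hP0 hP1 hPk
    h.constantCoeff_conjAdd (fun d hd => by rw [h.coeff_conjAdd hd]; exact one_mem _)
    (h.subst_conjAdd_eq hPι0)
  have hinj : ∀ {τ : Type} {f g : MvPowerSeries τ O}, f.map ι = g.map ι → f = g := by
    intro τ f g hfg
    ext d
    apply hι
    rw [← MvPowerSeries.coeff_map, hfg, MvPowerSeries.coeff_map]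
  have hF0 : MvPowerSeries.constantCoeff F = 0 := by
    apply hι
    rw [← MvPowerSeries.constantCoeff_map, hF, h.constantCoeff_conjAdd, map_zero]
  have hF1 : ∀ d : Fin 2 →₀ ℕ, d.degree = 1 → MvPowerSeries.coeff d F = 1 := by
    intro d hd
    apply hι
    rw [← MvPowerSeries.coeff_map, hF, h.coeff_conjAdd hd, map_one]
  have hFX : ∀ i j : Fin 3, MvPowerSeries.constantCoeff
      (MvPowerSeries.subst ![MvPowerSeries.X i, MvPowerSeries.X j] F : MvPowerSeries (Fin 3) O) = 0 :=
    fun i j => MvPowerSeries.constantCoeff_subst_eq_zero MvPowerSeries.HasSubst.X_X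
      (fun s => by fin_cases s <;> simp) hF0
  let G : FormalGroup O :=
    { toPowerSeries := F
      zero_constantCoeff := hF0
      lin_coeff_X := hF1 _ (by simp)
      lin_coeff_Y := hF1 _ (by simp)
      assoc := by
        apply hinj
        rw [map_pair ι (hFX _ _) (by simp), map_pair ι (by simp) (hFX _ _),
          map_pair ι (by simp) (by simp), map_pair ι (by simp) (by simp), hF]
        simp only [MvPowerSeries.map_X]
        exact h.subst_subst_conjAdd (by simp) (by simp) (by simp) }
  refine ⟨G, ⟨?_⟩, ?_⟩
  · apply hinj
    change F.map ι = (MvPowerSeries.subst _ F).map ι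
    rw [map_pair ι (by simp) (by simp), hF, MvPowerSeries.map_X, MvPowerSeries.map_X,
      subst_conjAdd h.log_zero (by simp) (by simp), add_comm]
    rfl
  · change PowerSeries.subst F P = MvPowerSeries.subst _ F
    apply hinj
    rw [PowerSeries.map_subst (PowerSeries.HasSubst.of_constantCoeff_zero hF0),
      map_pair ι (constantCoeff_subst_X hP0 _) (constantCoeff_subst_X hP0 _),
      PowerSeries.map_subst (PowerSeries.HasSubst.X _),
      PowerSeries.map_subst (PowerSeries.HasSubst.X _), hF, h.subst_conjAdd_eq hPι0]
    congr 1
    ext1 i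
    fin_cases i <;> simp

/-- Existence of the series `[a]_P`. -/
theorem exists_isMulSeries (hι : Function.Injective ι) {π : O} (hπ0 : π ≠ 0)
    (hρ : ∀ a, ρ a = 0 ↔ π ∣ a) (hu : ∀ j, IsUnit (1 - π ^ (j + 1))) {p f : ℕ} [ExpChar k p]
    (hk : ∀ c : k, c ^ p ^ f = c) {P : PowerSeries O} (hP0 : PowerSeries.constantCoeff P = 0)
    (hP1 : PowerSeries.coeff 1 P = π) (hPk : P.map ρ = PowerSeries.X ^ p ^ f)
    {e l : PowerSeries L} (h : IsExpLog (ι π) (P.map ι) e l) (a : O) :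
    ∃ g : PowerSeries O, IsMulSeries P a g := by
  have hPι0 : PowerSeries.constantCoeff (P.map ι) = 0 := by
    rw [← PowerSeries.coeff_zero_eq_constantCoeff_apply, PowerSeries.coeff_map,
      PowerSeries.coeff_zero_eq_constantCoeff_apply, hP0, map_zero]
  have hPs := PowerSeries.HasSubst.of_constantCoeff_zero' hPι0
  have hal0 : MvPowerSeries.constantCoeff (ι a • l) = 0 := by
    have := h.log_zero
    rw [PowerSeries.constantCoeff] at this
    simp [this]
  have hals : PowerSeries.HasSubst (ι a • l) := PowerSeries.HasSubst.of_constantCoeff_zero hal0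
  -- Over L the candidate is e(a l(X)): in the coordinate l it is multiplication by a, which
  -- commutes with multiplication by c.
  set G : PowerSeries L := PowerSeries.subst (ι a • l) e with hG
  have hG0 : PowerSeries.constantCoeff G = 0 :=
    PowerSeries.constantCoeff_subst_eq_zero hal0 _ h.exp_zero
  have hcomm : PowerSeries.subst G (P.map ι) = PowerSeries.subst (P.map ι) G := by
    rw [hG, h.subst_exp_apply hal0, PowerSeries.subst_comp_subst_apply hals hPs,
      PowerSeries.subst_smul hPs, h.subst_log, smul_comm]
  have hG1 : PowerSeries.coeff 1 G = ι a := by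
    rw [PowerSeries.coeff, hG, coeff_subst_of_degree_eq_one e hal0 _ (by simp) h.exp_zero,
      h.exp_one, one_smul]
    change PowerSeries.coeff 1 (ι a • l) = _
    simp [h.log_one]
  obtain ⟨g, hg⟩ := exists_map_eq_of_subst_comm (τ := Unit) (G := G) hι hπ0 hρ hu hk hP0 hP1 hPk hG0
    (fun d hd => by
      have : d = Finsupp.single () 1 := by
        ext; simpa [Finsupp.degree_eq_sum] using hd
      subst this
      exact ⟨a, hG1.symm⟩)
    (by
      rw [hcomm, PowerSeries.subst_def]
      congr 1
      ext1 i
      exact (PowerSeries.X_subst (P.map ι)).symm)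
  have hg' : PowerSeries.map ι g = G := hg
  have hg0 : PowerSeries.constantCoeff g = 0 := by
    apply hι
    rw [map_zero, ← hG0, ← hg', ← PowerSeries.coeff_zero_eq_constantCoeff_apply,
      ← PowerSeries.coeff_zero_eq_constantCoeff_apply, PowerSeries.coeff_map]
  refine ⟨g, hg0, ?_, ?_⟩
  · apply hι
    rw [← hG1, ← hg', PowerSeries.coeff_map]
  · have h1 : PowerSeries.map ι (PowerSeries.subst g P) =
        PowerSeries.map ι (PowerSeries.subst P g) := by
      rw [PowerSeries.map, PowerSeries.map_subst (PowerSeries.HasSubst.of_constantCoeff_zero' hg0),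
        PowerSeries.map_subst (PowerSeries.HasSubst.of_constantCoeff_zero' hP0), hg]
      exact hcomm.trans (by rw [hg']; rfl)
    ext n
    apply hι
    rw [← PowerSeries.coeff_map, h1, PowerSeries.coeff_map]

end Existence

/-! ### Characterization of the exponential and the action of endomorphisms -/

section Exponential

variable {R τ : Type*} [CommRing R]

lemma IsFormalExp.map {S : Type*} [CommRing S] {F : FormalGroup R} {e : PowerSeries R}
    (he : IsFormalExp F e) (h : R →+* S) : IsFormalExp (F.map h) (e.map h) := by
  have hX : ∀ i : Fin 2, PowerSeries.HasSubst (MvPowerSeries.X i : MvPowerSeries (Fin 2) R) :=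
    fun i => PowerSeries.HasSubst.X i
  refine ⟨?_, by rw [PowerSeries.coeff_map, he.coeff_one_eq, map_one], ?_⟩
  · rw [← PowerSeries.coeff_zero_eq_constantCoeff_apply, PowerSeries.coeff_map,
      PowerSeries.coeff_zero_eq_constantCoeff_apply, he.constantCoeff_eq, map_zero]
  · have := congrArg (MvPowerSeries.map h) he.map_add
    rw [PowerSeries.map_subst ((hX 0).add (hX 1)),
      map_pair h (constantCoeff_subst_X he.constantCoeff_eq 0)
        (constantCoeff_subst_X he.constantCoeff_eq 1),
      PowerSeries.map_subst (hX 0), PowerSeries.map_subst (hX 1)] at this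
    simpa using this

lemma IsFormalExp.subst_add {F : FormalGroup R} {e : PowerSeries R} (he : IsFormalExp F e)
    {a b : MvPowerSeries τ R} (ha : MvPowerSeries.constantCoeff a = 0)
    (hb : MvPowerSeries.constantCoeff b = 0) :
    PowerSeries.subst (a + b) e =
      MvPowerSeries.subst ![PowerSeries.subst a e, PowerSeries.subst b e] F.toPowerSeries := by
  have hX : ∀ i : Fin 2, PowerSeries.HasSubst (MvPowerSeries.X i : MvPowerSeries (Fin 2) R) :=
    fun i => PowerSeries.HasSubst.X i
  have hab := hasSubst_pair ha hb
  have hX' : ∀ i : Fin 2, MvPowerSeries.subst ![a, b]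
      (PowerSeries.subst (MvPowerSeries.X i : MvPowerSeries (Fin 2) R) e) =
        PowerSeries.subst (![a, b] i) e := by
    intro i
    rw [mvSubst_subst (hX i) hab, MvPowerSeries.subst_X hab]
  have := congrArg (MvPowerSeries.subst ![a, b]) he.map_add
  rw [mvSubst_subst ((hX 0).add (hX 1)) hab, MvPowerSeries.subst_add hab, MvPowerSeries.subst_X hab,
    MvPowerSeries.subst_X hab, mvSubst_pair (constantCoeff_subst_X he.constantCoeff_eq 0)
      (constantCoeff_subst_X he.constantCoeff_eq 1) hab (hX' 0) (hX' 1)] at this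
  simpa using this

lemma HasEndomorphism.subst_subst {F : FormalGroup R} {P : PowerSeries R}
    (hF : HasEndomorphism F P) (hP : PowerSeries.constantCoeff P = 0)
    {a b : MvPowerSeries τ R} (ha : MvPowerSeries.constantCoeff a = 0)
    (hb : MvPowerSeries.constantCoeff b = 0) :
    PowerSeries.subst (MvPowerSeries.subst ![a, b] F.toPowerSeries) P =
      MvPowerSeries.subst ![PowerSeries.subst a P, PowerSeries.subst b P] F.toPowerSeries := by
  have hX : ∀ i : Fin 2, PowerSeries.HasSubst (MvPowerSeries.X i : MvPowerSeries (Fin 2) R) :=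
    fun i => PowerSeries.HasSubst.X i
  have hab := hasSubst_pair ha hb
  have hX' : ∀ i : Fin 2, MvPowerSeries.subst ![a, b]
      (PowerSeries.subst (MvPowerSeries.X i : MvPowerSeries (Fin 2) R) P) =
        PowerSeries.subst (![a, b] i) P := by
    intro i
    rw [mvSubst_subst (hX i) hab, MvPowerSeries.subst_X hab]
  have := congrArg (MvPowerSeries.subst ![a, b]) hF.2
  rw [mvSubst_subst (PowerSeries.HasSubst.of_constantCoeff_zero F.zero_constantCoeff) hab,
    mvSubst_pair (constantCoeff_subst_X hP 0)
      (constantCoeff_subst_X hP 1) hab (hX' 0) (hX' 1)] at this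
  simpa using this

lemma HasEndomorphism.map_subst {S : Type*} [CommRing S] {F : FormalGroup R} {P : PowerSeries R}
    (hF : HasEndomorphism F P) (hP : PowerSeries.constantCoeff P = 0) (h : R →+* S) :
    HasEndomorphism (F.map h) (P.map h) := by
  refine ⟨⟨?_⟩, ?_⟩
  · have := congrArg (MvPowerSeries.map h) hF.1.comm
    rw [map_pair h (by simp) (by simp)] at this
    simpa using this
  · have := congrArg (MvPowerSeries.map h) hF.2
    rw [PowerSeries.map_subst (PowerSeries.HasSubst.of_constantCoeff_zero F.zero_constantCoeff),
      map_pair h (constantCoeff_subst_X hP 0) (constantCoeff_subst_X hP 1),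
      PowerSeries.map_subst (PowerSeries.HasSubst.X _),
      PowerSeries.map_subst (PowerSeries.HasSubst.X _)] at this
    simpa using this

variable {L : Type*} [Field L] {c : L} {P e l : PowerSeries L}

lemma coeff_mvSubst_of_degree_eq_one {F : FormalGroup L} (he0 : PowerSeries.constantCoeff e = 0)
    (he1 : PowerSeries.coeff 1 e = 1) {d : Fin 2 →₀ ℕ} (hd : d.degree = 1) :
    MvPowerSeries.coeff d (MvPowerSeries.subst
      ![PowerSeries.subst (MvPowerSeries.X (0 : Fin 2) : MvPowerSeries (Fin 2) L) e,
        PowerSeries.subst (MvPowerSeries.X (1 : Fin 2) : MvPowerSeries (Fin 2) L) e]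
      F.toPowerSeries) = 1 := by
  choose u hu1 hu2 using fun i : Fin 2 => exists_subst_X_eq_mul he0 i
  have h1 : ![PowerSeries.subst (MvPowerSeries.X (0 : Fin 2) : MvPowerSeries (Fin 2) L) e,
      PowerSeries.subst (MvPowerSeries.X (1 : Fin 2) : MvPowerSeries (Fin 2) L) e] =
      fun i => MvPowerSeries.X i * u i := by
    ext1 i
    fin_cases i <;> simp [hu1]
  rw [h1, coeff_subst_X_mul (c := 1) (fun i => by rw [hu2, he1]), one_pow, one_mul,
    coeff_formalGroup F hd]
  intro d' hd'
  rw [hd, Nat.lt_one_iff, Finsupp.degree_eq_zero_iff] at hd'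
  rw [hd', MvPowerSeries.coeff_zero_eq_constantCoeff_apply, F.zero_constantCoeff]

/-- The series conjugating `P` to multiplication by `c` is an exponential of every formal group
having `P` as an endomorphism. -/
theorem IsExpLog.isFormalExp (h : IsExpLog c P e l) (hc : ∀ j, 2 ≤ j → c ^ j ≠ c)
    (hP0 : PowerSeries.constantCoeff P = 0) (hP1 : PowerSeries.coeff 1 P = c)
    {F : FormalGroup L} (hF : HasEndomorphism F P) : IsFormalExp F e := by
  refine ⟨h.exp_zero, h.exp_one, ?_⟩
  have hX : ∀ i : Fin 2, PowerSeries.HasSubst (MvPowerSeries.X i : MvPowerSeries (Fin 2) L) :=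
    fun i => PowerSeries.HasSubst.X i
  have hs : MvPowerSeries.HasSubst ((fun _ => c : Fin 2 → L) • (MvPowerSeries.X :
      Fin 2 → MvPowerSeries (Fin 2) L)) := MvPowerSeries.HasSubst.smul_X _
  have hX' : ∀ i : Fin 2, MvPowerSeries.subst ((fun _ => c : Fin 2 → L) • MvPowerSeries.X)
      (PowerSeries.subst (MvPowerSeries.X i : MvPowerSeries (Fin 2) L) e) =
        PowerSeries.subst (c • (MvPowerSeries.X i : MvPowerSeries (Fin 2) L)) e := by
    intro i
    rw [mvSubst_subst (hX i) hs, MvPowerSeries.subst_X hs]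
    rfl
  -- Both e(X + Y) and F(e(X), e(Y)) satisfy P(G) = G(cX, cY) and have linear part X + Y.
  refine eq_of_subst_eq_rescale (D := P) hP1 hc
    (PowerSeries.constantCoeff_subst_eq_zero (by simp) _ h.exp_zero)
    (MvPowerSeries.constantCoeff_subst_eq_zero
      (hasSubst_pair (constantCoeff_subst_X h.exp_zero 0) (constantCoeff_subst_X h.exp_zero 1))
      (fun i => by
        fin_cases i
        · exact constantCoeff_subst_X h.exp_zero 0
        · exact constantCoeff_subst_X h.exp_zero 1) F.zero_constantCoeff) ?_ ?_ ?_
  · rw [h.subst_exp_apply (by simp), MvPowerSeries.rescale_eq_subst,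
      mvSubst_subst ((hX 0).add (hX 1)) hs, MvPowerSeries.subst_add hs, MvPowerSeries.subst_X hs,
      MvPowerSeries.subst_X hs, smul_add]
    rfl
  · rw [hF.subst_subst hP0 (constantCoeff_subst_X h.exp_zero 0) (constantCoeff_subst_X h.exp_zero 1),
      h.subst_exp_apply (by simp), h.subst_exp_apply (by simp), MvPowerSeries.rescale_eq_subst,
      mvSubst_pair (constantCoeff_subst_X h.exp_zero 0)
      (constantCoeff_subst_X h.exp_zero 1) hs (hX' 0) (hX' 1)]
  · intro d hd
    rw [coeff_mvSubst_of_degree_eq_one h.exp_zero h.exp_one hd,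
      coeff_subst_of_degree_eq_one e (by simp) d hd h.exp_zero, h.exp_one, one_smul,
      coeff_X_add_X hd]

/-- In characteristic zero a formal group has at most one exponential. -/
theorem IsFormalExp.unique [CharZero L] {F : FormalGroup L} {e₁ e₂ : PowerSeries L}
    (h₁ : IsFormalExp F e₁) (h₂ : IsFormalExp F e₂) : e₁ = e₂ := by
  -- D = F(X, X) is duplication. Any exponential satisfies D(e(X)) = e(2X), and in characteristic
  -- zero 2^j ≠ 2 for j ≥ 2, so the rigidity of `eq_of_subst_eq_rescale` applies without reference
  -- to P.
  set D : PowerSeries L := MvPowerSeries.subst ![PowerSeries.X, PowerSeries.X] F.toPowerSeries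
    with hD
  have hXX : MvPowerSeries.HasSubst ![(PowerSeries.X : PowerSeries L), PowerSeries.X] :=
    hasSubst_pair (MvPowerSeries.constantCoeff_X ()) (MvPowerSeries.constantCoeff_X ())
  have hD0 : PowerSeries.constantCoeff D = 0 :=
    MvPowerSeries.constantCoeff_subst_eq_zero hXX (fun i => by
      fin_cases i <;> exact MvPowerSeries.constantCoeff_X ()) F.zero_constantCoeff
  have key : ∀ {e : PowerSeries L}, IsFormalExp F e →
      PowerSeries.subst e D = PowerSeries.rescale 2 e := by
    intro e he
    have hes := PowerSeries.HasSubst.of_constantCoeff_zero' he.constantCoeff_eq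
    rw [rescale_eq_subst_smul, two_smul, he.subst_add (a := PowerSeries.X) (b := PowerSeries.X)
      (MvPowerSeries.constantCoeff_X ()) (MvPowerSeries.constantCoeff_X ()), hD, subst_mvSubst hXX hes]
    congr 1
    ext1 i
    have hX : PowerSeries.subst (PowerSeries.X : PowerSeries L) e = e := PowerSeries.X_subst e
    fin_cases i
    · exact (PowerSeries.subst_X hes).trans hX.symm
    · exact (PowerSeries.subst_X hes).trans hX.symm
  have hD1 : PowerSeries.coeff 1 D = 2 := by
    have h := coeff_subst_of_degree_eq_one D (G := e₁) h₁.constantCoeff_eq (Finsupp.single () 1)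
      (by simp) hD0
    rw [key h₁] at h
    change PowerSeries.coeff 1 (PowerSeries.rescale 2 e₁) = _ • PowerSeries.coeff 1 e₁ at h
    simpa [h₁.coeff_one_eq] using h.symm
  refine eq_of_subst_eq_rescale (τ := Unit) (D := D) hD1 (fun j hj => ?_) h₁.constantCoeff_eq
    h₂.constantCoeff_eq ?_ ?_ ?_
  · have : (2 : ℕ) ^ j ≠ 2 := by
      have : 2 ^ 1 < 2 ^ j := Nat.pow_lt_pow_right (by norm_num) hj
      omega
    exact_mod_cast this
  · rw [key h₁, PowerSeries.rescale_eq]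
  · rw [key h₂, PowerSeries.rescale_eq]
  · intro d hd
    have : d = Finsupp.single () 1 := by
      ext; simpa [Finsupp.degree_eq_sum] using hd
    subst this
    exact h₁.coeff_one_eq.trans h₂.coeff_one_eq.symm

/-- A series `g` commuting with `P` acts on the exponential through its linear coefficient. -/
theorem IsExpLog.subst_exp_of_comm (h : IsExpLog c P e l) (hc : ∀ j, 2 ≤ j → c ^ j ≠ c)
    (hP0 : PowerSeries.constantCoeff P = 0) (hP1 : PowerSeries.coeff 1 P = c) {a : L}
    {g : PowerSeries L} (hg : IsMulSeries P a g) :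
    PowerSeries.subst e g = PowerSeries.rescale a e := by
  have hes := PowerSeries.HasSubst.of_constantCoeff_zero' h.exp_zero
  have hgs := PowerSeries.HasSubst.of_constantCoeff_zero' hg.constantCoeff_eq
  have hPs := PowerSeries.HasSubst.of_constantCoeff_zero' hP0
  have hcX : PowerSeries.HasSubst (c • PowerSeries.X : PowerSeries L) :=
    PowerSeries.HasSubst.smul_X' c
  have haX : PowerSeries.HasSubst (a • PowerSeries.X : PowerSeries L) :=
    PowerSeries.HasSubst.smul_X' a
  -- Both g(e(X)) and e(aX) are carried by P to their rescaling by c, and both have linear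
  -- coefficient a.
  refine eq_of_subst_eq_rescale (τ := Unit) (D := P) hP1 hc
    (PowerSeries.constantCoeff_subst_eq_zero h.exp_zero _ hg.constantCoeff_eq) ?_ ?_ ?_ ?_
  · change PowerSeries.constantCoeff _ = 0
    rw [← PowerSeries.coeff_zero_eq_constantCoeff_apply, PowerSeries.coeff_rescale,
      PowerSeries.coeff_zero_eq_constantCoeff_apply, h.exp_zero, mul_zero]
  · rw [← PowerSeries.rescale_eq, ← PowerSeries.subst_comp_subst_apply hgs hes, hg.commutes,
      PowerSeries.subst_comp_subst_apply hPs hes, h.subst_exp, rescale_eq_subst_smul,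
      rescale_eq_subst_smul, PowerSeries.subst_comp_subst_apply hes hcX]
  · rw [← PowerSeries.rescale_eq, rescale_eq_subst_smul a e, h.subst_exp_apply (by
      change PowerSeries.constantCoeff (a • PowerSeries.X) = 0
      simp), rescale_eq_subst_smul,
      PowerSeries.subst_comp_subst_apply haX hcX, PowerSeries.subst_smul hcX,
      PowerSeries.subst_X hcX, smul_comm]
  · intro d hd
    rw [coeff_subst_of_degree_eq_one g h.exp_zero d hd hg.constantCoeff_eq, hg.coeff_one_eq]
    have : d = Finsupp.single () 1 := by
      ext; simpa [Finsupp.degree_eq_sum] using hd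
    subst this
    change a • PowerSeries.coeff 1 e = PowerSeries.coeff 1 (PowerSeries.rescale a e)
    simp [h.exp_one]

lemma IsMulSeries.map {S : Type*} [CommRing S] {P g : PowerSeries R} {a : R}
    (hg : IsMulSeries P a g) (hP : PowerSeries.constantCoeff P = 0) (h : R →+* S) :
    IsMulSeries (P.map h) (h a) (g.map h) := by
  refine ⟨?_, by rw [PowerSeries.coeff_map, hg.coeff_one_eq], ?_⟩
  · rw [← PowerSeries.coeff_zero_eq_constantCoeff_apply, PowerSeries.coeff_map,
      PowerSeries.coeff_zero_eq_constantCoeff_apply, hg.constantCoeff_eq, map_zero]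
  · have := congrArg (PowerSeries.map h) hg.commutes
    rw [PowerSeries.map, PowerSeries.map_subst
      (PowerSeries.HasSubst.of_constantCoeff_zero' hg.constantCoeff_eq),
      PowerSeries.map_subst (PowerSeries.HasSubst.of_constantCoeff_zero' hP)] at this
    exact this

end Exponential

/-! ### Dwork-type integrality -/

section Frobenius

lemma constantCoeff_map' {R S : Type*} [CommRing R] [CommRing S] (h : R →+* S) {f : PowerSeries R}
    (hf : PowerSeries.constantCoeff f = 0) : PowerSeries.constantCoeff (f.map h) = 0 := by
  rw [← PowerSeries.coeff_zero_eq_constantCoeff_apply, PowerSeries.coeff_map,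
    PowerSeries.coeff_zero_eq_constantCoeff_apply, hf, map_zero]

lemma map_powerSubst {R S : Type*} [CommRing R] [CommRing S] (h : R →+* S) {a : PowerSeries R}
    (ha : PowerSeries.constantCoeff a = 0) (f : PowerSeries R) :
    PowerSeries.map h (PowerSeries.subst a f) = PowerSeries.subst (a.map h) (f.map h) :=
  PowerSeries.map_subst (PowerSeries.HasSubst.of_constantCoeff_zero' ha) f

lemma map_powerPair {R S : Type*} [CommRing R] [CommRing S] (h : R →+* S) {a b : PowerSeries R}
    (ha : PowerSeries.constantCoeff a = 0) (hb : PowerSeries.constantCoeff b = 0)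
    (F : FormalGroup R) :
    PowerSeries.map h (MvPowerSeries.subst ![a, b] F.toPowerSeries) =
      MvPowerSeries.subst ![a.map h, b.map h] (F.map h).toPowerSeries :=
  map_pair h ha hb _

lemma constantCoeff_pair {R : Type*} [CommRing R] {a b : PowerSeries R}
    (ha : PowerSeries.constantCoeff a = 0) (hb : PowerSeries.constantCoeff b = 0)
    (F : FormalGroup R) :
    PowerSeries.constantCoeff
      (MvPowerSeries.subst ![a, b] F.toPowerSeries : PowerSeries R) = 0 :=
  MvPowerSeries.constantCoeff_subst_eq_zero (hasSubst_pair ha hb)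
    (fun i => by fin_cases i; exacts [ha, hb]) F.zero_constantCoeff

lemma coeff_powerSubst_sub {R : Type*} [CommRing R] (D : PowerSeries R) {G H : PowerSeries R}
    (hG : PowerSeries.constantCoeff G = 0) (hH : PowerSeries.constantCoeff H = 0) (n : ℕ)
    (h : ∀ m < n, PowerSeries.coeff m G = PowerSeries.coeff m H) :
    PowerSeries.coeff n (PowerSeries.subst G D) - PowerSeries.coeff n (PowerSeries.subst H D) =
      PowerSeries.coeff 1 D * (PowerSeries.coeff n G - PowerSeries.coeff n H) := by
  refine coeff_subst_sub_coeff_subst (τ := Unit) D hG hH (Finsupp.single () n) fun d hd => ?_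
  have hd' : d = Finsupp.single () (d ()) := by ext; simp
  rw [hd'] at hd ⊢
  exact h _ (by simpa using hd)

/-- Only the coefficients up to degree `n` of `a` matter for the degree `n` coefficient of
`F(a, b)`. -/
lemma coeff_pair_congr {R : Type*} [CommRing R] {a a' b : PowerSeries R}
    (ha : PowerSeries.constantCoeff a = 0) (ha' : PowerSeries.constantCoeff a' = 0)
    (hb : PowerSeries.constantCoeff b = 0) (F : MvPowerSeries (Fin 2) R) (n : ℕ)
    (h : ∀ m ≤ n, PowerSeries.coeff m a = PowerSeries.coeff m a') :
    PowerSeries.coeff n (MvPowerSeries.subst ![a, b] F : PowerSeries R) =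
      PowerSeries.coeff n (MvPowerSeries.subst ![a', b] F : PowerSeries R) := by
  rw [PowerSeries.coeff, MvPowerSeries.coeff_subst (hasSubst_pair ha hb),
    MvPowerSeries.coeff_subst (hasSubst_pair ha' hb)]
  refine finsum_congr fun d => ?_
  congr 1
  change PowerSeries.coeff n _ = PowerSeries.coeff n _
  rw [Finsupp.prod_fintype _ _ (by simp), Finsupp.prod_fintype _ _ (by simp),
    Fin.prod_univ_two, Fin.prod_univ_two]
  have h1 : PowerSeries.X ^ (n + 1) ∣ a - a' := by
    rw [PowerSeries.X_pow_dvd_iff]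
    intro m hm
    rw [map_sub, h m (by omega), sub_self]
  have h2 : PowerSeries.X ^ (n + 1) ∣ a ^ d 0 * b ^ d 1 - a' ^ d 0 * b ^ d 1 := by
    rw [← sub_mul]
    exact (h1.trans (sub_dvd_pow_sub_pow _ _ _)).mul_right _
  have h3 := PowerSeries.X_pow_dvd_iff.1 h2 n (by omega)
  rw [map_sub, sub_eq_zero] at h3
  exact h3

lemma exists_truncation {A S : Type*} [CommRing A] [CommRing S] {ι : A →+* S} {y : PowerSeries S}
    {r : ℕ} (h : ∀ n < r, PowerSeries.coeff n y ∈ ι.range) :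
    ∃ H : PowerSeries A, (∀ n < r, ι (PowerSeries.coeff n H) = PowerSeries.coeff n y) ∧
      ∀ n, r ≤ n → PowerSeries.coeff n H = 0 := by
  classical
  choose g hg using h
  refine ⟨PowerSeries.mk fun n => if hn : n < r then g n hn else 0, fun n hn => ?_, fun n hn => ?_⟩
  · rw [PowerSeries.coeff_mk, dif_pos hn, hg]
  · rw [PowerSeries.coeff_mk, dif_neg (by omega)]

lemma exists_map_eq_of_coeff_mem {A S : Type*} [CommRing A] [CommRing S] {ι : A →+* S}
    {y : PowerSeries S} (h : ∀ n, PowerSeries.coeff n y ∈ ι.range) :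
    ∃ Y : PowerSeries A, Y.map ι = y := by
  choose g hg using h
  exact ⟨PowerSeries.mk g, by ext n; simp [hg]⟩

/-- A Dwork-type integrality lemma: if `σ` lifts the `q`-power map modulo `π` and `y` satisfies
`P(y) = F(yᵠ, v)` with `φ` the extension of `σ` by `X ↦ X ^ q` and `v` divisible by `π`, then `y`
is integral. -/
theorem exists_map_eq_of_frobenius {A S κ : Type*} [CommRing A] [CommRing S] [IsDomain S]
    [CommRing κ] {ι : A →+* S} (hι : Function.Injective ι) {ρ : A →+* κ} {σ : A →+* A}
    {σ' : S →+* S} (hσ : ∀ a, ι (σ a) = σ' (ι a)) {p f : ℕ} [ExpChar κ p] (hq : 1 < p ^ f)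
    (hσρ : ∀ a, ρ (σ a) = ρ a ^ p ^ f) {π : A} (hπ0 : π ≠ 0) (hρ : ∀ a, ρ a = 0 ↔ π ∣ a)
    {P : PowerSeries A} (hP1 : PowerSeries.coeff 1 P = π) (hPκ : P.map ρ = PowerSeries.X ^ p ^ f)
    (F : FormalGroup A) {y : PowerSeries S} (hy0 : PowerSeries.constantCoeff y = 0)
    {v : PowerSeries A} (hv0 : PowerSeries.constantCoeff v = 0) (hvρ : v.map ρ = 0)
    (h : PowerSeries.subst y (P.map ι) = MvPowerSeries.subst
      ![(y.map σ').expand (p ^ f) (by omega), v.map ι] (F.map ι).toPowerSeries) :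
    ∃ Y : PowerSeries A, Y.map ι = y := by
  have hq0 : p ^ f ≠ 0 := by omega
  refine exists_map_eq_of_coeff_mem fun r => ?_
  induction r using Nat.strong_induction_on with
  | _ r ih =>
  rcases Nat.eq_zero_or_pos r with rfl | hr
  · exact ⟨0, by rw [map_zero, PowerSeries.coeff_zero_eq_constantCoeff_apply, hy0]⟩
  -- H is an integral lift of y in degrees below r, and its coefficient at r is 0. Replacing y by H
  -- on the left of the equation therefore costs exactly π y_r at degree r.
  obtain ⟨H, hH, hHr⟩ := exists_truncation ih
  have hH0 : PowerSeries.constantCoeff H = 0 := by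
    apply hι
    rw [← PowerSeries.coeff_zero_eq_constantCoeff_apply, hH 0 hr, map_zero,
      PowerSeries.coeff_zero_eq_constantCoeff_apply, hy0]
  have hHι0 := constantCoeff_map' ι hH0
  have hv0' := constantCoeff_map' ι hv0
  have hφ0 : PowerSeries.constantCoeff ((H.map σ).expand (p ^ f) hq0) = 0 := by
    rw [PowerSeries.constantCoeff_expand, constantCoeff_map' σ hH0]
  have hφι : (((H.map σ).expand (p ^ f) hq0).map ι) =
      ((H.map ι).map σ').expand (p ^ f) hq0 := by
    rw [PowerSeries.map_expand]
    congr 1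
    ext n
    simp [hσ]
  have hφy0 : PowerSeries.constantCoeff ((y.map σ').expand (p ^ f) hq0) = 0 := by
    rw [PowerSeries.constantCoeff_expand, constantCoeff_map' σ' hy0]
  have e1 := coeff_powerSubst_sub (P.map ι) hy0 hHι0 r (fun m hm => by
    rw [PowerSeries.coeff_map, hH m hm])
  rw [PowerSeries.coeff_map, PowerSeries.coeff_map, hHr r le_rfl, map_zero, sub_zero, hP1, h] at e1
  -- The coefficient of φ(y) at m comes from the coefficient of y at m / q, and m / q < r for m ≤ r
  -- because q > 1. So φ(y) may be replaced by φ(H) on the right at no cost.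
  rw [coeff_pair_congr hφy0 (a' := ((H.map σ).expand (p ^ f) hq0).map ι)
    (constantCoeff_map' ι hφ0) hv0' _ r (by
      intro m hm
      rw [hφι, PowerSeries.coeff_expand, PowerSeries.coeff_expand]
      split_ifs with hd
      · have : m / p ^ f < r := by
          rcases Nat.eq_zero_or_pos m with rfl | hm0
          · simpa using hr
          · exact (Nat.div_lt_self hm0 hq).trans_le hm
        rw [PowerSeries.coeff_map, PowerSeries.coeff_map, PowerSeries.coeff_map, hH _ this]
      · rfl),
    ← map_powerPair ι hφ0 hv0, ← map_powerSubst ι hH0, PowerSeries.coeff_map,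
    PowerSeries.coeff_map, ← map_sub] at e1
  set a := PowerSeries.coeff r (MvPowerSeries.subst ![(H.map σ).expand (p ^ f) hq0, v]
    F.toPowerSeries : PowerSeries A) - PowerSeries.coeff r (PowerSeries.subst H P) with ha
  -- Modulo π, P(H) becomes H^q, φ(H) becomes H^q and v vanishes, so F(φ(H), v) becomes F(H^q, 0) =
  -- H^q.
  have hρa : ρ a = 0 := by
    have hHρ : PowerSeries.HasSubst (H.map ρ) :=
      PowerSeries.HasSubst.of_constantCoeff_zero' (constantCoeff_map' ρ hH0)
    rw [ha, map_sub, ← PowerSeries.coeff_map, ← PowerSeries.coeff_map, map_powerPair ρ hφ0 hv0,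
      map_powerSubst ρ hH0, hPκ, PowerSeries.subst_pow hHρ, PowerSeries.subst_X hHρ, hvρ]
    have h2 : PowerSeries.map ρ ((H.map σ).expand (p ^ f) hq0) = (H.map ρ) ^ p ^ f := by
      have h3 : PowerSeries.map (iterateFrobenius κ p f) ((H.map ρ).expand (p ^ f) hq0) =
          (H.map ρ) ^ p ^ f :=
        MvPowerSeries.map_iterateFrobenius_expand p (expChar_ne_zero κ p) (H.map ρ) f
      rw [← h3, PowerSeries.map_expand, PowerSeries.map_expand]
      congr 1
      ext n
      simp [hσρ, iterateFrobenius_def]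
    rw [h2, FormalGroup.add_zero _ (by
      rw [← h2]
      exact PowerSeries.HasSubst.of_constantCoeff_zero' (constantCoeff_map' ρ hφ0)), sub_self]
  obtain ⟨b, hb⟩ := (hρ a).1 hρa
  refine ⟨b, ?_⟩
  rw [hb, map_mul] at e1
  exact mul_left_cancel₀ (fun h0 => hπ0 (hι (by rw [h0, map_zero]))) e1

/-- The exponential becomes integral, and divisible by `π`, after rescaling by `π`. -/
theorem IsExpLog.exists_rescale_eq {O L : Type*} [CommRing O] [Field L] {ι : O →+* L}
    (hι : Function.Injective ι) {π : O} (hπ0 : π ≠ 0) (hu : ∀ j, IsUnit (1 - π ^ (j + 1)))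
    {P : PowerSeries O} (hP : PowerSeries.X ^ 2 ∣ P - PowerSeries.C π * PowerSeries.X)
    {e l : PowerSeries L} (h : IsExpLog (ι π) (P.map ι) e l) :
    ∃ ε : PowerSeries O, PowerSeries.constantCoeff ε = 0 ∧
      PowerSeries.rescale (ι π) e = PowerSeries.C (ι π) * ε.map ι := by
  have hιπ : ι π ≠ 0 := fun h0 => hπ0 (hι (by rw [h0, map_zero]))
  -- With g = π⁻¹ e(πX), the equation P(e(πX)) = e(π²X) becomes P(πg(X)) = πg(πX), from which the
  -- coefficients of g are found integral one by one.
  obtain ⟨g, hg⟩ : ∃ g, g = PowerSeries.C (ι π)⁻¹ * PowerSeries.rescale (ι π) e := ⟨_, rfl⟩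
  have hge : PowerSeries.rescale (ι π) e = PowerSeries.C (ι π) * g := by
    rw [hg, ← mul_assoc, ← map_mul, mul_inv_cancel₀ hιπ, map_one, one_mul]
  have hg0 : PowerSeries.constantCoeff g = 0 := by
    rw [hg, map_mul, ← PowerSeries.coeff_zero_eq_constantCoeff_apply (φ := PowerSeries.rescale _ _),
      PowerSeries.coeff_rescale, PowerSeries.coeff_zero_eq_constantCoeff_apply, h.exp_zero]
    simp
  have hg1 : PowerSeries.coeff 1 g = 1 := by
    rw [hg, PowerSeries.coeff_C_mul, PowerSeries.coeff_rescale, h.exp_one]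
    field_simp
  suffices hint : ∀ n, PowerSeries.coeff n g ∈ ι.range by
    obtain ⟨ε, hε⟩ := exists_map_eq_of_coeff_mem hint
    refine ⟨ε, hι ?_, by rw [hε, hge]⟩
    rw [map_zero, ← hg0, ← hε, ← PowerSeries.coeff_zero_eq_constantCoeff_apply,
      ← PowerSeries.coeff_zero_eq_constantCoeff_apply, PowerSeries.coeff_map]
  obtain ⟨R, hR⟩ := hP
  have hP' : P = PowerSeries.C π * PowerSeries.X + PowerSeries.X ^ 2 * R := by
    rw [← hR]; ring
  have hPg : PowerSeries.subst (PowerSeries.C (ι π) * g) (P.map ι) =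
      PowerSeries.rescale (ι π) (PowerSeries.C (ι π) * g) := by
    rw [← hge, rescale_eq_subst_smul (ι π) e, h.subst_exp_apply (by
      change PowerSeries.constantCoeff (ι π • PowerSeries.X) = 0
      simp), ← rescale_eq_subst_smul, PowerSeries.rescale_rescale, rescale_eq_subst_smul,
      smul_smul]
  intro n
  induction n using Nat.strong_induction_on with
  | _ r ih =>
  rcases Nat.lt_or_ge r 2 with hr | hr
  · interval_cases r
    · exact ⟨0, by rw [map_zero, PowerSeries.coeff_zero_eq_constantCoeff_apply, hg0]⟩
    · exact ⟨1, by rw [map_one, hg1]⟩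
  obtain ⟨H, hH, hHr⟩ := exists_truncation ih
  have hH0 : PowerSeries.constantCoeff H = 0 := by
    apply hι
    rw [← PowerSeries.coeff_zero_eq_constantCoeff_apply, hH 0 (by omega), map_zero,
      PowerSeries.coeff_zero_eq_constantCoeff_apply, hg0]
  have hπH0 : PowerSeries.constantCoeff (PowerSeries.C π * H) = 0 := by simp [hH0]
  have hπHs := PowerSeries.HasSubst.of_constantCoeff_zero' hπH0
  have e1 := coeff_powerSubst_sub (P.map ι) (G := PowerSeries.C (ι π) * g)
    (H := (PowerSeries.C π * H).map ι) (by simp [hg0]) (constantCoeff_map' ι hπH0) r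
    (fun m hm => by
      rw [PowerSeries.coeff_map, PowerSeries.coeff_C_mul, PowerSeries.coeff_C_mul, map_mul, hH m hm])
  -- Substituting πH into πX + X²R yields a factor π² from both terms. That is precisely the power
  -- needed, so no congruence between P and X^q enters here.
  have e2 : PowerSeries.subst (PowerSeries.C π * H) P =
      PowerSeries.C π * (PowerSeries.C π * (H + H ^ 2 * PowerSeries.subst (PowerSeries.C π * H) R)) := by
    conv_lhs => rw [hP']
    rw [PowerSeries.subst_add hπHs, PowerSeries.subst_mul hπHs, PowerSeries.subst_mul hπHs,
      PowerSeries.subst_pow hπHs, PowerSeries.subst_X hπHs, PowerSeries.subst_C]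
    change PowerSeries.C π * (PowerSeries.C π * H) + _ = _
    ring
  set b := PowerSeries.coeff r (H + H ^ 2 * PowerSeries.subst (PowerSeries.C π * H) R) with hb
  rw [hPg, ← map_powerSubst ι hπH0, e2] at e1
  rw [PowerSeries.coeff_rescale, PowerSeries.coeff_map, PowerSeries.coeff_map,
    PowerSeries.coeff_map, PowerSeries.coeff_C_mul, PowerSeries.coeff_C_mul, PowerSeries.coeff_C_mul,
    PowerSeries.coeff_C_mul, hHr r le_rfl, ← hb, map_mul, map_mul, mul_zero, map_zero, sub_zero,
    hP'] at e1
  have e3 : PowerSeries.coeff 1 (PowerSeries.C π * PowerSeries.X + PowerSeries.X ^ 2 * R) = π := by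
    rw [map_add, PowerSeries.coeff_C_mul, PowerSeries.coeff_one_X, mul_one,
      PowerSeries.X_pow_dvd_iff.1 (Dvd.intro _ rfl) 1 (by norm_num), add_zero]
  rw [e3] at e1
  obtain ⟨v, hv⟩ := hu (r - 2)
  have hv' : ι ↑v⁻¹ * (1 - ι π ^ (r - 1)) = 1 := by
    have : (↑v⁻¹ : O) * (1 - π ^ (r - 1)) = 1 := by
      rw [show r - 1 = r - 2 + 1 by omega, ← hv, Units.inv_mul]
    simpa using congrArg ι this
  refine ⟨-(↑v⁻¹ * b), ?_⟩
  have h3 : ι b = -(1 - ι π ^ (r - 1)) * PowerSeries.coeff r g := by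
    apply mul_left_cancel₀ (mul_ne_zero hιπ hιπ)
    obtain ⟨r, rfl⟩ : ∃ s, r = s + 1 := ⟨r - 1, by omega⟩
    simp only [Nat.add_sub_cancel]
    linear_combination -e1
  rw [map_neg, map_mul, h3]
  linear_combination PowerSeries.coeff r g * hv'

end Frobenius

/-! ### Series supported on the powers of q -/

section Lacunary

variable {S : Type*} [CommRing S] {q : ℕ}

/-- The series `∑ r i X ^ (q ^ i)`. -/
def lacunary (q : ℕ) (r : ℕ → S) : PowerSeries S :=
  PowerSeries.mk fun k => if q ^ Nat.log q k = k then r (Nat.log q k) else 0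

/-- The sequence `0, r 0, r 1, ...`. -/
def shift (r : ℕ → S) : ℕ → S
  | 0 => 0
  | i + 1 => r i

lemma coeff_lacunary (r : ℕ → S) (k : ℕ) : PowerSeries.coeff k (lacunary q r) =
    if q ^ Nat.log q k = k then r (Nat.log q k) else 0 :=
  PowerSeries.coeff_mk _ _

lemma coeff_lacunary_pow (hq : 1 < q) (r : ℕ → S) (i : ℕ) :
    PowerSeries.coeff (q ^ i) (lacunary q r) = r i := by
  rw [coeff_lacunary, Nat.log_pow hq, if_pos rfl]

lemma lacunary_ext (hq : 1 < q) {f : PowerSeries S} {r : ℕ → S}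
    (h1 : ∀ i, PowerSeries.coeff (q ^ i) f = r i)
    (h2 : ∀ k, (∀ i, k ≠ q ^ i) → PowerSeries.coeff k f = 0) : f = lacunary q r := by
  ext k
  by_cases hk : ∃ i, k = q ^ i
  · obtain ⟨i, rfl⟩ := hk
    rw [h1, coeff_lacunary_pow hq]
  · push Not at hk
    rw [h2 k hk, coeff_lacunary, if_neg (fun h => hk _ h.symm)]

lemma coeff_lacunary_of_ne (r : ℕ → S) {k : ℕ} (hk : ∀ i, k ≠ q ^ i) :
    PowerSeries.coeff k (lacunary q r) = 0 := by
  rw [coeff_lacunary, if_neg (fun h => hk _ h.symm)]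

lemma constantCoeff_lacunary (hq : 1 < q) (r : ℕ → S) :
    PowerSeries.constantCoeff (lacunary q r) = 0 := by
  rw [← PowerSeries.coeff_zero_eq_constantCoeff_apply, coeff_lacunary_of_ne]
  intro i
  exact (pow_pos (by omega) i).ne

lemma lacunary_add (r s : ℕ → S) : lacunary q (r + s) = lacunary q r + lacunary q s := by
  ext k
  rw [map_add, coeff_lacunary, coeff_lacunary, coeff_lacunary]
  split_ifs <;> simp

lemma lacunary_sub (r s : ℕ → S) : lacunary q (r - s) = lacunary q r - lacunary q s := by
  ext k
  rw [map_sub, coeff_lacunary, coeff_lacunary, coeff_lacunary]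
  split_ifs <;> simp

lemma lacunary_C_mul (c : S) (r : ℕ → S) :
    lacunary q (fun i => c * r i) = PowerSeries.C c * lacunary q r := by
  ext k
  rw [PowerSeries.coeff_C_mul, coeff_lacunary, coeff_lacunary]
  split_ifs <;> simp

lemma map_lacunary {S' : Type*} [CommRing S'] (h : S →+* S') (r : ℕ → S) :
    (lacunary q r).map h = lacunary q fun i => h (r i) := by
  ext k
  rw [PowerSeries.coeff_map, coeff_lacunary, coeff_lacunary]
  split_ifs <;> simp

/-- Because of this, ∑ r_i (X^{q^i} − X^{q^{i+1}}) is `lacunary q (r - shift r)`, the form taken by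
all arguments of the exponential below. -/
lemma expand_lacunary (hq : 1 < q) (r : ℕ → S) :
    (lacunary q r).expand q (by omega) = lacunary q (shift r) := by
  refine lacunary_ext hq (fun i => ?_) fun k hk => ?_
  · rcases i with _ | i
    · rw [PowerSeries.coeff_expand_of_not_dvd]
      · rfl
      · simpa using hq.ne'
    · rw [pow_succ', PowerSeries.coeff_expand_mul, coeff_lacunary_pow hq]
      rfl
  · rw [PowerSeries.coeff_expand]
    split_ifs with h
    · obtain ⟨j, rfl⟩ := h
      rw [Nat.mul_div_cancel_left j (by omega), coeff_lacunary_of_ne]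
      rintro i rfl
      exact hk (i + 1) (pow_succ' q i).symm
    · rfl

end Lacunary

/-! ### Integrality for the generic argument -/

section TwoVariables

lemma subst_exp_apply' {R τ : Type*} [CommRing R] {P e : PowerSeries R} {c : R}
    (he0 : PowerSeries.constantCoeff e = 0) (h : PowerSeries.subst e P = PowerSeries.rescale c e)
    {a : MvPowerSeries τ R} (ha : MvPowerSeries.constantCoeff a = 0) :
    PowerSeries.subst (PowerSeries.subst a e) P = PowerSeries.subst (c • a) e := by
  have ha' := PowerSeries.HasSubst.of_constantCoeff_zero ha
  rw [← PowerSeries.subst_comp_subst_apply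
    (PowerSeries.HasSubst.of_constantCoeff_zero' he0) ha', h,
    rescale_eq_subst_smul, PowerSeries.subst_comp_subst_apply (PowerSeries.HasSubst.smul_X' c) ha',
    PowerSeries.subst_smul ha', PowerSeries.subst_X ha']

lemma subst_exp_apply_C_mul {R : Type*} [CommRing R] {P e : PowerSeries R} {c : R}
    (he0 : PowerSeries.constantCoeff e = 0) (h : PowerSeries.subst e P = PowerSeries.rescale c e)
    {a : PowerSeries R} (ha : PowerSeries.constantCoeff a = 0) :
    PowerSeries.subst (PowerSeries.subst a e) P = PowerSeries.subst (PowerSeries.C c * a) e := by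
  rw [← PowerSeries.smul_eq_C_mul]
  exact subst_exp_apply' he0 h ha

lemma subst_C_mul {R : Type*} [CommRing R] {e : PowerSeries R} {c : R}
    {a : PowerSeries R} (ha : PowerSeries.constantCoeff a = 0) :
    PowerSeries.subst (PowerSeries.C c * a) e = PowerSeries.subst a (PowerSeries.rescale c e) := by
  have has := PowerSeries.HasSubst.of_constantCoeff_zero' ha
  rw [rescale_eq_subst_smul, PowerSeries.subst_comp_subst_apply
        (PowerSeries.HasSubst.smul_X' _) has, PowerSeries.subst_smul has, PowerSeries.subst_X has,
        PowerSeries.smul_eq_C_mul]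

lemma map_rescale {R S : Type*} [CommRing R] [CommRing S] (h : R →+* S) (c : R)
    (f : PowerSeries R) : (PowerSeries.rescale c f).map h = PowerSeries.rescale (h c) (f.map h) := by
  ext n
  simp

/-- The iterates `Q ∘ ... ∘ Q`. -/
def iter {R : Type*} [CommRing R] (Q : PowerSeries R) : ℕ → PowerSeries R
  | 0 => PowerSeries.X
  | i + 1 => PowerSeries.subst Q (iter Q i)

lemma constantCoeff_iter {R : Type*} [CommRing R] {Q : PowerSeries R}
    (hQ : PowerSeries.constantCoeff Q = 0) (i : ℕ) : PowerSeries.constantCoeff (iter Q i) = 0 := by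
  induction i with
  | zero => simp [iter]
  | succ i ih => exact PowerSeries.constantCoeff_subst_eq_zero hQ _ ih

lemma iter_succ' {R : Type*} [CommRing R] {Q : PowerSeries R}
    (hQ : PowerSeries.constantCoeff Q = 0) (i : ℕ) :
    iter Q (i + 1) = PowerSeries.subst (iter Q i) Q := by
  have hQs := PowerSeries.HasSubst.of_constantCoeff_zero' hQ
  induction i with
  | zero =>
    change PowerSeries.subst Q PowerSeries.X = PowerSeries.subst PowerSeries.X Q
    rw [PowerSeries.subst_X hQs]
    exact (PowerSeries.X_subst Q).symm
  | succ i ih =>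
    change PowerSeries.subst Q (iter Q (i + 1)) = PowerSeries.subst (PowerSeries.subst Q (iter Q i)) Q
    rw [ih, PowerSeries.subst_comp_subst_apply
      (PowerSeries.HasSubst.of_constantCoeff_zero' (constantCoeff_iter hQ i)) hQs]

/-- The sequence `Q^{∘ i} / c ^ i`. -/
def scaledIter {L : Type*} [Field L] (c : L) (Q : PowerSeries L) (i : ℕ) : PowerSeries L :=
  (c ^ i)⁻¹ • iter Q i

/-- The argument `∑ Q^{∘ i}(T) (X ^ (q ^ i) - X ^ (q ^ (i + 1))) / c ^ i`, as a series in `X` with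
coefficients in `L⟦T⟧`. -/
def genericArgument {L : Type*} [Field L] (q : ℕ) (c : L) (Q : PowerSeries L) :
    PowerSeries (PowerSeries L) :=
  lacunary q (scaledIter c Q - shift (scaledIter c Q))

variable {O L k : Type*} [CommRing O] [Field L] [Field k] {ι : O →+* L} {ρ : O →+* k}

/-- Integrality of the exponential of the generic argument. -/
theorem exists_map_eq_subst_genericArgument (hι : Function.Injective ι) {π : O} (hπ0 : π ≠ 0)
    (hρ : ∀ a, ρ a = 0 ↔ π ∣ a) (hu : ∀ j, IsUnit (1 - π ^ (j + 1))) {p f : ℕ} [ExpChar k p]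
    (hq : 1 < p ^ f) (hk : ∀ c : k, c ^ p ^ f = c) {P Q : PowerSeries O}
    (hP : IsLubinTateSeries π (p ^ f) P)
    (hP1 : PowerSeries.coeff 1 P = π)
    (hPk : P.map ρ = PowerSeries.X ^ p ^ f) (hQ0 : PowerSeries.constantCoeff Q = 0)
    (hQk : Q.map ρ = PowerSeries.X ^ p ^ f) (F : FormalGroup O) {e l : PowerSeries L}
    (h : IsExpLog (ι π) (P.map ι) e l) (he : IsFormalExp (F.map ι) e) :
    ∃ Y : PowerSeries (PowerSeries O), Y.map (PowerSeries.map ι) =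
      PowerSeries.subst (genericArgument (p ^ f) (ι π) (Q.map ι)) (e.map PowerSeries.C) := by
  have hιπ : ι π ≠ 0 := fun h0 => hπ0 (hι (by rw [h0, map_zero]))
  obtain ⟨ε, hε0, hε⟩ := h.exists_rescale_eq hι hπ0 hu hP.linear
  have hQι0 := constantCoeff_map' ι hQ0
  have hQs := PowerSeries.HasSubst.of_constantCoeff_zero' hQ0
  have hQιs := PowerSeries.HasSubst.of_constantCoeff_zero' hQι0
  -- σ is T ↦ Q(T). It lifts the q-power map modulo π because Q ≡ T^q and the q-power map fixes the
  -- residue field. Only this congruence on Q is needed for integrality; its linear coefficient is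
  -- irrelevant.
  let σ : PowerSeries O →+* PowerSeries O := (PowerSeries.substAlgHom (R := O) hQs).toRingHom
  let σ' : PowerSeries L →+* PowerSeries L := (PowerSeries.substAlgHom (R := L) hQιs).toRingHom
  have hσ : ∀ g, σ g = PowerSeries.subst Q g := fun g =>
    congrFun (PowerSeries.coe_substAlgHom hQs) g
  have hσ' : ∀ g, σ' g = PowerSeries.subst (Q.map ι) g := fun g =>
    congrFun (PowerSeries.coe_substAlgHom hQιs) g
  have : ExpChar (PowerSeries k) p :=
    expChar_of_injective_ringHom (PowerSeries.C_injective (R := k)) p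
  set c := ι π with hc
  set q := p ^ f with hqdef
  set Qι := Q.map ι with hQι
  set B := genericArgument q c Qι with hB
  have hB0 : PowerSeries.constantCoeff B = 0 := constantCoeff_lacunary hq _
  set eS : PowerSeries (PowerSeries L) := e.map PowerSeries.C with heS
  have heS0 : PowerSeries.constantCoeff eS = 0 := constantCoeff_map' _ h.exp_zero
  have hσC : ∀ x : L, σ' (PowerSeries.C x) = PowerSeries.C x := fun x => by
    rw [hσ', PowerSeries.subst_C]; rfl
  have hιA : Function.Injective (PowerSeries.map ι) := by
    intro a b hab
    ext n
    apply hι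
    rw [← PowerSeries.coeff_map, hab, PowerSeries.coeff_map]
  have hφB : (B.map σ').expand q (by omega) =
      lacunary q (shift fun i => σ' ((scaledIter c Qι - shift (scaledIter c Qι)) i)) := by
    rw [hB, genericArgument, map_lacunary, expand_lacunary hq]
  have hσr : ∀ i, σ' (scaledIter c Qι i) = c • scaledIter c Qι (i + 1) := by
    intro i
    rw [hσ', scaledIter, scaledIter, PowerSeries.subst_smul hQιs, smul_smul, pow_succ', mul_inv,
      mul_inv_cancel_left₀ hιπ]
    rfl
  set D : PowerSeries (PowerSeries L) := lacunary q (Pi.single 0 PowerSeries.X) -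
    (lacunary q (Pi.single 0 PowerSeries.X)).expand q (by omega) with hD
  -- The functional equation cB = φ(B) + cD with D = T(X − X^q): φ sends the i-th term of B to c
  -- times the (i+1)-st, so only the term i = 0 of cB is left over.
  have hsplit : PowerSeries.C (PowerSeries.C c) * B =
      (B.map σ').expand q (by omega) + PowerSeries.C (PowerSeries.C c) * D := by
    rw [hφB, hB, genericArgument, hD, expand_lacunary hq, ← lacunary_sub,
      ← lacunary_C_mul, ← lacunary_C_mul, ← lacunary_add]
    congr 1
    funext i
    have h0 : scaledIter c Qι 0 = PowerSeries.X := by simp [scaledIter, iter]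
    rcases i with _ | _ | i
    · simp [shift, h0]
    · simp only [Pi.sub_apply, Pi.add_apply, shift, hσr, map_sub, zero_add, h0,
        ← PowerSeries.smul_eq_C_mul, Pi.single_eq_same, map_zero, sub_zero]
      rw [Pi.single_eq_of_ne (by omega), zero_sub, smul_sub, smul_neg, ← h0, sub_eq_add_neg]
    · simp only [Pi.sub_apply, Pi.add_apply, shift, hσr, map_sub,
        ← PowerSeries.smul_eq_C_mul]
      rw [Pi.single_eq_of_ne (by omega), Pi.single_eq_of_ne (by omega)]
      simp [smul_sub]
  have hD0 : PowerSeries.constantCoeff D = 0 := by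
    rw [hD, map_sub, PowerSeries.constantCoeff_expand, constantCoeff_lacunary hq, sub_zero]
  have hφB0 : PowerSeries.constantCoeff ((B.map σ').expand q (by omega)) = 0 := by
    rw [PowerSeries.constantCoeff_expand, constantCoeff_map' σ' hB0]
  set DA : PowerSeries (PowerSeries O) := lacunary q (Pi.single 0 PowerSeries.X) -
    (lacunary q (Pi.single 0 PowerSeries.X)).expand q (by omega) with hDA
  have hDA0 : PowerSeries.constantCoeff DA = 0 := by
    rw [hDA, map_sub, PowerSeries.constantCoeff_expand, constantCoeff_lacunary hq, sub_zero]
  have hDA' : DA.map (PowerSeries.map ι) = D := by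
    rw [hDA, hD, map_sub, PowerSeries.map_expand, map_lacunary]
    have : (fun i => PowerSeries.map ι ((Pi.single 0 PowerSeries.X : ℕ → PowerSeries O) i)) =
        (Pi.single 0 PowerSeries.X : ℕ → PowerSeries L) := by
      funext i
      rcases i with _ | i
      · simp
      · rw [Pi.single_eq_of_ne (by omega), Pi.single_eq_of_ne (by omega), map_zero]
    rw [this]
  have hCι : (PowerSeries.C : L →+* PowerSeries L).comp ι =
      (PowerSeries.map ι).comp (PowerSeries.C : O →+* PowerSeries O) := by
    ext1 x; simp
  have hmm : ∀ g : PowerSeries O, (g.map ι).map (PowerSeries.C : L →+* PowerSeries L) =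
      (g.map (PowerSeries.C : O →+* PowerSeries O)).map (PowerSeries.map ι) := by
    intro g
    ext n m
    simp
  -- An integral model of e(cD), divisible by π since e(cX) = c ε(X) with ε integral.
  set v : PowerSeries (PowerSeries O) := PowerSeries.C (PowerSeries.C π) *
    PowerSeries.subst DA (ε.map (PowerSeries.C : O →+* PowerSeries O)) with hv
  have hvmap : v.map (PowerSeries.map ι) =
      PowerSeries.subst (PowerSeries.C (PowerSeries.C c) * D) eS := by
    have hDs := PowerSeries.HasSubst.of_constantCoeff_zero' hD0
    rw [subst_C_mul hD0, heS, ← map_rescale, hε, map_mul (PowerSeries.map (PowerSeries.C : L →+* PowerSeries L)) (PowerSeries.C c),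
      PowerSeries.map_C, PowerSeries.subst_mul hDs,
      PowerSeries.subst_C, hv, map_mul, map_powerSubst _ hDA0, hDA', hmm, PowerSeries.map_C,
      PowerSeries.map_C]
    rfl
  refine exists_map_eq_of_frobenius (π := PowerSeries.C π) (ρ := PowerSeries.map ρ) (p := p) (f := f)
    (P := P.map (PowerSeries.C : O →+* PowerSeries O)) (v := v) (σ := σ) (σ' := σ')
    (y := PowerSeries.subst B eS) hιA
    ?_ hq ?_ ?_ ?_ ?_ ?_ (F.map PowerSeries.C) ?_ ?_ ?_ ?_
  · intro a
    rw [hσ, hσ', map_powerSubst ι hQ0]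
  · intro a
    have hk' : iterateFrobenius k p f = RingHom.id k := by
      ext x; exact (iterateFrobenius_def p f x).trans (hk x)
    have h3 : PowerSeries.map (iterateFrobenius k p f) ((a.map ρ).expand q (by omega)) =
        (a.map ρ) ^ q :=
      MvPowerSeries.map_iterateFrobenius_expand p (expChar_ne_zero k p) (a.map ρ) f
    rw [hσ, map_powerSubst ρ hQ0, hQk, ← h3, hk', PowerSeries.map_id, id_eq,
      PowerSeries.expand_apply]
  · intro h0
    apply hπ0
    have := congrArg PowerSeries.constantCoeff h0
    simpa using this
  · intro a
    constructor
    · intro ha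
      have : ∀ n, ∃ b, PowerSeries.coeff n a = π * b := fun n => (hρ _).1 (by
        rw [← PowerSeries.coeff_map, ha, map_zero])
      choose b hb using this
      refine ⟨PowerSeries.mk b, ?_⟩
      ext n
      rw [PowerSeries.coeff_C_mul, PowerSeries.coeff_mk, hb]
    · rintro ⟨b, rfl⟩
      rw [map_mul, PowerSeries.map_C, (hρ π).2 dvd_rfl, map_zero, zero_mul]
  · rw [PowerSeries.coeff_map, hP1]
  · have : (P.map (PowerSeries.C : O →+* PowerSeries O)).map (PowerSeries.map ρ) =
        (P.map ρ).map PowerSeries.C := by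
      ext n m; simp
    rw [this, hPk, map_pow, PowerSeries.map_X]
  · exact PowerSeries.constantCoeff_subst_eq_zero hB0 _ heS0
  · rw [hv, map_mul, show PowerSeries.constantCoeff (PowerSeries.subst DA
      (ε.map (PowerSeries.C : O →+* PowerSeries O))) = 0 from
      PowerSeries.constantCoeff_subst_eq_zero hDA0 _ (constantCoeff_map' _ hε0), mul_zero]
  · rw [hv, map_mul, PowerSeries.map_C, PowerSeries.map_C, (hρ π).2 dvd_rfl, map_zero, map_zero,
      zero_mul]
  · have heS' : IsFormalExp ((F.map ι).map (PowerSeries.C : L →+* PowerSeries L)) eS := he.map _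
    -- What remains is P(e(B)) = e(cB) = F(e(φ(B)), e(cD)). Here e(φ(B)) = φ(e(B)), as the
    -- coefficients of e are constants in T and so are fixed by σ'.
    have hFF : (F.map ι).map (PowerSeries.C : L →+* PowerSeries L) =
        (F.map (PowerSeries.C : O →+* PowerSeries O)).map (PowerSeries.map ι) := by
      apply FormalGroup.ext
      ext d m
      simp
    have hPe : PowerSeries.subst eS ((P.map ι).map (PowerSeries.C : L →+* PowerSeries L)) =
        PowerSeries.rescale (PowerSeries.C c) eS := by
      rw [heS, ← map_powerSubst _ h.exp_zero, h.subst_exp, map_rescale]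
    rw [← hmm, subst_exp_apply_C_mul heS0 hPe hB0, hsplit, heS'.subst_add hφB0 (by
      change PowerSeries.constantCoeff (PowerSeries.C (PowerSeries.C c) * D) = 0
      rw [map_mul, hD0, mul_zero]), hvmap, hFF]
    congr 2
    have h5 : eS.map σ' = eS := by
      ext1 n
      rw [heS, PowerSeries.coeff_map, PowerSeries.coeff_map, hσC]
    rw [map_powerSubst σ' hB0, h5]
    exact (PowerSeries.expand_subst q (by omega)
      (PowerSeries.HasSubst.of_constantCoeff_zero' (constantCoeff_map' σ' hB0)) eS).symm

end TwoVariables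

/-! ### Evaluation of small series on the closed unit disc -/

section Tate

set_option linter.unusedSectionVars false

open Filter Topology

variable {L : Type*} [NormedField L] [IsUltrametricDist L]

lemma nonarchimedeanRing_of_isUltrametricDist : NonarchimedeanRing L :=
  ⟨NonarchimedeanAddGroup.is_nonarchimedean⟩

variable (L) in
/-- The Tate algebra: the power series whose coefficients tend to `0`. -/
def tate : Subring (PowerSeries L) := PowerSeries.IsRestricted.subring 1

lemma mem_tate {f : PowerSeries L} :
    f ∈ tate L ↔ Tendsto (fun k => PowerSeries.coeff k f) cofinite (𝓝 0) := by
  change PowerSeries.IsRestricted 1 f ↔ _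
  rw [PowerSeries.isRestricted_iff]
  simp only [one_pow, mul_one]
  exact tendsto_zero_iff_norm_tendsto_zero.symm

/-- The value of a power series. -/
def value (f : PowerSeries L) (x : L) : L := ∑' k : ℕ, PowerSeries.coeff k f * x ^ k

lemma norm_coeff_mul_pow_le {f : PowerSeries L} {x : L} (hx : ‖x‖ ≤ 1) (k : ℕ) :
    ‖PowerSeries.coeff k f * x ^ k‖ ≤ ‖PowerSeries.coeff k f‖ := by
  rw [norm_mul, norm_pow]
  exact mul_le_of_le_one_right (norm_nonneg _) (pow_le_one₀ (norm_nonneg _) hx)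

lemma norm_value_le {f : PowerSeries L} {x : L} (hx : ‖x‖ ≤ 1) {r : ℝ} (hr : 0 ≤ r)
    (hf : ∀ k, ‖PowerSeries.coeff k f‖ ≤ r) : ‖value f x‖ ≤ r :=
  (IsUltrametricDist.norm_tsum_le _).trans
    (Real.iSup_le (fun k => (norm_coeff_mul_pow_le hx k).trans (hf k)) hr)

lemma norm_coeff_mul_le {f g : PowerSeries L} {r s : ℝ} (hf : ∀ k, ‖PowerSeries.coeff k f‖ ≤ r)
    (hg : ∀ k, ‖PowerSeries.coeff k g‖ ≤ s) (k : ℕ) :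
    ‖PowerSeries.coeff k (f * g)‖ ≤ r * s := by
  have hr : 0 ≤ r := (norm_nonneg _).trans (hf 0)
  have hs : 0 ≤ s := (norm_nonneg _).trans (hg 0)
  rw [PowerSeries.coeff_mul]
  refine IsUltrametricDist.norm_sum_le_of_forall_le_of_nonneg (mul_nonneg hr hs) fun i _ => ?_
  rw [norm_mul]
  exact mul_le_mul (hf _) (hg _) (norm_nonneg _) hr

lemma norm_coeff_pow_le {f : PowerSeries L} {r : ℝ} (hf : ∀ k, ‖PowerSeries.coeff k f‖ ≤ r)
    (j k : ℕ) : ‖PowerSeries.coeff k (f ^ j)‖ ≤ r ^ j := by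
  induction j generalizing k with
  | zero =>
    rw [pow_zero, pow_zero, PowerSeries.coeff_one]
    split_ifs <;> simp
  | succ j ih =>
    rw [pow_succ, pow_succ]
    exact norm_coeff_mul_le ih hf k

variable [CompleteSpace L]

lemma summable_of_mem_tate {f : PowerSeries L} (hf : f ∈ tate L) {x : L} (hx : ‖x‖ ≤ 1) :
    Summable fun k : ℕ => PowerSeries.coeff k f * x ^ k := by
  refine NonarchimedeanAddGroup.summable_of_tendsto_cofinite_zero ?_
  exact squeeze_zero_norm (fun k => norm_coeff_mul_pow_le hx k)
    (tendsto_zero_iff_norm_tendsto_zero.1 (mem_tate.1 hf))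

lemma summable_mul {a b : ℕ → L} (ha : Summable a) (hb : Summable b) :
    Summable fun i : ℕ × ℕ => a i.1 * b i.2 :=
  have := nonarchimedeanRing_of_isUltrametricDist (L := L)
  ha.mul_of_nonarchimedean hb

lemma tsum_mul_tsum {a b : ℕ → L} (ha : Summable a) (hb : Summable b) :
    (∑' n, a n) * ∑' n, b n =
      ∑' n, ∑ kl ∈ Finset.HasAntidiagonal.antidiagonal n, a kl.1 * b kl.2 := by
  have := summable_mul ha hb
  apply Summable.tsum_mul_tsum_eq_tsum_sum_antidiagonal ha hb
  exact this

lemma value_mul_of_summable {f g : PowerSeries L}  {x : L}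
    (hf : Summable fun k : ℕ => PowerSeries.coeff k f * x ^ k)
    (hg : Summable fun k : ℕ => PowerSeries.coeff k g * x ^ k) :
    value (f * g) x = value f x * value g x := by
  refine Eq.trans ?_ (tsum_mul_tsum hf hg).symm
  refine tsum_congr fun k => ?_
  rw [PowerSeries.coeff_mul, Finset.sum_mul]
  refine Finset.sum_congr rfl fun i hi => ?_
  rw [← Finset.HasAntidiagonal.mem_antidiagonal.1 hi, pow_add]
  ring

lemma value_mul {f g : PowerSeries L} (hf : f ∈ tate L) (hg : g ∈ tate L) {x : L} (hx : ‖x‖ ≤ 1) :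
    value (f * g) x = value f x * value g x :=
  value_mul_of_summable (summable_of_mem_tate hf hx) (summable_of_mem_tate hg hx)

/-- Evaluation of the Tate algebra at a point of the closed unit disc. -/
def tateValue {x : L} (hx : ‖x‖ ≤ 1) : tate L →+* L where
  toFun f := value f x
  map_one' := by
    change value 1 x = 1
    rw [value, tsum_eq_single 0]
    · simp
    · intro k hk
      simp [PowerSeries.coeff_one, hk]
  map_zero' := by
    change value 0 x = 0
    simp [value]
  map_add' f g := by
    change value (f + g : PowerSeries L) x = value f x + value g x
    rw [value, value, value, ← (summable_of_mem_tate f.2 hx).tsum_add (summable_of_mem_tate g.2 hx)]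
    simp only [map_add, add_mul]
  map_mul' f g := value_mul f.2 g.2 hx

lemma value_pow {f : PowerSeries L} (hf : f ∈ tate L) {x : L} (hx : ‖x‖ ≤ 1) (j : ℕ) :
    value (f ^ j) x = value f x ^ j :=
  map_pow (tateValue hx) ⟨f, hf⟩ j

lemma value_rescale (f : PowerSeries L) (c x : L) :
    value (PowerSeries.rescale c f) x = value f (c * x) := by
  refine tsum_congr fun k => ?_
  rw [PowerSeries.coeff_rescale, mul_pow]
  ring

/-- A convergent combination of a family of elements of the Tate algebra whose norms tend
to `0`. -/
lemma tendsto_combination {J : Type*} {G : J → L} (hG : ∀ j, ‖G j‖ ≤ 1) {h : J → PowerSeries L}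
    {r : J → ℝ} (hr : Tendsto r cofinite (𝓝 0)) (hh : ∀ j k, ‖PowerSeries.coeff k (h j)‖ ≤ r j)
    (hT : ∀ j, h j ∈ tate L) {x : L} (hx : ‖x‖ ≤ 1) :
    Tendsto (fun i : J × ℕ => G i.1 * (PowerSeries.coeff i.2 (h i.1) * x ^ i.2)) cofinite
      (𝓝 0) := by
  rw [Metric.tendsto_nhds]
  intro ε hε
  have h1 := (Metric.tendsto_nhds.1 hr ε hε)
  have h2 := fun j => (Metric.tendsto_nhds.1 (mem_tate.1 (hT j)) ε hε)
  rw [Filter.eventually_cofinite] at h1 ⊢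
  simp only [Filter.eventually_cofinite] at h2
  refine (h1.biUnion fun j _ => (h2 j).image (Prod.mk j)).subset ?_
  rintro ⟨j, k⟩ hjk
  simp only [dist_zero_right, not_lt, Set.mem_ofPred_eq, Set.mem_iUnion, Set.mem_image, exists_prop]
    at hjk ⊢
  have h3 : ε ≤ ‖PowerSeries.coeff k (h j)‖ := by
    refine hjk.trans ?_
    rw [norm_mul]
    exact (mul_le_of_le_one_left (norm_nonneg _) (hG j)).trans (norm_coeff_mul_pow_le hx k)
  exact ⟨j, (h3.trans (hh j k)).trans (le_abs_self _), k, h3, rfl⟩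

/-- At x = 1 the double family is summable. Summing first over j leaves a summable family in k, and
the terms of such a family tend to 0. -/
lemma mem_tate_of_combination {J : Type*} {G : J → L} (hG : ∀ j, ‖G j‖ ≤ 1) {h : J → PowerSeries L}
    {r : J → ℝ} (hr : Tendsto r cofinite (𝓝 0)) (hh : ∀ j k, ‖PowerSeries.coeff k (h j)‖ ≤ r j)
    (hT : ∀ j, h j ∈ tate L) {f : PowerSeries L}
    (hf : ∀ k, PowerSeries.coeff k f = ∑' j, G j * PowerSeries.coeff k (h j)) : f ∈ tate L := by
  have hs := NonarchimedeanAddGroup.summable_of_tendsto_cofinite_zero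
    (tendsto_combination hG hr hh hT (x := 1) (by simp))
  rw [mem_tate]
  have := hs.prod_symm.prod.tendsto_cofinite_zero
  simpa [hf] using this

/-- The double family is summable, so the order of summation may be exchanged. -/
lemma value_combination {J : Type*} {G : J → L} (hG : ∀ j, ‖G j‖ ≤ 1) {h : J → PowerSeries L}
    {r : J → ℝ} (hr : Tendsto r cofinite (𝓝 0)) (hh : ∀ j k, ‖PowerSeries.coeff k (h j)‖ ≤ r j)
    (hT : ∀ j, h j ∈ tate L) {f : PowerSeries L}
    (hf : ∀ k, PowerSeries.coeff k f = ∑' j, G j * PowerSeries.coeff k (h j)) {x : L}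
    (hx : ‖x‖ ≤ 1) : value f x = ∑' j, G j * value (h j) x := by
  have hs := NonarchimedeanAddGroup.summable_of_tendsto_cofinite_zero
    (tendsto_combination hG hr hh hT hx)
  have hc := Summable.tsum_comm (f := fun j k => G j * (PowerSeries.coeff k (h j) * x ^ k)) hs
  calc value f x = ∑' k, ∑' j, G j * (PowerSeries.coeff k (h j) * x ^ k) := by
        refine tsum_congr fun k => ?_
        rw [hf, ← tsum_mul_right]
        exact tsum_congr fun j => mul_assoc _ _ _
    _ = ∑' j, G j * value (h j) x := by
        rw [hc]
        exact tsum_congr fun j => tsum_mul_left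

/-- A power series without constant term in the open unit ball of the Tate algebra. -/
structure IsSmall (f : PowerSeries L) : Prop where
  constantCoeff_eq : PowerSeries.constantCoeff f = 0
  mem_tate : f ∈ tate L
  exists_bound : ∃ r : ℝ, r < 1 ∧ ∀ k, ‖PowerSeries.coeff k f‖ ≤ r

lemma IsSmall.hasSubst {f : PowerSeries L} (hf : IsSmall f) : PowerSeries.HasSubst f :=
  PowerSeries.HasSubst.of_constantCoeff_zero' hf.constantCoeff_eq

lemma IsSmall.norm_value_lt {f : PowerSeries L} (hf : IsSmall f) {x : L} (hx : ‖x‖ ≤ 1) :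
    ‖value f x‖ < 1 := by
  obtain ⟨r, hr, h⟩ := hf.exists_bound
  exact (norm_value_le hx ((norm_nonneg _).trans (h 0)) h).trans_lt hr

lemma tendsto_pow_cofinite {r : ℝ} (hr0 : 0 ≤ r) (hr : r < 1) :
    Tendsto (fun j : ℕ => r ^ j) cofinite (𝓝 0) := by
  rw [Nat.cofinite_eq_atTop]
  exact tendsto_pow_atTop_nhds_zero_of_lt_one hr0 hr

lemma coeff_subst_eq_tsum {R : Type*} [CommRing R] [TopologicalSpace R] {f G : PowerSeries R}
    (hf : PowerSeries.HasSubst f) (k : ℕ) :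
    PowerSeries.coeff k (PowerSeries.subst f G) =
      ∑' j, PowerSeries.coeff j G * PowerSeries.coeff k (f ^ j) := by
  rw [PowerSeries.coeff_subst' hf]
  exact (tsum_eq_finsum (PowerSeries.coeff_subst_finite' hf G k)).symm

/-- Values of a composite. -/
theorem value_subst {f G : PowerSeries L} (hf : IsSmall f)
    (hG : ∀ k, ‖PowerSeries.coeff k G‖ ≤ 1) {x : L} (hx : ‖x‖ ≤ 1) :
    value (PowerSeries.subst f G) x = value G (value f x) := by
  obtain ⟨r, hr, h⟩ := hf.exists_bound
  rw [value_combination hG (tendsto_pow_cofinite ((norm_nonneg _).trans (h 0)) hr)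
    (norm_coeff_pow_le h) (fun j => pow_mem hf.mem_tate j) (coeff_subst_eq_tsum hf.hasSubst) hx]
  exact tsum_congr fun j => by rw [value_pow hf.mem_tate hx]

lemma norm_coeff_subst_le {f G : PowerSeries L} {r : ℝ} (hr : r ≤ 1)
    (hf : PowerSeries.constantCoeff f = 0) (h : ∀ k, ‖PowerSeries.coeff k f‖ ≤ r)
    (hG0 : PowerSeries.constantCoeff G = 0) (hG : ∀ k, ‖PowerSeries.coeff k G‖ ≤ 1) (k : ℕ) :
    ‖PowerSeries.coeff k (PowerSeries.subst f G)‖ ≤ r := by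
  have hr0 : 0 ≤ r := (norm_nonneg _).trans (h 0)
  rw [coeff_subst_eq_tsum (PowerSeries.HasSubst.of_constantCoeff_zero' hf)]
  refine (IsUltrametricDist.norm_tsum_le _).trans (Real.iSup_le (fun j => ?_) hr0)
  rcases j with _ | j
  · rw [PowerSeries.coeff_zero_eq_constantCoeff_apply, hG0, zero_mul, norm_zero]
    exact hr0
  · rw [norm_mul]
    refine (mul_le_of_le_one_left (norm_nonneg _) (hG _)).trans
      ((norm_coeff_pow_le h _ k).trans ?_)
    rw [pow_succ]
    exact mul_le_of_le_one_left hr0 (pow_le_one₀ hr0 hr)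

theorem IsSmall.subst {f G : PowerSeries L} (hf : IsSmall f)
    (hG0 : PowerSeries.constantCoeff G = 0) (hG : ∀ k, ‖PowerSeries.coeff k G‖ ≤ 1) :
    IsSmall (PowerSeries.subst f G) := by
  obtain ⟨r, hr, h⟩ := hf.exists_bound
  exact ⟨PowerSeries.constantCoeff_subst_eq_zero hf.constantCoeff_eq _ hG0,
    mem_tate_of_combination hG (tendsto_pow_cofinite ((norm_nonneg _).trans (h 0)) hr)
    (norm_coeff_pow_le h) (fun j => pow_mem hf.mem_tate j) (coeff_subst_eq_tsum hf.hasSubst),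
    r, hr, norm_coeff_subst_le hr.le hf.constantCoeff_eq h hG0 hG⟩

lemma hasSubst_pair_of_isSmall {a b : PowerSeries L} (ha : IsSmall a) (hb : IsSmall b) :
    MvPowerSeries.HasSubst ![a, b] :=
  hasSubst_pair ha.constantCoeff_eq hb.constantCoeff_eq

lemma coeff_pair_eq_tsum {a b : PowerSeries L} (ha : IsSmall a) (hb : IsSmall b)
    (F : MvPowerSeries (Fin 2) L) (k : ℕ) :
    PowerSeries.coeff k (MvPowerSeries.subst ![a, b] F : PowerSeries L) =
      ∑' d : Fin 2 →₀ ℕ, MvPowerSeries.coeff d F * PowerSeries.coeff k (a ^ d 0 * b ^ d 1) := by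
  rw [PowerSeries.coeff, MvPowerSeries.coeff_subst (hasSubst_pair_of_isSmall ha hb),
    ← tsum_eq_finsum (L := SummationFilter.unconditional _)
      (MvPowerSeries.coeff_subst_finite (hasSubst_pair_of_isSmall ha hb) F _)]
  refine tsum_congr fun d => ?_
  rw [Finsupp.prod_fintype _ _ (by simp)]
  simp [Fin.prod_univ_two]

lemma tendsto_pow_degree {r : ℝ} (hr0 : 0 ≤ r) (hr : r < 1) :
    Tendsto (fun d : Fin 2 →₀ ℕ => r ^ (d 0 + d 1)) cofinite (𝓝 0) := by
  rw [Metric.tendsto_nhds]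
  intro ε hε
  obtain ⟨N, hN⟩ := exists_pow_lt_of_lt_one hε hr
  rw [Filter.eventually_cofinite]
  refine (Finsupp.finite_of_degree_le (σ := Fin 2) N).subset fun d hd => ?_
  simp only [Real.dist_eq, sub_zero, not_lt, Set.mem_ofPred_eq] at hd ⊢
  rw [abs_of_nonneg (pow_nonneg hr0 _)] at hd
  by_contra! hlt
  rw [Finsupp.degree_eq_sum, Fin.sum_univ_two] at hlt
  exact absurd (hd.trans (pow_le_pow_of_le_one hr0 hr.le hlt.le)) (not_le.2 hN)

lemma norm_coeff_pow_mul_pow_le {a b : PowerSeries L} {r : ℝ}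
    (ha : ∀ k, ‖PowerSeries.coeff k a‖ ≤ r) (hb : ∀ k, ‖PowerSeries.coeff k b‖ ≤ r)
    (d : Fin 2 →₀ ℕ) (k : ℕ) :
    ‖PowerSeries.coeff k (a ^ d 0 * b ^ d 1)‖ ≤ r ^ (d 0 + d 1) := by
  rw [pow_add]
  exact norm_coeff_mul_le (norm_coeff_pow_le ha _) (norm_coeff_pow_le hb _) k

lemma exists_common_bound {a b : PowerSeries L} (ha : IsSmall a) (hb : IsSmall b) :
    ∃ r : ℝ, 0 ≤ r ∧ r < 1 ∧ (∀ k, ‖PowerSeries.coeff k a‖ ≤ r) ∧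
      ∀ k, ‖PowerSeries.coeff k b‖ ≤ r := by
  obtain ⟨r, hr, h⟩ := ha.exists_bound
  obtain ⟨s, hs, h'⟩ := hb.exists_bound
  exact ⟨max r s, le_max_of_le_left ((norm_nonneg _).trans (h 0)), max_lt hr hs,
    fun k => (h k).trans (le_max_left _ _), fun k => (h' k).trans (le_max_right _ _)⟩

/-- Values of a composite with a series in two variables. -/
theorem value_pair {a b : PowerSeries L} (ha : IsSmall a) (hb : IsSmall b)
    {F : MvPowerSeries (Fin 2) L} (hF : ∀ d, ‖MvPowerSeries.coeff d F‖ ≤ 1) {x : L}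
    (hx : ‖x‖ ≤ 1) : value (MvPowerSeries.subst ![a, b] F) x =
      ∑' d : Fin 2 →₀ ℕ, MvPowerSeries.coeff d F * (value a x ^ d 0 * value b x ^ d 1) := by
  obtain ⟨r, hr0, hr, h, h'⟩ := exists_common_bound ha hb
  rw [value_combination hF (tendsto_pow_degree hr0 hr)
    (norm_coeff_pow_mul_pow_le h h')
    (fun d => mul_mem (pow_mem ha.mem_tate _) (pow_mem hb.mem_tate _))
    (coeff_pair_eq_tsum ha hb F) hx]
  refine tsum_congr fun d => ?_
  rw [value_mul (pow_mem ha.mem_tate _) (pow_mem hb.mem_tate _) hx, value_pow ha.mem_tate hx,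
    value_pow hb.mem_tate hx]

theorem IsSmall.pair {a b : PowerSeries L} (ha : IsSmall a) (hb : IsSmall b)
    (F : FormalGroup L) (hF : ∀ d, ‖MvPowerSeries.coeff d F.toPowerSeries‖ ≤ 1) :
    IsSmall (MvPowerSeries.subst ![a, b] F.toPowerSeries) := by
  obtain ⟨r, hr0, hr, h, h'⟩ := exists_common_bound ha hb
  refine ⟨constantCoeff_pair ha.constantCoeff_eq hb.constantCoeff_eq F, mem_tate_of_combination hF
    (tendsto_pow_degree hr0 hr) (norm_coeff_pow_mul_pow_le h h')
    (fun d => mul_mem (pow_mem ha.mem_tate _) (pow_mem hb.mem_tate _))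
    (coeff_pair_eq_tsum ha hb F.toPowerSeries), r, hr, fun k => ?_⟩
  rw [coeff_pair_eq_tsum ha hb]
  refine (IsUltrametricDist.norm_tsum_le _).trans (Real.iSup_le (fun d => ?_) hr0)
  by_cases hd : d = 0
  · subst hd
    rw [MvPowerSeries.coeff_zero_eq_constantCoeff_apply, F.zero_constantCoeff, zero_mul, norm_zero]
    exact hr0
  · rw [norm_mul]
    refine (mul_le_of_le_one_left (norm_nonneg _) (hF _)).trans
      ((norm_coeff_pow_mul_pow_le h h' d k).trans ?_)
    refine pow_le_of_le_one hr0 hr.le fun h0 => hd ?_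
    ext i
    fin_cases i <;> simp <;> omega

/-- Rescaling a bounded series by an element of the open unit disc. -/
lemma isSmall_rescale {f : PowerSeries L} (hf0 : PowerSeries.constantCoeff f = 0)
    (hf : ∀ k, ‖PowerSeries.coeff k f‖ ≤ 1) {x : L} (hx : ‖x‖ < 1) :
    IsSmall (PowerSeries.rescale x f) := by
  have h : ∀ k, ‖PowerSeries.coeff k (PowerSeries.rescale x f)‖ ≤ ‖x‖ ^ k := fun k => by
    rw [PowerSeries.coeff_rescale, norm_mul, norm_pow]
    exact mul_le_of_le_one_right (pow_nonneg (norm_nonneg _) _) (hf k)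
  refine ⟨by rw [← PowerSeries.coeff_zero_eq_constantCoeff_apply, PowerSeries.coeff_rescale,
      PowerSeries.coeff_zero_eq_constantCoeff_apply, hf0, mul_zero],
    mem_tate.2 (squeeze_zero_norm h (tendsto_pow_cofinite (norm_nonneg _) hx)), ‖x‖, hx,
    fun k => ?_⟩
  rcases k with _ | k
  · rw [PowerSeries.coeff_rescale, PowerSeries.coeff_zero_eq_constantCoeff_apply, hf0, mul_zero,
      norm_zero]
    exact norm_nonneg _
  · refine (h _).trans ?_
    rw [pow_succ]
    exact mul_le_of_le_one_left (norm_nonneg _) (pow_le_one₀ (norm_nonneg _) hx.le)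

lemma rescale_subst {R : Type*} [CommRing R] {f : PowerSeries R}
    (hf : PowerSeries.constantCoeff f = 0) (G : PowerSeries R) (x : R) :
    PowerSeries.rescale x (PowerSeries.subst f G) =
      PowerSeries.subst (PowerSeries.rescale x f) G := by
  rw [rescale_eq_subst_smul, rescale_eq_subst_smul, PowerSeries.subst_comp_subst_apply
    (PowerSeries.HasSubst.of_constantCoeff_zero' hf) (PowerSeries.HasSubst.smul_X' _)]

/-- Values of a composite at a point of the open unit disc. -/
theorem value_subst' {f G : PowerSeries L} (hf0 : PowerSeries.constantCoeff f = 0)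
    (hf : ∀ k, ‖PowerSeries.coeff k f‖ ≤ 1) (hG : ∀ k, ‖PowerSeries.coeff k G‖ ≤ 1) {x : L}
    (hx : ‖x‖ < 1) : value (PowerSeries.subst f G) x = value G (value f x) := by
  -- Rescaling by x moves the evaluation to 1 and makes the merely bounded series f small.
  have h1 : ∀ g : PowerSeries L, value g x = value (PowerSeries.rescale x g) 1 := fun g => by
    rw [value_rescale, mul_one]
  rw [h1, rescale_subst hf0, value_subst (isSmall_rescale hf0 hf hx) hG (by simp), ← h1]

end Tate

/-! ### Coefficients with respect to the parameter T -/

section Slices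

variable {R : Type*} [CommRing R]

/-- The coefficient of `T ^ a` of a series in `X` with coefficients in `R⟦T⟧`. -/
def slice (a : ℕ) (f : PowerSeries (PowerSeries R)) : PowerSeries R :=
  PowerSeries.mk fun k => PowerSeries.coeff a (PowerSeries.coeff k f)

lemma coeff_slice (a k : ℕ) (f : PowerSeries (PowerSeries R)) :
    PowerSeries.coeff k (slice a f) = PowerSeries.coeff a (PowerSeries.coeff k f) :=
  PowerSeries.coeff_mk _ _

lemma slice_mul (a : ℕ) (f g : PowerSeries (PowerSeries R)) :
    slice a (f * g) =
      ∑ i ∈ Finset.HasAntidiagonal.antidiagonal a, slice i.1 f * slice i.2 g := by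
  ext k
  rw [coeff_slice, PowerSeries.coeff_mul, map_sum, map_sum]
  simp only [PowerSeries.coeff_mul, coeff_slice]
  exact Finset.sum_comm

lemma slice_one (a : ℕ) : slice a (1 : PowerSeries (PowerSeries R)) = if a = 0 then 1 else 0 := by
  ext k
  rw [coeff_slice, PowerSeries.coeff_one]
  split_ifs with h1 h2 h2 <;> simp [PowerSeries.coeff_one, h1, h2]

/-- Vanishing of the zeroth slice means that T divides f, hence T^j divides f^j. -/
lemma slice_pow_eq_zero {f : PowerSeries (PowerSeries R)} (hf : slice 0 f = 0) {a j : ℕ}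
    (h : a < j) : slice a (f ^ j) = 0 := by
  induction j generalizing a with
  | zero => omega
  | succ j ih =>
    rw [pow_succ, slice_mul]
    refine Finset.sum_eq_zero fun i hi => ?_
    have hi' := Finset.HasAntidiagonal.mem_antidiagonal.1 hi
    rcases Nat.eq_zero_or_pos i.2 with h0 | h0
    · rw [h0, hf, mul_zero]
    · rw [ih (by omega), zero_mul]

lemma slice_lacunary (q a : ℕ) (b : ℕ → PowerSeries R) :
    slice a (lacunary q b) = lacunary q fun i => PowerSeries.coeff a (b i) := by
  ext k
  rw [coeff_slice, coeff_lacunary, coeff_lacunary]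
  split_ifs <;> simp

/-- As f is divisible by T, powers f^j with j > a do not reach T^a. As f is divisible by X, powers
with j > k do not reach X^k. The two finite sums therefore agree on a common range, and one range
serves for all k. -/
lemma slice_subst {f : PowerSeries (PowerSeries R)} (hf0 : PowerSeries.constantCoeff f = 0)
    (hf : slice 0 f = 0) (e : PowerSeries R) (a : ℕ) :
    slice a (PowerSeries.subst f (e.map PowerSeries.C)) =
      ∑ j ∈ Finset.range (a + 1), PowerSeries.C (PowerSeries.coeff j e) * slice a (f ^ j) := by
  ext k
  rw [coeff_slice, coeff_subst_eq_sum hf0, map_sum, map_sum]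
  simp only [PowerSeries.coeff_map, smul_eq_mul, PowerSeries.coeff_C_mul, coeff_slice]
  have h1 : ∀ j, a < j → PowerSeries.coeff j e *
      PowerSeries.coeff a (PowerSeries.coeff k (f ^ j)) = 0 := fun j hj => by
    rw [← coeff_slice, slice_pow_eq_zero hf hj, map_zero, mul_zero]
  have h2 : ∀ j, k < j → PowerSeries.coeff j e *
      PowerSeries.coeff a (PowerSeries.coeff k (f ^ j)) = 0 := fun j hj => by
    have : PowerSeries.X ^ j ∣ f ^ j := pow_dvd_pow_of_dvd (PowerSeries.X_dvd_iff.2 hf0) j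
    rw [PowerSeries.X_pow_dvd_iff.1 this k hj, map_zero, mul_zero]
  rw [Finset.sum_subset (Finset.range_mono (show k + 1 ≤ max k a + 1 by omega))
      (fun j _ hj => h2 j (by simpa using hj)),
    Finset.sum_subset (Finset.range_mono (show a + 1 ≤ max k a + 1 by omega))
      (fun j _ hj => h1 j (by simpa using hj))]

end Slices

/-! ### Specializing the parameter at a point of the open disc -/

section Specialization

set_option linter.unusedSectionVars false

open Filter Topology

variable {L : Type*} [NormedField L] [IsUltrametricDist L]

lemma lacunary_mem_tate {q : ℕ} (hq : 1 < q) {b : ℕ → L} (hb : Tendsto b cofinite (𝓝 0)) :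
    lacunary q b ∈ tate L := by
  rw [mem_tate, Metric.tendsto_nhds]
  intro ε hε
  have h := Metric.tendsto_nhds.1 hb ε hε
  rw [Filter.eventually_cofinite] at h ⊢
  refine (h.image fun i => q ^ i).subset fun k hk => ?_
  simp only [dist_zero_right, not_lt, Set.mem_ofPred_eq, Set.mem_image] at hk ⊢
  by_cases hi : ∃ i, k = q ^ i
  · obtain ⟨i, rfl⟩ := hi
    rw [coeff_lacunary_pow hq] at hk
    exact ⟨i, hk, rfl⟩
  · push Not at hi
    rw [coeff_lacunary_of_ne _ hi, norm_zero] at hk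
    exact absurd hk (not_le.2 hε)

lemma norm_coeff_lacunary_le {q : ℕ} {b : ℕ → L} {r : ℝ} (hb : ∀ i, ‖b i‖ ≤ r) (k : ℕ) :
    ‖PowerSeries.coeff k (lacunary q b)‖ ≤ r := by
  rw [coeff_lacunary]
  split_ifs
  · exact hb _
  · rw [norm_zero]
    exact (norm_nonneg _).trans (hb 0)

lemma C_mem_tate (x : L) : PowerSeries.C x ∈ tate L :=
  PowerSeries.isRestricted_C 1 x

/-- Each slice of e(f) is a finite polynomial expression in slices of f, and the Tate algebra is a
ring. No bound on the coefficients of e is needed. -/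
lemma slice_subst_mem_tate {f : PowerSeries (PowerSeries L)}
    (hf0 : PowerSeries.constantCoeff f = 0) (hf : slice 0 f = 0)
    (hT : ∀ a, slice a f ∈ tate L) (e : PowerSeries L) (a : ℕ) :
    slice a (PowerSeries.subst f (e.map PowerSeries.C)) ∈ tate L := by
  have hpow : ∀ j a, slice a (f ^ j) ∈ tate L := by
    intro j
    induction j with
    | zero =>
      intro a
      rw [pow_zero, slice_one]
      split_ifs
      exacts [one_mem _, zero_mem _]
    | succ j ih =>
      intro a
      rw [pow_succ, slice_mul]
      exact sum_mem fun i _ => mul_mem (ih _) (hT _)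
  rw [slice_subst hf0 hf]
  exact sum_mem fun j _ => mul_mem (C_mem_tate _) (hpow _ _)

variable [CompleteSpace L]

/-- The power series with convergent value at `x`. -/
def convergent (x : L) : Subring (PowerSeries L) := (tate L).comap (PowerSeries.rescale x)

/-- Evaluation at `x`. -/
def convergentValue (x : L) : convergent x →+* L :=
  (tateValue (L := L) (x := 1) (by simp)).comp
    (((PowerSeries.rescale x).comp (convergent x).subtype).codRestrict (tate L) fun f => f.2)

lemma convergentValue_apply (x : L) (f : convergent x) :
    convergentValue x f = value (f : PowerSeries L) x := by
  change value (PowerSeries.rescale x (f : PowerSeries L)) 1 = _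
  rw [value_rescale, mul_one]

lemma C_mem_convergent (x y : L) : PowerSeries.C y ∈ convergent x := by
  change PowerSeries.rescale x (PowerSeries.C y) ∈ tate L
  have : PowerSeries.rescale x (PowerSeries.C y) = PowerSeries.C y := by
    ext k
    rw [PowerSeries.coeff_rescale, PowerSeries.coeff_C]
    split_ifs with h <;> simp [h]
  rw [this]
  exact C_mem_tate y

lemma value_C (x y : L) : value (PowerSeries.C y) x = y := by
  rw [value, tsum_eq_single 0]
  · simp
  · intro k hk
    simp [PowerSeries.coeff_C, hk]

/-- Specialization of the parameter `T` in the composite of `e` with a lacunary series. -/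
theorem coeff_subst_specialization {q : ℕ} (hq : 1 < q) {e : PowerSeries L} {x : L}
    {b : ℕ → PowerSeries L} (hb : ∀ i, b i ∈ convergent x) (k : ℕ) :
    PowerSeries.coeff k (PowerSeries.subst (lacunary q fun i => value (b i) x) e) =
      value (PowerSeries.coeff k
        (PowerSeries.subst (lacunary q b) (e.map PowerSeries.C))) x := by
  -- The composite is formed over the ring of series convergent at x. Inclusion into L⟦T⟧ and
  -- evaluation at x are ring homomorphisms out of it, and substitution commutes with both.
  let C' : L →+* convergent x := PowerSeries.C.codRestrict (convergent x) (C_mem_convergent x)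
  let b' : ℕ → convergent x := fun i => ⟨b i, hb i⟩
  let y : PowerSeries (convergent x) := PowerSeries.subst (lacunary q b') (e.map C')
  have h0 : PowerSeries.constantCoeff (lacunary q b') = 0 := constantCoeff_lacunary hq _
  have h1 : y.map (convergent x).subtype =
      PowerSeries.subst (lacunary q b) (e.map PowerSeries.C) := by
    rw [map_powerSubst _ h0, map_lacunary]
    congr 1
  have h2 : y.map (convergentValue x) =
      PowerSeries.subst (lacunary q fun i => value (b i) x) e := by
    rw [map_powerSubst _ h0, map_lacunary]
    have : (e.map C').map (convergentValue x) = e := by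
      ext j
      rw [PowerSeries.coeff_map, PowerSeries.coeff_map, convergentValue_apply]
      exact value_C x _
    rw [this]
    simp only [convergentValue_apply]
    rfl
  rw [← h1, ← h2, PowerSeries.coeff_map, PowerSeries.coeff_map, convergentValue_apply]
  rfl

/-- Write e(B) = ∑ T^a y_a(X). Each y_a is integral and lies in the Tate algebra, and y_0 = 0. At T
= x the sum ∑ x^a y_a converges uniformly, and its coefficients are bounded by ‖x‖. -/
theorem isSmall_specialization {q : ℕ} (hq : 1 < q) {e : PowerSeries L}
    (he0 : PowerSeries.constantCoeff e = 0) {x : L} (hx : ‖x‖ < 1) {b : ℕ → PowerSeries L}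
    (hb : ∀ i, b i ∈ convergent x) (hb0 : ∀ i, PowerSeries.constantCoeff (b i) = 0)
    (hlim : ∀ a, Tendsto (fun i => PowerSeries.coeff a (b i)) cofinite (𝓝 0))
    (hint : ∀ a k, ‖PowerSeries.coeff a (PowerSeries.coeff k
        (PowerSeries.subst (lacunary q b) (e.map PowerSeries.C)))‖ ≤ 1) :
    IsSmall (PowerSeries.subst (lacunary q fun i => value (b i) x) e) := by
  have hB0 : PowerSeries.constantCoeff (lacunary q b) = 0 := constantCoeff_lacunary hq _
  have hs0 : slice 0 (lacunary q b) = 0 := by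
    rw [slice_lacunary]
    ext k
    rw [coeff_lacunary]
    simp [hb0]
  set y := PowerSeries.subst (lacunary q b) (e.map PowerSeries.C) with hy
  have hy0 : ∀ k, PowerSeries.constantCoeff (PowerSeries.coeff k y) = 0 := by
    intro k
    rw [← PowerSeries.coeff_zero_eq_constantCoeff_apply, ← coeff_slice, hy, slice_subst hB0 hs0]
    simp [he0]
  have hyT : ∀ a, slice a y ∈ tate L := slice_subst_mem_tate hB0 hs0
    (fun a => by rw [slice_lacunary]; exact lacunary_mem_tate hq (hlim a)) e
  refine ⟨PowerSeries.constantCoeff_subst_eq_zero (constantCoeff_lacunary hq _) _ he0, ?_, ?_⟩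
  · refine mem_tate_of_combination (J := ℕ) (G := fun _ => 1) (by simp)
      (h := fun a => PowerSeries.C (x ^ a) * slice a y)
      (r := fun a => ‖x‖ ^ a) (tendsto_pow_cofinite (norm_nonneg _) hx) (fun a k => ?_)
      (fun a => mul_mem (C_mem_tate _) (hyT a)) fun k => ?_
    · rw [PowerSeries.coeff_C_mul, norm_mul, norm_pow, coeff_slice]
      exact mul_le_of_le_one_right (pow_nonneg (norm_nonneg _) _) (hint a k)
    · rw [coeff_subst_specialization hq hb, ← hy, value]
      refine tsum_congr fun a => ?_
      rw [PowerSeries.coeff_C_mul, coeff_slice, one_mul, mul_comm]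
  · refine ⟨‖x‖, hx, fun k => ?_⟩
    rw [coeff_subst_specialization hq hb, ← hy, ← mul_one x, ← value_rescale]
    refine norm_value_le (by simp) (norm_nonneg _) fun a => ?_
    rw [PowerSeries.coeff_rescale, norm_mul, norm_pow, mul_one]
    rcases a with _ | a
    · rw [PowerSeries.coeff_zero_eq_constantCoeff_apply, hy0, norm_zero, mul_zero]
      exact norm_nonneg _
    · refine (mul_le_of_le_one_right (pow_nonneg (norm_nonneg _) _) (hint _ _)).trans ?_
      rw [pow_succ]
      exact mul_le_of_le_one_left (norm_nonneg _) (pow_le_one₀ (norm_nonneg _) hx.le)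

end Specialization

/-! ### Iterates of Q and their scaled limit -/

section Iterates

set_option linter.unusedSectionVars false

open Filter Topology

lemma IsExpLog.iter_eq {L : Type*} [Field L] {c : L} {Q e l : PowerSeries L}
    (h : IsExpLog c Q e l) (hQ : PowerSeries.constantCoeff Q = 0) (i : ℕ) :
    iter Q i = PowerSeries.subst (c ^ i • l) e := by
  induction i with
  | zero =>
    rw [pow_zero, one_smul, h.exp_log]
    rfl
  | succ i ih =>
    rw [iter_succ' hQ, ih, pow_succ', mul_smul]
    refine subst_exp_apply' h.exp_zero h.subst_exp ?_
    change PowerSeries.constantCoeff (c ^ i • l) = 0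
    rw [PowerSeries.smul_eq_C_mul, map_mul, h.log_zero, mul_zero]

variable {L : Type*} [NormedField L] [IsUltrametricDist L]

/-- Since Q^{∘i} = e(c^i l), one has Q^{∘i} / c^i = ∑_s c^{i(s-1)} e_s l^s. The term s = 0 vanishes,
s = 1 is constant in i, and the others tend to 0, so the limit is the coefficient of the logarithm
l. -/
lemma tendsto_coeff_scaledIter {c : L} (hc0 : c ≠ 0) (hc : ‖c‖ < 1) {Q e l : PowerSeries L}
    (h : IsExpLog c Q e l) (hQ : PowerSeries.constantCoeff Q = 0) (a : ℕ) :
    ∃ z, Tendsto (fun i => PowerSeries.coeff a (scaledIter c Q i)) atTop (𝓝 z) := by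
  have hformula : ∀ i, PowerSeries.coeff a (scaledIter c Q i) =
      ∑ s ∈ Finset.range (a + 1), (c ^ i)⁻¹ * (c ^ i) ^ s *
        (PowerSeries.coeff s e * PowerSeries.coeff a (l ^ s)) := by
    intro i
    have h0 : PowerSeries.constantCoeff (c ^ i • l) = 0 := by
      rw [PowerSeries.smul_eq_C_mul, map_mul, h.log_zero, mul_zero]
    rw [scaledIter, map_smul, h.iter_eq hQ, coeff_subst_eq_sum h0, smul_eq_mul, Finset.mul_sum]
    refine Finset.sum_congr rfl fun s _ => ?_
    rw [smul_pow, map_smul, smul_eq_mul, smul_eq_mul]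
    ring
  simp only [hformula]
  have hterm : ∀ s, ∃ z, Tendsto (fun i => (c ^ i)⁻¹ * (c ^ i) ^ s *
      (PowerSeries.coeff s e * PowerSeries.coeff a (l ^ s))) atTop (𝓝 z) := by
    intro s
    rcases s with _ | _ | s
    · refine ⟨0, ?_⟩
      simp [h.exp_zero]
    · refine ⟨PowerSeries.coeff 1 e * PowerSeries.coeff a (l ^ 1), ?_⟩
      have : ∀ i : ℕ, (c ^ i)⁻¹ * (c ^ i) ^ (0 + 1) = 1 := fun i => by
        rw [zero_add, pow_one, inv_mul_cancel₀ (pow_ne_zero i hc0)]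
      simp only [this, one_mul]
      exact tendsto_const_nhds
    · refine ⟨0, ?_⟩
      have h1 : ∀ i : ℕ, (c ^ i)⁻¹ * (c ^ i) ^ (s + 1 + 1) = (c ^ (s + 1)) ^ i := fun i => by
        rw [pow_succ (c ^ i), mul_comm (_ ^ (s + 1)), inv_mul_cancel_left₀ (pow_ne_zero i hc0),
          ← pow_mul, ← pow_mul, mul_comm]
      simp only [h1]
      have h2 : Tendsto (fun i : ℕ => (c ^ (s + 1)) ^ i) atTop (𝓝 0) := by
        refine tendsto_pow_atTop_nhds_zero_of_norm_lt_one ?_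
        rw [norm_pow]
        exact pow_lt_one₀ (norm_nonneg _) hc (by omega)
      simpa using h2.mul_const (PowerSeries.coeff (s + 1 + 1) e *
        PowerSeries.coeff a (l ^ (s + 1 + 1)))
  choose z hz using hterm
  exact ⟨_, tendsto_finsetSum _ fun s _ => hz s⟩

lemma tendsto_sub_shift {b : ℕ → L} {z : L} (h : Tendsto b atTop (𝓝 z)) :
    Tendsto (b - shift b) cofinite (𝓝 0) := by
  rw [Nat.cofinite_eq_atTop, ← tendsto_add_atTop_iff_nat 1]
  have := ((tendsto_add_atTop_iff_nat 1).2 h).sub h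
  rw [sub_self] at this
  exact this

variable [CompleteSpace L]

lemma norm_coeff_iter_le {Q : PowerSeries L} (hQ0 : PowerSeries.constantCoeff Q = 0)
    (hQ : ∀ k, ‖PowerSeries.coeff k Q‖ ≤ 1) (i k : ℕ) : ‖PowerSeries.coeff k (iter Q i)‖ ≤ 1 := by
  induction i generalizing k with
  | zero =>
    rw [iter, PowerSeries.coeff_X]
    split_ifs <;> simp
  | succ i ih => exact norm_coeff_subst_le le_rfl hQ0 hQ (constantCoeff_iter hQ0 i) ih k

/-- Values of the iterates of an integral series. -/
lemma value_iter_succ {Q : PowerSeries L} (hQ0 : PowerSeries.constantCoeff Q = 0)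
    (hQ : ∀ k, ‖PowerSeries.coeff k Q‖ ≤ 1) {x : L} (hx : ‖x‖ < 1) (i : ℕ) :
    value (iter Q (i + 1)) x = value Q (value (iter Q i) x) := by
  rw [iter_succ' hQ0, value_subst' (constantCoeff_iter hQ0 i) (norm_coeff_iter_le hQ0 hQ i) hQ hx]

lemma iter_mem_convergent {Q : PowerSeries L} (hQ0 : PowerSeries.constantCoeff Q = 0)
    (hQ : ∀ k, ‖PowerSeries.coeff k Q‖ ≤ 1) {x : L} (hx : ‖x‖ < 1) (i : ℕ) :
    iter Q i ∈ convergent x :=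
  (isSmall_rescale (constantCoeff_iter hQ0 i) (norm_coeff_iter_le hQ0 hQ i) hx).mem_tate

lemma scaledIter_mem_convergent (c : L) {Q : PowerSeries L}
    (hQ0 : PowerSeries.constantCoeff Q = 0)
    (hQ : ∀ k, ‖PowerSeries.coeff k Q‖ ≤ 1) {x : L} (hx : ‖x‖ < 1) (i : ℕ) :
    scaledIter c Q i ∈ convergent x := by
  rw [scaledIter, PowerSeries.smul_eq_C_mul]
  exact mul_mem (C_mem_convergent _ _) (iter_mem_convergent hQ0 hQ hx i)

lemma value_scaledIter (c : L) {Q : PowerSeries L}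
    (hQ0 : PowerSeries.constantCoeff Q = 0)
    (hQ : ∀ k, ‖PowerSeries.coeff k Q‖ ≤ 1) {x : L} (hx : ‖x‖ < 1) (i : ℕ) :
    value (scaledIter c Q i) x = value (iter Q i) x / c ^ i := by
  have h1 := map_mul (convergentValue x) ⟨_, C_mem_convergent x (c ^ i)⁻¹⟩
    ⟨_, iter_mem_convergent hQ0 hQ hx i⟩
  rw [convergentValue_apply, convergentValue_apply, convergentValue_apply] at h1
  rw [scaledIter, PowerSeries.smul_eq_C_mul]
  refine h1.trans ?_
  rw [value_C, div_eq_mul_inv, mul_comm]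

/-- The specialization T = x of the generic argument. The linear coefficient of Q must be exactly c:
only then do Q^{∘i} / c^i converge coefficientwise and their successive differences tend to 0. -/
theorem isSmall_subst_iterates {q : ℕ} (hq : 1 < q) {c : L} (hc0 : c ≠ 0) (hc : ‖c‖ < 1)
    {Q : PowerSeries L} (hQ0 : PowerSeries.constantCoeff Q = 0) (hQ1 : PowerSeries.coeff 1 Q = c)
    (hQ : ∀ k, ‖PowerSeries.coeff k Q‖ ≤ 1) {e : PowerSeries L}
    (he0 : PowerSeries.constantCoeff e = 0)
    (hint : ∀ a k, ‖PowerSeries.coeff a (PowerSeries.coeff k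
        (PowerSeries.subst (genericArgument q c Q) (e.map PowerSeries.C)))‖ ≤ 1)
    {x : L} (hx : ‖x‖ < 1) :
    IsSmall (PowerSeries.subst (lacunary q ((fun i => value (iter Q i) x / c ^ i) -
      shift fun i => value (iter Q i) x / c ^ i)) e) := by
  have hcj : ∀ j, 2 ≤ j → c ^ j ≠ c := by
    intro j hj h
    have h1 : c ^ (j - 1) = 1 := by
      apply mul_right_cancel₀ hc0
      rw [← pow_succ, one_mul, Nat.sub_add_cancel (by omega), h]
    have h2 := pow_lt_one₀ (norm_nonneg c) hc (show j - 1 ≠ 0 by omega)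
    rw [← norm_pow, h1, norm_one] at h2
    exact lt_irrefl _ h2
  obtain ⟨e', l', h⟩ := exists_isExpLog hcj hQ0 hQ1
  have hmem := scaledIter_mem_convergent c hQ0 hQ hx
  have hval := value_scaledIter c hQ0 hQ hx
  have h0 : ∀ i, PowerSeries.constantCoeff (scaledIter c Q i) = 0 := fun i => by
    rw [scaledIter, PowerSeries.smul_eq_C_mul, map_mul, constantCoeff_iter hQ0, mul_zero]
  have := isSmall_specialization hq he0 hx (b := scaledIter c Q - shift (scaledIter c Q))
    (fun i => ?_) (fun i => ?_) (fun a => ?_) hint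
  · convert this using 3
    funext i
    rcases i with _ | i
    · simp [shift, hval]
    · have h1 := map_sub (convergentValue x) ⟨_, hmem (i + 1)⟩ ⟨_, hmem i⟩
      rw [convergentValue_apply, convergentValue_apply, convergentValue_apply] at h1
      refine Eq.trans ?_ h1.symm
      rw [hval, hval]
      rfl
  · rcases i with _ | i
    · exact sub_mem (hmem 0) (zero_mem _)
    · exact sub_mem (hmem _) (hmem _)
  · rcases i with _ | i
    · rw [Pi.sub_apply, map_sub, h0, zero_sub, neg_eq_zero]
      exact map_zero _
    · rw [Pi.sub_apply, map_sub, h0, zero_sub, neg_eq_zero]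
      exact h0 i
  · obtain ⟨z, hz⟩ := tendsto_coeff_scaledIter hc0 hc h hQ0 a
    convert tendsto_sub_shift hz using 1
    funext i
    rcases i with _ | i
    · simp [shift]
    · simp [shift]

end Iterates

/-! ### Comparing a chain of roots with an orbit -/

section Estimates

set_option linter.unusedSectionVars false

open Filter Topology

variable {L : Type*} [NormedField L] [IsUltrametricDist L] [CompleteSpace L]

lemma summable_of_norm_le_one {G : PowerSeries L} (hG : ∀ k, ‖PowerSeries.coeff k G‖ ≤ 1) {x : L}
    (hx : ‖x‖ < 1) : Summable fun k : ℕ => PowerSeries.coeff k G * x ^ k := by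
  refine NonarchimedeanAddGroup.summable_of_tendsto_cofinite_zero (squeeze_zero_norm (fun k => ?_)
    (tendsto_pow_cofinite (norm_nonneg x) hx))
  rw [norm_mul, norm_pow]
  exact mul_le_of_le_one_left (pow_nonneg (norm_nonneg _) _) (hG k)

lemma norm_value_le_norm {G : PowerSeries L} (hG0 : PowerSeries.constantCoeff G = 0)
    (hG : ∀ k, ‖PowerSeries.coeff k G‖ ≤ 1) {x : L} (hx : ‖x‖ < 1) : ‖value G x‖ ≤ ‖x‖ := by
  refine (IsUltrametricDist.norm_tsum_le _).trans (Real.iSup_le (fun k => ?_) (norm_nonneg _))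
  rcases k with _ | k
  · simp [hG0]
  · rw [norm_mul, norm_pow, pow_succ]
    exact (mul_le_of_le_one_left (by positivity) (hG _)).trans
      (mul_le_of_le_one_left (norm_nonneg _) (pow_le_one₀ (norm_nonneg _) hx.le))

lemma norm_value_sub_value_le {G : PowerSeries L} (hG : ∀ k, ‖PowerSeries.coeff k G‖ ≤ 1) {x y : L}
    (hx : ‖x‖ < 1) (hy : ‖y‖ < 1) : ‖value G x - value G y‖ ≤ ‖x - y‖ := by
  rw [value, value, ← (summable_of_norm_le_one hG hx).tsum_sub (summable_of_norm_le_one hG hy)]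
  refine (IsUltrametricDist.norm_tsum_le _).trans (Real.iSup_le (fun k => ?_) (norm_nonneg _))
  rw [← mul_sub, ← (Commute.all x y).mul_geom_sum₂ k, norm_mul, norm_mul]
  have h : ‖∑ i ∈ Finset.range k, x ^ i * y ^ (k - 1 - i)‖ ≤ 1 := by
    refine IsUltrametricDist.norm_sum_le_of_forall_le_of_nonneg zero_le_one fun i _ => ?_
    rw [norm_mul, norm_pow, norm_pow]
    exact mul_le_one₀ (pow_le_one₀ (norm_nonneg _) hx.le) (by positivity)
      (pow_le_one₀ (norm_nonneg _) hy.le)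
  exact (mul_le_of_le_one_left (by positivity) (hG k)).trans
    (mul_le_of_le_one_right (norm_nonneg _) h)

lemma value_C_mul_X (c x : L) : value (PowerSeries.C c * PowerSeries.X) x = c * x := by
  rw [value, tsum_eq_single 1]
  · simp
  · intro k hk
    simp [PowerSeries.coeff_X, hk]

lemma value_add_C_mul_X {G : PowerSeries L} (hG : ∀ k, ‖PowerSeries.coeff k G‖ ≤ 1) (c : L) {x : L}
    (hx : ‖x‖ < 1) :
    value (G + PowerSeries.C c * PowerSeries.X) x = value G x + c * x := by
  have h : Summable fun k : ℕ => PowerSeries.coeff k (PowerSeries.C c * PowerSeries.X) * x ^ k := by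
    refine summable_of_ne_finset_zero (s := {1}) fun k hk => ?_
    rw [Finset.mem_singleton] at hk
    simp [PowerSeries.coeff_X, hk]
  rw [← value_C_mul_X c x, value, value, value, ← (summable_of_norm_le_one hG hx).tsum_add h]
  simp only [map_add, add_mul]

lemma norm_value_sub_mul_le {G : PowerSeries L} (hG0 : PowerSeries.constantCoeff G = 0) {c : L}
    (hG1 : PowerSeries.coeff 1 G = c) (hG : ∀ k, ‖PowerSeries.coeff k G‖ ≤ 1) {x : L}
    (hx : ‖x‖ < 1) : ‖value G x - c * x‖ ≤ ‖x‖ ^ 2 := by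
  rw [sub_eq_add_neg, ← neg_mul, ← value_add_C_mul_X hG _ hx]
  refine (IsUltrametricDist.norm_tsum_le _).trans (Real.iSup_le (fun k => ?_) (by positivity))
  rw [map_add, PowerSeries.coeff_C_mul, PowerSeries.coeff_X]
  rcases k with _ | _ | k
  · simp [hG0]
  · simp [hG1]
  · rw [if_neg (by omega), mul_zero, add_zero, norm_mul, norm_pow, show k + 1 + 1 = k + 2 from rfl,
      pow_add]
    exact (mul_le_of_le_one_left (by positivity) (hG _)).trans
      (mul_le_of_le_one_left (by positivity) (pow_le_one₀ (norm_nonneg _) hx.le))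

/-- Integrality of the exponential of a convergent lacunary argument that is small. -/
lemma isSmall_subst_lacunary {q : ℕ} (hq : 1 < q) {c : L} (hc0 : c ≠ 0) {e : PowerSeries L}
    (he0 : PowerSeries.constantCoeff e = 0)
    (hE : ∀ k, ‖PowerSeries.coeff k (PowerSeries.rescale c e)‖ ≤ 1) {d : ℕ → L} {r : ℝ}
    (hr : r < 1) (hd : ∀ i, ‖d i‖ ≤ ‖c‖ * r) (hlim : Tendsto d cofinite (𝓝 0)) :
    IsSmall (PowerSeries.subst (lacunary q d) e) := by
  -- e(A) is the series e(cX), which is integral, evaluated at the small series c⁻¹ A.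
  have hd' : d = fun i => c * (c⁻¹ * d i) := by
    funext i
    rw [mul_inv_cancel_left₀ hc0]
  rw [hd', lacunary_C_mul, subst_C_mul (constantCoeff_lacunary hq _)]
  refine IsSmall.subst ⟨constantCoeff_lacunary hq _, lacunary_mem_tate hq ?_, r, hr,
    norm_coeff_lacunary_le fun i => ?_⟩ ?_ hE
  · simpa using hlim.const_mul c⁻¹
  · rw [norm_mul, norm_inv]
    exact (inv_mul_le_iff₀ (norm_pos_iff.2 hc0)).2 (hd i)
  · rw [← PowerSeries.coeff_zero_eq_constantCoeff_apply, PowerSeries.coeff_rescale,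
      PowerSeries.coeff_zero_eq_constantCoeff_apply, he0, mul_zero]

/-- The exponential of the argument attached to a chain of preimages of `0` under `Q`, where `Q` is
close to a series `Q'` for which the exponential of the generic argument is integral. -/
theorem isSmall_subst_chain {q : ℕ} (hq : 1 < q) {c : L} (hc0 : c ≠ 0) (hc : ‖c‖ < 1)
    {F : FormalGroup L} (hF : ∀ d, ‖MvPowerSeries.coeff d F.toPowerSeries‖ ≤ 1)
    {e : PowerSeries L} (he : IsFormalExp F e)
    (hE : ∀ k, ‖PowerSeries.coeff k (PowerSeries.rescale c e)‖ ≤ 1) {Q Q' : PowerSeries L}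
    (hQ0 : PowerSeries.constantCoeff Q = 0) (hQ : ∀ k, ‖PowerSeries.coeff k Q‖ ≤ 1)
    (hQ0' : PowerSeries.constantCoeff Q' = 0) (hQ1' : PowerSeries.coeff 1 Q' = c)
    (hQ' : ∀ k, ‖PowerSeries.coeff k Q'‖ ≤ 1) {δ : L}
    (hδ : Q' = Q + PowerSeries.C δ * PowerSeries.X) {m n : ℕ} (hmn : m ≤ n)
    (hδn : ‖δ‖ ≤ ‖c‖ ^ (n + 1))
    (hint : ∀ a k, ‖PowerSeries.coeff a (PowerSeries.coeff k
        (PowerSeries.subst (genericArgument q c Q') (e.map PowerSeries.C)))‖ ≤ 1)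
    {w : ℕ → L} (hw : ‖w 0‖ < 1) (hw1 : ∀ j, j < m → w (j + 1) = value Q (w j))
    (hw2 : ∀ j, m ≤ j → w j = 0) :
    IsSmall (PowerSeries.subst (lacunary q ((fun i => w i / c ^ i) -
      shift fun i => w i / c ^ i)) e) := by
  -- The genuine Q'-orbit of w 0, to which `isSmall_subst_iterates` applies; w is treated as a
  -- perturbation of it.
  set x : ℕ → L := fun i => value (iter Q' i) (w 0) with hx
  have hcpos : 0 < ‖c‖ := norm_pos_iff.2 hc0
  have hxs : ∀ i, x (i + 1) = value Q' (x i) := value_iter_succ hQ0' hQ' hw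
  have hx0 : x 0 = w 0 := by
    have := value_C_mul_X 1 (w 0)
    rwa [map_one, one_mul, one_mul] at this
  have hxn : ∀ i, ‖x i‖ ≤ ‖w 0‖ := by
    intro i
    induction i with
    | zero => rw [hx0]
    | succ i ih => rw [hxs]; exact (norm_value_le_norm hQ0' hQ' (ih.trans_lt hw)).trans ih
  have hwn : ∀ i, i ≤ m → ‖w i‖ ≤ ‖w 0‖ := by
    intro i
    induction i with
    | zero => intro _; exact le_rfl
    | succ i ih =>
      intro hi
      have := ih (by omega)
      rw [hw1 i (by omega)]
      exact (norm_value_le_norm hQ0 hQ (this.trans_lt hw)).trans this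
  -- Each step introduces the error δ w_j, while Q' is 1-Lipschitz on the open disc, so by the
  -- ultrametric inequality errors do not accumulate.
  have hxw : ∀ j, j ≤ m → ‖x j - w j‖ ≤ ‖c‖ ^ (n + 1) * ‖w 0‖ := by
    intro j
    induction j with
    | zero =>
      intro _
      rw [hx0, sub_self, norm_zero]
      positivity
    | succ j ih =>
      intro hj
      have h1 := hwn j (by omega)
      have h2 : x (j + 1) - w (j + 1) = (value Q' (x j) - value Q' (w j)) + δ * w j := by
        rw [hxs, hw1 j (by omega), hδ, value_add_C_mul_X hQ δ (h1.trans_lt hw)]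
        ring
      rw [h2]
      refine (IsUltrametricDist.norm_add_le_max _ _).trans (max_le ?_ ?_)
      · exact (norm_value_sub_value_le hQ' ((hxn j).trans_lt hw) (h1.trans_lt hw)).trans
          (ih (by omega))
      · rw [norm_mul]
        exact mul_le_mul hδn h1 (norm_nonneg _) (by positivity)
  -- At index m the chain has reached 0, so x_m is itself the error. Where ‖x‖ ≤ ‖c‖, both terms of
  -- Q'(x) = cx + (terms bounded by ‖x‖²) are at most ‖c‖ ‖x‖, and each further step gains a factor
  -- ‖c‖.
  have htail : ∀ k, ‖x (m + k)‖ ≤ ‖c‖ ^ (n + 1 + k) * ‖w 0‖ := by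
    intro k
    induction k with
    | zero =>
      have := hxw m le_rfl
      rwa [hw2 m le_rfl, sub_zero] at this
    | succ k ih =>
      have h1 : ‖x (m + k)‖ ≤ ‖c‖ := by
        refine ih.trans ((mul_le_of_le_one_right (by positivity) hw.le).trans ?_)
        exact pow_le_of_le_one hcpos.le hc.le (by omega)
      have h2 : ‖x (m + (k + 1))‖ ≤ ‖c‖ * ‖x (m + k)‖ := by
        have h3 : x (m + (k + 1)) = (value Q' (x (m + k)) - c * x (m + k)) + c * x (m + k) := by
          rw [sub_add_cancel, ← hxs]
          rfl
        rw [h3]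
        refine (IsUltrametricDist.norm_add_le_max _ _).trans (max_le ?_ (norm_mul _ _).le)
        refine (norm_value_sub_mul_le hQ0' hQ1' hQ' (h1.trans_lt hc)).trans ?_
        rw [pow_two]
        exact mul_le_mul_of_nonneg_right h1 (norm_nonneg _)
      refine h2.trans ((mul_le_mul_of_nonneg_left ih hcpos.le).trans (le_of_eq ?_))
      ring
  set d : ℕ → L := fun i => w i / c ^ i - x i / c ^ i with hd
  -- Up to i = m ≤ n, division by c^i still leaves one factor of c in the error ‖c‖^{n+1}. This is
  -- where the exponent n + 1 is spent.
  have hdn : ∀ i, ‖d i‖ ≤ ‖c‖ * ‖w 0‖ := by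
    intro i
    have h1 : ‖x i - w i‖ ≤ ‖c‖ ^ (i + 1) * ‖w 0‖ := by
      rcases le_total i m with hi | hi
      · exact (hxw i hi).trans (mul_le_mul_of_nonneg_right
          (pow_le_pow_of_le_one hcpos.le hc.le (by omega)) (norm_nonneg _))
      · obtain ⟨k, rfl⟩ := Nat.exists_eq_add_of_le hi
        rw [hw2 _ hi, sub_zero]
        exact (htail k).trans (mul_le_mul_of_nonneg_right
          (pow_le_pow_of_le_one hcpos.le hc.le (by omega)) (norm_nonneg _))
    rw [hd]
    simp only
    rw [← sub_div, norm_div, norm_pow, norm_sub_rev, div_le_iff₀ (by positivity)]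
    exact h1.trans (le_of_eq (by ring))
  -- Smallness of d itself at infinity is not claimed. Past m the differences are −(Q'(x_i) − c x_i)
  -- / c^{i+1}, and the numerator is quadratic in x_i.
  have hdlim : Tendsto (d - shift d) cofinite (𝓝 0) := by
    rw [Nat.cofinite_eq_atTop, ← tendsto_add_atTop_iff_nat (m + 1)]
    refine squeeze_zero_norm (a := fun k => ‖c‖ ^ k) (fun k => ?_)
      (tendsto_pow_atTop_nhds_zero_of_lt_one hcpos.le hc)
    have h1 : (d - shift d) (k + (m + 1)) =
        -((value Q' (x (m + k)) - c * x (m + k)) / c ^ (k + (m + 1))) := by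
      rw [show k + (m + 1) = (m + k) + 1 by ring]
      change (w (m + k + 1) / c ^ (m + k + 1) - x (m + k + 1) / c ^ (m + k + 1)) -
        (w (m + k) / c ^ (m + k) - x (m + k) / c ^ (m + k)) = _
      rw [hw2 _ (by omega), hw2 _ (by omega), hxs]
      field_simp
      ring
    have h2 : ‖x (m + k)‖ ≤ ‖c‖ ^ (n + 1 + k) :=
      (htail k).trans (mul_le_of_le_one_right (by positivity) hw.le)
    have h3 : ‖x (m + k)‖ < 1 := (hxn _).trans_lt hw
    rw [h1, norm_neg, norm_div, norm_pow, div_le_iff₀ (by positivity), ← pow_add]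
    refine (norm_value_sub_mul_le hQ0' hQ1' hQ' h3).trans
      ((pow_le_pow_left₀ (norm_nonneg _) h2 2).trans ?_)
    rw [← pow_mul]
    exact pow_le_pow_of_le_one hcpos.le hc.le (by omega)
  have hsd : ∀ i, ‖(d - shift d) i‖ ≤ ‖c‖ * ‖w 0‖ := by
    intro i
    rcases i with _ | i
    · simpa [shift] using hdn 0
    · rw [Pi.sub_apply, sub_eq_add_neg]
      refine (IsUltrametricDist.norm_add_le_max _ _).trans (max_le (hdn _) ?_)
      rw [norm_neg]
      exact hdn i
  have hE1 := isSmall_subst_iterates hq hc0 hc hQ0' hQ1' hQ' he.constantCoeff_eq hint hw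
  have hE2 := isSmall_subst_lacunary hq hc0 he.constantCoeff_eq hE hw hsd hdlim
  -- The argument of w is that of the orbit plus that of d, so its exponential is the F-sum of two
  -- small series.
  have hsum : lacunary q ((fun i => w i / c ^ i) - shift fun i => w i / c ^ i) =
      lacunary q ((fun i => x i / c ^ i) - shift fun i => x i / c ^ i) +
        lacunary q (d - shift d) := by
    rw [← lacunary_add]
    congr 1
    funext i
    rcases i with _ | i
    · simp [shift, hd]
    · simp only [shift, hd, Pi.sub_apply, Pi.add_apply]
      ring
  rw [hsum, he.subst_add (constantCoeff_lacunary hq _) (constantCoeff_lacunary hq _)]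
  exact hE1.pair hE2 F hF

end Estimates

/-! ### The relation between values -/

section Relation

set_option linter.unusedSectionVars false

open Filter Topology

/-- The sequence `r` moved `j` places to the right. -/
def shiftBy {S : Type*} [Zero S] (j : ℕ) (r : ℕ → S) (i : ℕ) : S := if j ≤ i then r (i - j) else 0

lemma expand_pow_lacunary {S : Type*} [CommRing S] {q : ℕ} (hq : 1 < q) (j : ℕ) (r : ℕ → S) :
    (lacunary q r).expand (q ^ j) (pow_pos (by omega) j).ne' = lacunary q (shiftBy j r) := by
  refine lacunary_ext hq (fun i => ?_) fun k hk => ?_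
  · rw [shiftBy]
    split_ifs with h
    · obtain ⟨l, rfl⟩ := Nat.exists_eq_add_of_le h
      rw [pow_add, PowerSeries.coeff_expand_mul, coeff_lacunary_pow hq, Nat.add_sub_cancel_left]
    · rw [PowerSeries.coeff_expand_of_not_dvd]
      rwa [Nat.pow_dvd_pow_iff_le_right hq]
  · rw [PowerSeries.coeff_expand]
    split_ifs with h
    · obtain ⟨l, rfl⟩ := h
      rw [Nat.mul_div_cancel_left l (pow_pos (by omega) j), coeff_lacunary_of_ne]
      rintro i rfl
      exact hk (j + i) (pow_add q j i).symm
    · rfl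

lemma shiftBy_sub_shift {S : Type*} [CommRing S] (j : ℕ) (r : ℕ → S) :
    shiftBy j (r - shift r) = shiftBy j r - shift (shiftBy j r) := by
  funext i
  rcases i with _ | i
  · rcases j with _ | j <;> simp [shiftBy, shift]
  · rcases lt_trichotomy j (i + 1) with h | h | h
    · have h1 : i + 1 - j = (i - j) + 1 := by omega
      simp [shiftBy, shift, h.le, Nat.lt_succ_iff.1 h, h1]
    · subst h
      simp [shiftBy, shift]
    · simp [shiftBy, shift, show ¬ j ≤ i + 1 by omega, show ¬ j ≤ i by omega]

variable {L : Type*} [NormedField L] [IsUltrametricDist L] [CompleteSpace L]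

lemma value_expand (f : PowerSeries L) {N : ℕ} (hN : N ≠ 0) (x : L) :
    value (f.expand N hN) x = value f (x ^ N) := by
  have hinj : Function.Injective fun k : ℕ => N * k := fun a b h => Nat.eq_of_mul_eq_mul_left (Nat.pos_of_ne_zero hN) h
  rw [value, ← hinj.tsum_eq]
  · refine tsum_congr fun k => ?_
    rw [PowerSeries.coeff_expand_mul, pow_mul]
  · intro k hk
    by_contra h
    refine hk ?_
    change PowerSeries.coeff k (f.expand N hN) * x ^ k = 0
    rw [PowerSeries.coeff_expand_of_not_dvd, zero_mul]
    rintro ⟨l, hl⟩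
    exact h ⟨l, hl.symm⟩

lemma IsSmall.expand {f : PowerSeries L} (hf : IsSmall f) {N : ℕ} (hN : N ≠ 0) :
    IsSmall (f.expand N hN) := by
  obtain ⟨r, hr, h⟩ := hf.exists_bound
  refine ⟨by rw [PowerSeries.constantCoeff_expand, hf.constantCoeff_eq], LubinTateExp.mem_tate.2 ?_, r, hr,
    fun k => ?_⟩
  · rw [Metric.tendsto_nhds]
    intro ε hε
    have h1 := Metric.tendsto_nhds.1 (LubinTateExp.mem_tate.1 hf.mem_tate) ε hε
    rw [Filter.eventually_cofinite] at h1 ⊢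
    refine (h1.image fun i => N * i).subset fun k hk => ?_
    simp only [dist_zero_right, not_lt, Set.mem_ofPred_eq, Set.mem_image] at hk ⊢
    by_cases hd : N ∣ k
    · obtain ⟨l, rfl⟩ := hd
      rw [PowerSeries.coeff_expand_mul] at hk
      exact ⟨l, hk, rfl⟩
    · rw [PowerSeries.coeff_expand_of_not_dvd _ _ _ hd, norm_zero] at hk
      exact absurd hk (not_le.2 hε)
  · rw [PowerSeries.coeff_expand]
    split_ifs
    · exact h _
    · rw [norm_zero]
      exact (norm_nonneg _).trans (h 0)

lemma IsSmall.rescale {f : PowerSeries L} (hf : IsSmall f) {x : L} (hx : ‖x‖ ≤ 1) :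
    IsSmall (PowerSeries.rescale x f) := by
  obtain ⟨r, hr, h⟩ := hf.exists_bound
  have h1 : ∀ k, ‖PowerSeries.coeff k (PowerSeries.rescale x f)‖ ≤ ‖PowerSeries.coeff k f‖ :=
    fun k => by
      rw [PowerSeries.coeff_rescale, mul_comm]
      exact norm_coeff_mul_pow_le hx k
  refine ⟨?_, LubinTateExp.mem_tate.2 (squeeze_zero_norm h1
    (tendsto_zero_iff_norm_tendsto_zero.1 (LubinTateExp.mem_tate.1 hf.mem_tate))), r, hr,
    fun k => (h1 k).trans (h k)⟩
  rw [← PowerSeries.coeff_zero_eq_constantCoeff_apply, PowerSeries.coeff_rescale,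
    PowerSeries.coeff_zero_eq_constantCoeff_apply, hf.constantCoeff_eq, mul_zero]

lemma isSmall_zero : IsSmall (0 : PowerSeries L) :=
  ⟨map_zero _, zero_mem _, 0, zero_lt_one, by simp⟩

/-- From z^q = z follows z^{q^i} = z for all i. This is why the digits are zero or roots of unity:
multiplying the argument by z amounts to replacing X by zX. -/
lemma rescale_lacunary {q : ℕ} {z : L} (hz : z ^ q = z) (r : ℕ → L) :
    PowerSeries.rescale z (lacunary q r) = PowerSeries.C z * lacunary q r := by
  have hzi : ∀ i, z ^ q ^ i = z := by
    intro i
    induction i with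
    | zero => rw [pow_zero, pow_one]
    | succ i ih => rw [pow_succ, pow_mul, ih, hz]
  ext k
  rw [PowerSeries.coeff_rescale, PowerSeries.coeff_C_mul, coeff_lacunary]
  split_ifs with h
  · rw [← h, hzi]
  · simp

/-- The exponential of a small argument `∑ t i (X ^ (q ^ i) - X ^ (q ^ (i + 1)))` vanishes
at `1`. -/
lemma value_subst_lacunary {q : ℕ} (hq : 1 < q) {c : L} (hc0 : c ≠ 0) {e : PowerSeries L}
    (he0 : PowerSeries.constantCoeff e = 0)
    (hE : ∀ k, ‖PowerSeries.coeff k (PowerSeries.rescale c e)‖ ≤ 1) {t : ℕ → L} {r : ℝ}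
    (hr : r < 1) (ht : ∀ i, ‖t i‖ ≤ ‖c‖ * r) (hlim : Tendsto t cofinite (𝓝 0)) :
    IsSmall (PowerSeries.subst (lacunary q (t - shift t)) e) ∧
      value (PowerSeries.subst (lacunary q (t - shift t)) e) 1 = 0 := by
  -- With t = c s the exponential becomes e(cX), integral, composed with S(X) − S(X^q) for a small
  -- series S. Evaluation at 1 then commutes with the composition, and S(1) − S(1) = 0.
  set s : ℕ → L := fun i => c⁻¹ * t i with hs
  have hcs : (t - shift t) = fun i => c * (s - shift s) i := by
    funext i
    rcases i with _ | i <;> simp [shift, hs, mul_sub, mul_inv_cancel_left₀ hc0]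
  have hsn : ∀ i, ‖s i‖ ≤ r := fun i => by
    rw [hs, norm_mul, norm_inv]
    exact (inv_mul_le_iff₀ (norm_pos_iff.2 hc0)).2 (ht i)
  have hsT : lacunary q s ∈ tate L :=
    lacunary_mem_tate hq (by simpa using hlim.const_mul c⁻¹)
  have hsS : IsSmall (lacunary q s) :=
    ⟨constantCoeff_lacunary hq _, hsT, r, hr, norm_coeff_lacunary_le hsn⟩
  have hsS' := hsS.expand (show q ≠ 0 by omega)
  have hsub : lacunary q (s - shift s) =
      lacunary q s - (lacunary q s).expand q (by omega) := by
    rw [lacunary_sub, expand_lacunary hq]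
  have hsmall : IsSmall (lacunary q (s - shift s)) := by
    rw [hsub]
    refine ⟨by rw [map_sub, hsS.constantCoeff_eq, hsS'.constantCoeff_eq, sub_zero],
      sub_mem hsS.mem_tate hsS'.mem_tate, ?_⟩
    obtain ⟨ρ, -, hρ, h1, h2⟩ := exists_common_bound hsS hsS'
    refine ⟨ρ, hρ, fun k => ?_⟩
    rw [map_sub, sub_eq_add_neg]
    refine (IsUltrametricDist.norm_add_le_max _ _).trans (max_le (h1 k) ?_)
    rw [norm_neg]
    exact h2 k
  have hv : value (lacunary q (s - shift s)) 1 = 0 := by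
    have h1 := map_sub (tateValue (L := L) (x := 1) (by simp)) ⟨_, hsS.mem_tate⟩
      ⟨_, hsS'.mem_tate⟩
    rw [hsub]
    refine Eq.trans h1 ?_
    change value _ 1 - value _ 1 = 0
    rw [value_expand, one_pow, sub_self]
  have h0 : PowerSeries.constantCoeff (PowerSeries.rescale c e) = 0 := by
    rw [← PowerSeries.coeff_zero_eq_constantCoeff_apply, PowerSeries.coeff_rescale,
      PowerSeries.coeff_zero_eq_constantCoeff_apply, he0, mul_zero]
  rw [hcs, lacunary_C_mul, subst_C_mul (constantCoeff_lacunary hq _)]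
  refine ⟨hsmall.subst h0 hE, ?_⟩
  rw [value_subst hsmall hE (by simp), hv]
  have := norm_value_le_norm h0 hE (x := 0) (by simp)
  simpa using this

/-- The relation between the values of the exponentials of the arguments attached to `w`. -/
theorem value_relation {q : ℕ} (hq : 1 < q) {c : L} (hc0 : c ≠ 0) (hc : ‖c‖ < 1)
    {F : FormalGroup L} (hF : ∀ d, ‖MvPowerSeries.coeff d F.toPowerSeries‖ ≤ 1)
    {e : PowerSeries L} (he : IsFormalExp F e)
    (hE : ∀ k, ‖PowerSeries.coeff k (PowerSeries.rescale c e)‖ ≤ 1)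
    {w : ℕ → L} {r : ℝ} (hr : r < 1) {n : ℕ}
    (hw : ∀ i, 1 ≤ i → i ≤ n → ‖w i‖ ≤ r) {a : ℕ → ℕ → L}
    (ha : ∀ m i, a m i = if i < m then w (m - i) / c ^ i else 0)
    (hsmall : ∀ m, m ≤ n → IsSmall (PowerSeries.subst (lacunary q (a m - shift (a m))) e))
    {z : ℕ → L} (hz : ∀ i, i < n → z i ^ q = z i ∧ ‖z i‖ ≤ 1) {G : PowerSeries L}
    (hG : ∀ k, ‖PowerSeries.coeff k G‖ ≤ 1)
    (hGe : PowerSeries.subst e G =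
      PowerSeries.rescale (∑ i ∈ Finset.range n, z i * c ^ i) e)
    {s : ℕ → L} (hs0 : s 0 = 0) (hs : ∀ j, j < n → s (j + 1) =
      ∑' d : Fin 2 →₀ ℕ, MvPowerSeries.coeff d F.toPowerSeries * (s j ^ d 0 *
        value (PowerSeries.subst (lacunary q (a (n - j) - shift (a (n - j)))) e) (z j) ^ d 1)) :
    value G (value (PowerSeries.subst (lacunary q (a n - shift (a n))) e) 1) = s n := by
  have hcpos : 0 < ‖c‖ := norm_pos_iff.2 hc0
  have h1 : ‖(1 : L)‖ ≤ 1 := by simp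
  have he0 := he.constantCoeff_eq
  set A : ℕ → PowerSeries L := fun m => lacunary q (a m - shift (a m)) with hA
  have hA0 : ∀ m, PowerSeries.constantCoeff (A m) = 0 := fun m => constantCoeff_lacunary hq _
  have hCA0 : ∀ x m, PowerSeries.constantCoeff (PowerSeries.C x * A m) = 0 := fun x m => by
    rw [map_mul, hA0, mul_zero]
  have hzero : PowerSeries.subst (0 : PowerSeries L) e = 0 :=
    PowerSeries.subst_zero_of_constantCoeff_zero he0
  have hstep : ∀ j, j < n →
      IsSmall (PowerSeries.subst (PowerSeries.C (z j * c ^ j) * A n) e) ∧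
      value (PowerSeries.subst (PowerSeries.C (z j * c ^ j) * A n) e) 1 =
        value (PowerSeries.subst (A (n - j)) e) (z j) := by
    intro j hj
    obtain ⟨hzq, hzn⟩ := hz j hj
    -- The first j coefficients of z_j c^j A_n, namely z_j c^{j-i} w_{n-i}; each still contains a
    -- factor c. The remaining terms form z_j A_{n-j}(X^{q^j}).
    set t : ℕ → L := fun i => if i < j then z j * (c ^ j * a n i) else 0 with ht
    set N := q ^ j with hN
    have hN0 : N ≠ 0 := (pow_pos (by omega) j).ne'
    have hsplit : PowerSeries.C (z j * c ^ j) * A n =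
        lacunary q (t - shift t) + PowerSeries.C (z j) * (A (n - j)).expand N hN0 := by
      rw [hA]
      simp only
      rw [expand_pow_lacunary hq, ← lacunary_C_mul, ← lacunary_C_mul, ← lacunary_add,
        shiftBy_sub_shift]
      have key : ∀ i, z j * c ^ j * a n i = t i + z j * shiftBy j (a (n - j)) i := by
        intro i
        rw [ht, shiftBy]
        simp only
        by_cases hij : i < j
        · rw [if_pos hij, if_neg (by omega), mul_zero, add_zero, mul_assoc]
        · rw [if_neg hij, if_pos (by omega), zero_add, ha, ha]
          by_cases hin : i < n
          · rw [if_pos hin, if_pos (by omega), show n - j - (i - j) = n - i by omega]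
            have : c ^ i = c ^ j * c ^ (i - j) := by rw [← pow_add]; congr 1; omega
            rw [this]
            have h3 := pow_ne_zero j hc0
            have h4 := pow_ne_zero (i - j) hc0
            field_simp
          · rw [if_neg hin, if_neg (by omega), mul_zero, mul_zero]
      congr 1
      funext i
      rcases i with _ | i
      · simp only [Pi.sub_apply, Pi.add_apply, shift, sub_zero, key]
      · simp only [Pi.sub_apply, Pi.add_apply, shift, mul_sub, key]
        ring
    -- The bound r is not assumed nonnegative, hence the maximum with 0 to cover the vanishing t_i.
    have htn : ∀ i, ‖t i‖ ≤ ‖c‖ * max r 0 := by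
      intro i
      rw [ht]
      simp only
      split_ifs with hij
      · rw [ha, if_pos (by omega), norm_mul]
        have h2 : c ^ j * (w (n - i) / c ^ i) = c ^ (j - i) * w (n - i) := by
          have : c ^ j = c ^ (j - i) * c ^ i := by rw [← pow_add]; congr 1; omega
          rw [this]
          have h3 := pow_ne_zero i hc0
          field_simp
        rw [h2, norm_mul, norm_pow]
        refine (mul_le_of_le_one_left (by positivity) hzn).trans
          (mul_le_mul (pow_le_of_le_one hcpos.le hc.le (by omega))
            ((hw _ (by omega) (Nat.sub_le _ _)).trans (le_max_left _ _)) (norm_nonneg _) hcpos.le)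
      · rw [norm_zero]
        exact mul_nonneg hcpos.le (le_max_right _ _)
    have htlim : Tendsto t cofinite (𝓝 0) := by
      rw [Nat.cofinite_eq_atTop]
      refine tendsto_const_nhds.congr' ?_
      filter_upwards [eventually_ge_atTop j] with i hi
      rw [ht]
      simp only
      rw [if_neg (by omega)]
    obtain ⟨hD, hDv⟩ := value_subst_lacunary hq hc0 he0 hE
      (max_lt hr zero_lt_one) htn htlim
    have hD0 : PowerSeries.constantCoeff (lacunary q (t - shift t)) = 0 :=
      constantCoeff_lacunary hq _
    have hB : PowerSeries.C (z j) * (A (n - j)).expand N hN0 =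
        (PowerSeries.rescale (z j) (A (n - j))).expand N hN0 := by
      rw [hA]
      simp only
      rw [rescale_lacunary hzq, map_mul]
      congr 1
      exact (MvPowerSeries.expand_C N hN0 (z j)).symm
    have hR0 : PowerSeries.constantCoeff (PowerSeries.rescale (z j) (A (n - j))) = 0 := by
      rw [← PowerSeries.coeff_zero_eq_constantCoeff_apply, PowerSeries.coeff_rescale,
        PowerSeries.coeff_zero_eq_constantCoeff_apply, hA0, mul_zero]
    have hBe : PowerSeries.subst (PowerSeries.C (z j) * (A (n - j)).expand N hN0) e =
        (PowerSeries.rescale (z j) (PowerSeries.subst (A (n - j)) e)).expand N hN0 := by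
      rw [hB, rescale_subst (hA0 _)]
      exact (PowerSeries.expand_subst N hN0 (PowerSeries.HasSubst.of_constantCoeff_zero' hR0) e).symm
    have hB0 : PowerSeries.constantCoeff (PowerSeries.C (z j) * (A (n - j)).expand N hN0) = 0 := by
      rw [hB, PowerSeries.constantCoeff_expand, hR0]
    have hBs : IsSmall (PowerSeries.subst (PowerSeries.C (z j) * (A (n - j)).expand N hN0) e) := by
      rw [hBe]
      exact ((hsmall (n - j) (Nat.sub_le _ _)).rescale hzn).expand hN0
    have hBv : value (PowerSeries.subst (PowerSeries.C (z j) * (A (n - j)).expand N hN0) e) 1 =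
        value (PowerSeries.subst (A (n - j)) e) (z j) := by
      rw [hBe, value_expand, one_pow, value_rescale, mul_one]
    rw [hsplit, he.subst_add hD0 hB0]
    refine ⟨hD.pair hBs F hF, ?_⟩
    rw [value_pair hD hBs hF h1, hDv, ← hBv]
    -- The value of F at (0, y) is y: evaluate e(0 + B) = F(e(0), e(B)) at 1.
    have h5 := value_pair isSmall_zero hBs hF h1
    rw [← hzero, ← he.subst_add (map_zero _) hB0, zero_add, hzero,
      show value (0 : PowerSeries L) 1 = 0 from map_zero (tateValue h1)] at h5
    exact h5.symm
  have hmain : ∀ j, j ≤ n →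
      IsSmall (PowerSeries.subst (PowerSeries.C (∑ i ∈ Finset.range j, z i * c ^ i) * A n) e) ∧
      value (PowerSeries.subst (PowerSeries.C (∑ i ∈ Finset.range j, z i * c ^ i) * A n) e) 1 =
        s j := by
    intro j
    induction j with
    | zero =>
      intro _
      rw [Finset.sum_range_zero, map_zero, zero_mul, hzero, hs0]
      exact ⟨isSmall_zero, map_zero (tateValue h1)⟩
    | succ j ih =>
      intro hj
      obtain ⟨h2, h3⟩ := ih (by omega)
      obtain ⟨h4, h5⟩ := hstep j (by omega)
      rw [Finset.sum_range_succ, map_add, add_mul, he.subst_add (hCA0 _ _) (hCA0 _ _)]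
      refine ⟨h2.pair h4 F hF, ?_⟩
      rw [value_pair h2 h4 hF h1, h3, h5, hs j (by omega)]
  -- For u the sum of all digits, e(u A_n) = G(e(A_n)), so its value at 1 is G applied to the value
  -- of e(A_n).
  have hfin := (hmain n le_rfl).2
  rw [subst_C_mul (hA0 n), ← hGe, PowerSeries.subst_comp_subst_apply
    (PowerSeries.HasSubst.of_constantCoeff_zero' he0)
    (PowerSeries.HasSubst.of_constantCoeff_zero' (hA0 n)), value_subst (hsmall n le_rfl) hG h1]
    at hfin
  exact hfin

end Relation

/-! ### The valuation ring of K, its residue field and Teichmüller representatives -/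

section LocalField

open Filter Topology

variable {p : ℕ} [Fact p.Prime] {K : IntermediateField ℚ_[p] (PadicAlgCl p)}

lemma mem_integerRing {x : K} : x ∈ integerRing K ↔ ‖(x : PadicAlgCl p)‖ ≤ 1 := by
  change (PadicAlgCl.valued p).v (x : PadicAlgCl p) ≤ 1 ↔ _
  rw [← NNReal.coe_le_coe]
  rfl

lemma norm_integerRing_le (x : integerRing K) : ‖((x : K) : PadicAlgCl p)‖ ≤ 1 :=
  mem_integerRing.1 x.2

lemma mem_maximalIdeal_integerRing {x : integerRing K} :
    x ∈ IsLocalRing.maximalIdeal (integerRing K) ↔ ‖((x : K) : PadicAlgCl p)‖ < 1 := by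
  rw [IsLocalRing.mem_maximalIdeal, mem_nonunits_iff]
  constructor
  · intro h
    refine lt_of_le_of_ne (norm_integerRing_le x) fun h1 => h ?_
    have hx : (x : K) ≠ 0 := by
      intro h0
      rw [h0] at h1
      simp at h1
    have hinv : (x : K)⁻¹ ∈ integerRing K := by
      rw [mem_integerRing]
      change ‖((x : K) : PadicAlgCl p)⁻¹‖ ≤ 1
      rw [norm_inv, h1, inv_one]
    refine IsUnit.of_mul_eq_one ⟨(x : K)⁻¹, hinv⟩ ?_
    ext1
    exact mul_inv_cancel₀ hx
  · rintro h ⟨u, rfl⟩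
    have h1 : (((u : integerRing K) : K) : PadicAlgCl p) *
        (((u⁻¹ : (integerRing K)ˣ) : integerRing K) : K) = 1 := by
      have := congrArg (fun y : integerRing K => ((y : K) : PadicAlgCl p)) u.mul_inv
      exact this
    have h2 := congrArg norm h1
    rw [norm_mul, norm_one] at h2
    have h3 := norm_integerRing_le ((u⁻¹ : (integerRing K)ˣ) : integerRing K)
    nlinarith [norm_nonneg ((((u⁻¹ : (integerRing K)ˣ) : integerRing K) : K) : PadicAlgCl p),
      norm_nonneg (((u : integerRing K) : K) : PadicAlgCl p)]

lemma norm_integerEmb (x : integerRing K) : ‖integerEmb K x‖ = ‖((x : K) : PadicAlgCl p)‖ :=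
  PadicComplex.norm_extends p ((x : K) : PadicAlgCl p)

lemma norm_integerEmb_le (x : integerRing K) : ‖integerEmb K x‖ ≤ 1 := by
  rw [norm_integerEmb]
  exact norm_integerRing_le x

lemma integerEmb_injective : Function.Injective (integerEmb K) :=
  ((algebraMap (PadicAlgCl p) ℂ_[p]).injective.comp (algebraMap K (PadicAlgCl p)).injective).comp
    Subtype.val_injective

lemma IsUniformiser.norm_lt_one {π : integerRing K} (hπ : IsUniformiser K π) :
    ‖integerEmb K π‖ < 1 := by
  rw [norm_integerEmb, ← mem_maximalIdeal_integerRing, hπ]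
  exact Ideal.mem_span_singleton_self π

/-- If π were 0 the maximal ideal would be zero, yet it contains p, which is nonzero in K. -/
lemma IsUniformiser.ne_zero {π : integerRing K} (hπ : IsUniformiser K π) : π ≠ 0 := by
  rintro rfl
  have hp : ‖((p : K) : PadicAlgCl p)‖ = (p : ℝ)⁻¹ := by
    have h1 : ((p : K) : PadicAlgCl p) = ((p : ℚ_[p]) : PadicAlgCl p) := by
      simp
    rw [h1, PadicAlgCl.norm_extends, Padic.norm_p]
  have hp1 : (p : ℝ)⁻¹ < 1 := inv_lt_one_of_one_lt₀ (by exact_mod_cast (Fact.out : p.Prime).one_lt)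
  have hmem : (⟨(p : K), mem_integerRing.2 (hp.trans_lt hp1).le⟩ : integerRing K) ∈
      IsLocalRing.maximalIdeal (integerRing K) :=
    mem_maximalIdeal_integerRing.2 (hp.trans_lt hp1)
  rw [hπ, Ideal.mem_span_singleton, zero_dvd_iff] at hmem
  have h2 : (p : K) = 0 := congrArg Subtype.val hmem
  exact (Fact.out : p.Prime).ne_zero (by exact_mod_cast h2)

lemma IsUniformiser.residue_eq_zero_iff {π : integerRing K} (hπ : IsUniformiser K π)
    (a : integerRing K) : IsLocalRing.residue (integerRing K) a = 0 ↔ π ∣ a := by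
  rw [IsLocalRing.residue_eq_zero_iff, hπ, Ideal.mem_span_singleton]

lemma IsUniformiser.isUnit_one_sub {π : integerRing K} (hπ : IsUniformiser K π) (j : ℕ) :
    IsUnit (1 - π ^ (j + 1)) := by
  rw [← IsLocalRing.notMem_maximalIdeal]
  intro h
  have h1 : π ^ (j + 1) ∈ IsLocalRing.maximalIdeal (integerRing K) := by
    refine Ideal.pow_mem_of_mem _ ?_ _ (Nat.succ_pos j)
    rw [hπ]
    exact Ideal.mem_span_singleton_self π
  have h2 := Ideal.add_mem _ h h1
  rw [sub_add_cancel] at h2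
  exact (Ideal.ne_top_iff_one _).1 (IsLocalRing.maximalIdeal.isMaximal _).ne_top h2

lemma IsUniformiser.norm_le_of_mem_pow {π : integerRing K} (hπ : IsUniformiser K π)
    {a : integerRing K} {n : ℕ} (ha : a ∈ IsLocalRing.maximalIdeal (integerRing K) ^ n) :
    ‖integerEmb K a‖ ≤ ‖integerEmb K π‖ ^ n := by
  rw [hπ, Ideal.span_singleton_pow, Ideal.mem_span_singleton] at ha
  obtain ⟨b, rfl⟩ := ha
  rw [map_mul, map_pow, norm_mul, norm_pow]
  exact mul_le_of_le_one_right (by positivity) (norm_integerEmb_le b)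

variable [FiniteDimensional ℚ_[p] K]

/-- The closed unit ball of K is compact, K being finite-dimensional over ℚ_p, so finitely many open
balls of radius 1 cover it. Two integers in the same ball differ by an element of the maximal ideal.
-/
instance finite_residueField : Finite (IsLocalRing.ResidueField (integerRing K)) := by
  let S : Submodule ℚ_[p] (PadicAlgCl p) := Subalgebra.toSubmodule K.toSubalgebra
  have hfin : FiniteDimensional ℚ_[p] S := inferInstanceAs (FiniteDimensional ℚ_[p] K)
  have hprop : ProperSpace S := FiniteDimensional.proper ℚ_[p] S
  obtain ⟨t, htf, ht⟩ := Metric.totallyBounded_iff.1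
    (isCompact_closedBall (0 : S) 1).totallyBounded 1 one_pos
  have h1 : ∀ c : IsLocalRing.ResidueField (integerRing K), ∃ y : t, ∃ x : integerRing K,
      IsLocalRing.residue _ x = c ∧ ‖((x : K) : PadicAlgCl p) - ((y : S) : PadicAlgCl p)‖ < 1 := by
    intro c
    obtain ⟨x, rfl⟩ := IsLocalRing.residue_surjective c
    have hx : (⟨((x : K) : PadicAlgCl p), (x : K).2⟩ : S) ∈ Metric.closedBall (0 : S) 1 := by
      rw [mem_closedBall_zero_iff]
      exact norm_integerRing_le x
    have := ht hx
    simp only [Set.mem_iUnion, exists_prop] at this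
    obtain ⟨y, hy, hxy⟩ := this
    rw [Metric.mem_ball, dist_eq_norm] at hxy
    exact ⟨⟨y, hy⟩, x, rfl, hxy⟩
  choose y x hx hxy using h1
  have := htf.to_subtype
  refine Finite.of_injective y fun c c' h => ?_
  rw [← hx c, ← hx c', ← sub_eq_zero, ← map_sub, IsLocalRing.residue_eq_zero_iff,
    mem_maximalIdeal_integerRing]
  have h2 : (((x c - x c' : integerRing K) : K) : PadicAlgCl p) =
      (((x c : K) : PadicAlgCl p) - ((y c : S) : PadicAlgCl p)) -
        (((x c' : K) : PadicAlgCl p) - ((y c : S) : PadicAlgCl p)) := by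
    rw [sub_sub_sub_cancel_right]
    rfl
  rw [h2, sub_eq_add_neg]
  refine (IsUltrametricDist.norm_add_le_max _ _).trans_lt (max_lt (hxy c) ?_)
  rw [norm_neg, h]
  exact hxy c'

lemma one_lt_residueCard : 1 < residueCard K := Finite.one_lt_card

lemma pow_residueCard (c : IsLocalRing.ResidueField (integerRing K)) : c ^ residueCard K = c := by
  have := Fintype.ofFinite (IsLocalRing.ResidueField (integerRing K))
  rw [residueCard, Nat.card_eq_fintype_card, FiniteField.pow_card]

lemma cast_residueCard : (residueCard K : IsLocalRing.ResidueField (integerRing K)) = 0 := by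
  have := Fintype.ofFinite (IsLocalRing.ResidueField (integerRing K))
  rw [residueCard, Nat.card_eq_fintype_card, FiniteField.cast_card_eq_zero]

variable (K) in
lemma exists_residueCard_eq : ∃ ℓ f : ℕ, ExpChar (IsLocalRing.ResidueField (integerRing K)) ℓ ∧
    residueCard K = ℓ ^ f := by
  have := Fintype.ofFinite (IsLocalRing.ResidueField (integerRing K))
  obtain ⟨ℓ, hℓ⟩ := CharP.exists (IsLocalRing.ResidueField (integerRing K))
  obtain ⟨f, hp, hf⟩ := FiniteField.card (IsLocalRing.ResidueField (integerRing K)) ℓ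
  have : Fact ℓ.Prime := ⟨hp⟩
  exact ⟨ℓ, f, inferInstance, by rw [residueCard, Nat.card_eq_fintype_card, hf]⟩

/-- Factor x^q − y^q as (x − y) ∑ x^i y^{q-1-i}. Since x ≡ y, the sum is congruent to q y^{q-1},
which is 0 in the residue field. -/
lemma IsUniformiser.dvd_pow_sub_pow {π : integerRing K} (hπ : IsUniformiser K π)
    {x y : integerRing K} {k : ℕ} (h : π ^ (k + 1) ∣ x - y) :
    π ^ (k + 2) ∣ x ^ residueCard K - y ^ residueCard K := by
  have h1 : IsLocalRing.residue (integerRing K) x = IsLocalRing.residue (integerRing K) y := by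
    rw [← sub_eq_zero, ← map_sub, hπ.residue_eq_zero_iff]
    exact (dvd_pow_self π (Nat.succ_ne_zero k)).trans h
  have h2 : π ∣ ∑ i ∈ Finset.range (residueCard K), x ^ i * y ^ (residueCard K - 1 - i) := by
    rw [← hπ.residue_eq_zero_iff, map_sum]
    simp only [map_mul, map_pow, h1]
    rw [Finset.sum_congr rfl (g := fun _ => IsLocalRing.residue (integerRing K) y ^
      (residueCard K - 1)), Finset.sum_const, Finset.card_range, nsmul_eq_mul, cast_residueCard,
      zero_mul]
    intro i hi
    rw [← pow_add]
    congr 1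
    have := Finset.mem_range.1 hi
    omega
  rw [← (Commute.all x y).mul_geom_sum₂, pow_succ]
  exact mul_dvd_mul h h2

/-- Teichmüller representatives. -/
lemma IsUniformiser.exists_teichmuller {π : integerRing K} (hπ : IsUniformiser K π)
    (c : IsLocalRing.ResidueField (integerRing K)) :
    ∃ t : integerRing K, t ^ residueCard K = t ∧ IsLocalRing.residue _ t = c := by
  set q := residueCard K with hq
  obtain ⟨x, rfl⟩ := IsLocalRing.residue_surjective c
  let f : integerRing K → PadicAlgCl p := fun y => ((y : K) : PadicAlgCl p)
  -- The representative is the limit of x^{q^k}. The limit exists because consecutive terms agree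
  -- modulo π^{k+1}, and it remains in K because K is complete.
  let s : ℕ → PadicAlgCl p := fun k => f (x ^ q ^ k)
  have hdvd : ∀ k, π ^ (k + 1) ∣ x ^ q ^ (k + 1) - x ^ q ^ k := by
    intro k
    induction k with
    | zero =>
      rw [zero_add, pow_one, pow_one, pow_zero, pow_one, ← hπ.residue_eq_zero_iff, map_sub, map_pow,
        pow_residueCard, sub_self]
    | succ k ih =>
      have := hπ.dvd_pow_sub_pow ih
      rwa [← pow_mul, ← pow_mul, ← hq, ← pow_succ, ← pow_succ] at this
  have hπ1 : ‖f π‖ < 1 := by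
    have := hπ.norm_lt_one
    rwa [norm_integerEmb] at this
  have hstep : ∀ k, dist (s k) (s (k + 1)) ≤ ‖f π‖ * ‖f π‖ ^ k := by
    intro k
    obtain ⟨b, hb⟩ := hdvd k
    have h1 : s (k + 1) - s k = f π ^ (k + 1) * f b :=
      congrArg f hb
    rw [dist_comm, dist_eq_norm, h1, norm_mul, norm_pow, pow_succ']
    exact mul_le_of_le_one_right (by positivity) (norm_integerRing_le b)
  have hcauchy : CauchySeq s := cauchySeq_of_le_geometric _ _ hπ1 hstep
  have hcomplete : IsComplete (K : Set (PadicAlgCl p)) := by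
    let S : Submodule ℚ_[p] (PadicAlgCl p) := Subalgebra.toSubmodule K.toSubalgebra
    have hfin : FiniteDimensional ℚ_[p] S := inferInstanceAs (FiniteDimensional ℚ_[p] K)
    exact Submodule.complete_of_finiteDimensional S
  obtain ⟨t, htK, ht⟩ := cauchySeq_tendsto_of_isComplete hcomplete
    (fun k => ((x ^ q ^ k : integerRing K) : K).2) hcauchy
  have htq : t ^ q = t := by
    have h1 : Tendsto (fun k => s k ^ q) atTop (𝓝 (t ^ q)) := ht.pow q
    have h2 : (fun k => s k ^ q) = fun k => s (k + 1) := by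
      funext k
      change f (x ^ q ^ k) ^ q = f (x ^ q ^ (k + 1))
      rw [pow_succ, pow_mul]
      rfl
    rw [h2] at h1
    exact tendsto_nhds_unique h1 ((tendsto_add_atTop_iff_nat 1).2 ht)
  have hst : ∀ k, ‖s k - s 0‖ ≤ ‖f π‖ := by
    intro k
    induction k with
    | zero => rw [sub_self, norm_zero]; exact norm_nonneg _
    | succ k ih =>
      rw [← sub_add_sub_cancel _ (s k)]
      refine (IsUltrametricDist.norm_add_le_max _ _).trans (max_le ?_ ih)
      rw [← dist_eq_norm, dist_comm]
      exact (hstep k).trans (mul_le_of_le_one_right (norm_nonneg _)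
        (pow_le_one₀ (norm_nonneg _) hπ1.le))
  have htx : ‖t - f x‖ < 1 := by
    have h1 : Tendsto (fun k => ‖s k - s 0‖) atTop (𝓝 ‖t - s 0‖) := (ht.sub_const _).norm
    have h2 := le_of_tendsto' h1 hst
    have h3 : s 0 = f x := by
      change f (x ^ q ^ 0) = f x
      rw [pow_zero, pow_one]
    rw [h3] at h2
    exact h2.trans_lt hπ1
  have htn : ‖t‖ ≤ 1 := by
    rw [← sub_add_cancel t (f x)]
    exact (IsUltrametricDist.norm_add_le_max _ _).trans (max_le htx.le (norm_integerRing_le x))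
  refine ⟨⟨⟨t, htK⟩, mem_integerRing.2 htn⟩, ?_, ?_⟩
  · apply Subtype.ext
    apply Subtype.ext
    exact htq
  · rw [← sub_eq_zero, ← map_sub, IsLocalRing.residue_eq_zero_iff, mem_maximalIdeal_integerRing]
    exact htx

/-- The roots of `X ^ q - X` lie in the valuation ring of `K`. -/
lemma IsUniformiser.exists_eq_of_pow_eq {π : integerRing K} (hπ : IsUniformiser K π)
    {z : PadicAlgCl p} (hz : z ^ residueCard K = z) :
    ∃ t : integerRing K, ((t : K) : PadicAlgCl p) = z := by
  classical
  set q := residueCard K with hq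
  have hq1 : 1 < q := one_lt_residueCard
  choose τ hτ hτr using hπ.exists_teichmuller
  let g : IsLocalRing.ResidueField (integerRing K) → PadicAlgCl p :=
    fun c => ((τ c : K) : PadicAlgCl p)
  have hg : Function.Injective g := by
    intro c c' h
    have h1 : τ c = τ c' := Subtype.ext (Subtype.ext h)
    rw [← hτr c, ← hτr c', h1]
  have := Fintype.ofFinite (IsLocalRing.ResidueField (integerRing K))
  set f : Polynomial (PadicAlgCl p) := Polynomial.X ^ q - Polynomial.X with hf
  have hf0 : f ≠ 0 := FiniteField.X_pow_card_sub_X_ne_zero _ hq1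
  have hdeg : f.natDegree = q := FiniteField.X_pow_card_sub_X_natDegree_eq _ hq1
  have hroot : ∀ y, y ∈ f.roots.toFinset ↔ y ^ q = y := by
    intro y
    rw [Multiset.mem_toFinset, Polynomial.mem_roots hf0, Polynomial.IsRoot.def]
    simp [hf, sub_eq_zero]
  -- The Teichmüller representatives are q distinct roots of X^q − X, which has degree q, so they
  -- exhaust its roots.
  have hsub : Finset.univ.image g ⊆ f.roots.toFinset := by
    intro y hy
    obtain ⟨c, -, rfl⟩ := Finset.mem_image.1 hy
    rw [hroot]
    exact congrArg (fun t : integerRing K => ((t : K) : PadicAlgCl p)) (hτ c)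
  have hcard : f.roots.toFinset.card ≤ (Finset.univ.image g).card := by
    rw [Finset.card_image_of_injective _ hg, Finset.card_univ, ← Nat.card_eq_fintype_card]
    exact (Multiset.toFinset_card_le _).trans ((Polynomial.card_roots' f).trans hdeg.le)
  have hmem : z ∈ Finset.univ.image g := by
    rw [Finset.eq_of_subset_of_card_le hsub hcard, hroot]
    exact hz
  obtain ⟨c, -, hc⟩ := Finset.mem_image.1 hmem
  exact ⟨τ c, hc⟩

end LocalField

/-! ### Application to Lubin-Tate series over the valuation ring -/

section LubinTate

lemma IsLubinTateSeries.constantCoeff_eq {R : Type*} [CommRing R] {π : R} {q : ℕ}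
    {P : PowerSeries R} (hP : IsLubinTateSeries π q P) : PowerSeries.constantCoeff P = 0 := by
  have := PowerSeries.X_pow_dvd_iff.1 hP.linear 0 (by omega)
  simpa using this

lemma IsLubinTateSeries.coeff_one_eq {R : Type*} [CommRing R] {π : R} {q : ℕ}
    {P : PowerSeries R} (hP : IsLubinTateSeries π q P) : PowerSeries.coeff 1 P = π := by
  have := PowerSeries.X_pow_dvd_iff.1 hP.linear 1 (by omega)
  rw [map_sub, PowerSeries.coeff_C_mul, PowerSeries.coeff_one_X, mul_one, sub_eq_zero] at this
  exact this

lemma IsLubinTateSeries.map_eq {R k : Type*} [CommRing R] [CommRing k] {π : R} {q : ℕ}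
    {P : PowerSeries R} (hP : IsLubinTateSeries π q P) {ρ : R →+* k} (hρ : ρ π = 0) :
    P.map ρ = PowerSeries.X ^ q := by
  obtain ⟨g, hg⟩ := hP.frobenius
  rw [sub_eq_iff_eq_add.1 hg, map_add, map_mul, PowerSeries.map_C, hρ, map_zero, zero_mul, zero_add,
    map_pow, PowerSeries.map_X]

lemma sum_C_mul_X_pow_eq_lacunary {S : Type*} [CommRing S] {q : ℕ} (hq : 1 < q) (x : ℕ → S)
    (m : ℕ) : ∑ i ∈ Finset.range m, PowerSeries.C (x i) * PowerSeries.X ^ q ^ i =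
      lacunary q fun i => if i < m then x i else 0 := by
  refine lacunary_ext hq (fun j => ?_) fun k hk => ?_
  · rw [map_sum]
    simp only [PowerSeries.coeff_C_mul, PowerSeries.coeff_X_pow, (Nat.pow_right_injective hq).eq_iff,
      mul_ite, mul_one, mul_zero, Finset.sum_ite_eq, Finset.mem_range]
  · rw [map_sum]
    refine Finset.sum_eq_zero fun i _ => ?_
    rw [PowerSeries.coeff_C_mul, PowerSeries.coeff_X_pow, if_neg (hk i), mul_zero]

lemma sum_eq_lacunary {S : Type*} [CommRing S] {q : ℕ} (hq : 1 < q) (x : ℕ → S) (m : ℕ) :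
    ∑ i ∈ Finset.range m, PowerSeries.C (x i) *
      (PowerSeries.X ^ q ^ i - PowerSeries.X ^ q ^ (i + 1)) =
      lacunary q ((fun i => if i < m then x i else 0) - shift fun i => if i < m then x i else 0) := by
  rw [lacunary_sub, ← expand_lacunary hq, ← sum_C_mul_X_pow_eq_lacunary hq, map_sum,
    ← Finset.sum_sub_distrib]
  refine Finset.sum_congr rfl fun i _ => ?_
  rw [mul_sub, map_mul, map_pow, PowerSeries.expand_X, PowerSeries.expand_C, ← pow_mul,
    ← pow_succ']

lemma pow_ne_self {L : Type*} [Field L] {c : L} (hc0 : c ≠ 0) (h : ∀ j, c ^ (j + 1) ≠ 1) (j : ℕ)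
    (hj : 2 ≤ j) : c ^ j ≠ c := by
  intro hcj
  refine h (j - 2) (mul_right_cancel₀ hc0 ?_)
  rw [← pow_succ, one_mul, show j - 2 + 1 + 1 = j by omega, hcj]

variable {p : ℕ} [Fact p.Prime] {K : IntermediateField ℚ_[p] (PadicAlgCl p)}

/-- The inclusion of `K` in `ℂ_p`. -/
def fieldEmb (K : IntermediateField ℚ_[p] (PadicAlgCl p)) : K →+* ℂ_[p] :=
  (algebraMap (PadicAlgCl p) ℂ_[p]).comp (algebraMap K (PadicAlgCl p))

/-- The exponential of the Lubin-Tate group, with its coefficients read in `ℂ_p`. -/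
def lubinTateExpC (P : PowerSeries (integerRing K)) : PowerSeries ℂ_[p] :=
  (lubinTateExp P).map (fieldEmb K)

lemma IsUniformiser.map_pow_ne_one {π : integerRing K} (hπ : IsUniformiser K π) {L : Type*}
    [Field L] {ι : integerRing K →+* L} (hι : Function.Injective ι) (j : ℕ) :
    ι π ^ (j + 1) ≠ 1 := by
  intro h
  have h1 : π ^ (j + 1) = 1 := hι (by rw [map_pow, h, map_one])
  have h2 := hπ.isUnit_one_sub j
  rw [h1, sub_self] at h2
  exact not_isUnit_zero h2

lemma IsUniformiser.map_pow_ne_self {π : integerRing K} (hπ : IsUniformiser K π) {L : Type*}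
    [Field L] {ι : integerRing K →+* L} (hι : Function.Injective ι) :
    ∀ j, 2 ≤ j → ι π ^ j ≠ ι π :=
  pow_ne_self (fun h0 => hπ.ne_zero (hι (by rw [h0, map_zero]))) (hπ.map_pow_ne_one hι)

variable {π : integerRing K} {P : PowerSeries (integerRing K)}

lemma norm_coeff_map_integerEmb_le (f : PowerSeries (integerRing K)) (k : ℕ) :
    ‖PowerSeries.coeff k (f.map (integerEmb K))‖ ≤ 1 := by
  rw [PowerSeries.coeff_map]
  exact norm_integerEmb_le _

lemma norm_coeff_lubinTateGroup_le (d : Fin 2 →₀ ℕ) : ‖MvPowerSeries.coeff d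
    ((lubinTateGroup P).map (integerEmb K)).toPowerSeries‖ ≤ 1 :=
  norm_integerEmb_le (MvPowerSeries.coeff d (lubinTateGroup P).toPowerSeries)


lemma exists_isExpLog_map (hπ : IsUniformiser K π) {q : ℕ} (hP : IsLubinTateSeries π q P)
    {L : Type*} [Field L] {ι : integerRing K →+* L} (hι : Function.Injective ι) :
    ∃ e l : PowerSeries L, IsExpLog (ι π) (P.map ι) e l :=
  exists_isExpLog (hπ.map_pow_ne_self hι) (constantCoeff_map' ι hP.constantCoeff_eq)
    (by rw [PowerSeries.coeff_map, hP.coeff_one_eq])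

variable [FiniteDimensional ℚ_[p] K]

/-- The Lubin-Tate group does admit `P` as an endomorphism. -/
theorem hasEndomorphism_lubinTateGroup (hπ : IsUniformiser K π)
    (hP : IsLubinTateSeries π (residueCard K) P) : HasEndomorphism (lubinTateGroup P) P := by
  obtain ⟨e, l, h⟩ := exists_isExpLog_map hπ hP integerEmb_injective
  obtain ⟨ℓ, f, _, hq⟩ := exists_residueCard_eq K
  have hex : ∃ F : FormalGroup (integerRing K), HasEndomorphism F P :=
    exists_hasEndomorphism integerEmb_injective hπ.ne_zero hπ.residue_eq_zero_iff hπ.isUnit_one_sub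
      (p := ℓ) (f := f) (fun c => by rw [← hq, pow_residueCard]) hP.constantCoeff_eq hP.coeff_one_eq
      (by rw [← hq]; exact hP.map_eq ((hπ.residue_eq_zero_iff π).2 dvd_rfl)) h
  rw [lubinTateGroup, dif_pos hex]
  exact hex.choose_spec

theorem isMulSeries_mulSeries (hπ : IsUniformiser K π)
    (hP : IsLubinTateSeries π (residueCard K) P) (u : integerRing K) :
    IsMulSeries P u (mulSeries P u) := by
  obtain ⟨e, l, h⟩ := exists_isExpLog_map hπ hP integerEmb_injective
  obtain ⟨ℓ, f, _, hq⟩ := exists_residueCard_eq K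
  exact Classical.epsilon_spec (exists_isMulSeries integerEmb_injective hπ.ne_zero
    hπ.residue_eq_zero_iff hπ.isUnit_one_sub
    (p := ℓ) (f := f) (fun c => by rw [← hq, pow_residueCard]) hP.constantCoeff_eq hP.coeff_one_eq
    (by rw [← hq]; exact hP.map_eq ((hπ.residue_eq_zero_iff π).2 dvd_rfl)) h u)

theorem isFormalExp_of_isExpLog (hπ : IsUniformiser K π)
    (hP : IsLubinTateSeries π (residueCard K) P) {L : Type*} [Field L] {ι : integerRing K →+* L}
    (hι : Function.Injective ι) {e l : PowerSeries L} (h : IsExpLog (ι π) (P.map ι) e l) :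
    IsFormalExp ((lubinTateGroup P).map ι) e :=
  h.isFormalExp (hπ.map_pow_ne_self hι) (constantCoeff_map' ι hP.constantCoeff_eq)
    (by rw [PowerSeries.coeff_map, hP.coeff_one_eq])
    ((hasEndomorphism_lubinTateGroup hπ hP).map_subst hP.constantCoeff_eq ι)

/-- The exponential is chosen over K, so existence must be established there; the characterization
is then transported to ℂ_p. -/
theorem isFormalExp_lubinTateExpC (hπ : IsUniformiser K π)
    (hP : IsLubinTateSeries π (residueCard K) P) :
    IsFormalExp ((lubinTateGroup P).map (integerEmb K)) (lubinTateExpC P) := by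
  have hinj : Function.Injective (integerRing K).subtype := Subtype.val_injective
  obtain ⟨e, l, h⟩ := exists_isExpLog_map hπ hP hinj
  have h1 : IsFormalExp ((lubinTateGroup P).map (integerRing K).subtype) (lubinTateExp P) :=
    Classical.epsilon_spec ⟨e, isFormalExp_of_isExpLog hπ hP hinj h⟩
  exact h1.map (fieldEmb K)

/-- The chosen exponential is specified only through the group law. Uniqueness identifies it with
the series conjugating P to multiplication by π. -/
theorem exists_isExpLog_lubinTateExpC (hπ : IsUniformiser K π)
    (hP : IsLubinTateSeries π (residueCard K) P) :
    ∃ l, IsExpLog (integerEmb K π) (P.map (integerEmb K)) (lubinTateExpC P) l := by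
  obtain ⟨e, l, h⟩ := exists_isExpLog_map hπ hP integerEmb_injective
  have : lubinTateExpC P = e := (isFormalExp_lubinTateExpC hπ hP).unique
    (isFormalExp_of_isExpLog hπ hP integerEmb_injective h)
  rw [this]
  exact ⟨l, h⟩

/-- The argument of the exponential, with its coefficients read in `ℂ_p`. -/
def argumentCoeff (c : ℂ_[p]) (w : ℕ → ℂ_[p]) (m i : ℕ) : ℂ_[p] :=
  if i < m then w (m - i) / c ^ i else 0

lemma expSeriesC_eq (ω : ℕ → PadicAlgCl p) (m : ℕ) : expSeriesC π P ω m =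
    PowerSeries.subst (lacunary (residueCard K)
      (argumentCoeff (integerEmb K π) (fun i => (ω i : ℂ_[p])) m -
        shift (argumentCoeff (integerEmb K π) (fun i => (ω i : ℂ_[p])) m))) (lubinTateExpC P) := by
  have hq : 1 < residueCard K := one_lt_residueCard
  rw [expSeriesC, expSeries, expArgument, sum_eq_lacunary hq,
    map_powerSubst _ (constantCoeff_lacunary hq _), map_lacunary]
  have hE : ((lubinTateExp P).map (algebraMap K (PadicAlgCl p))).map
      (algebraMap (PadicAlgCl p) ℂ_[p]) = lubinTateExpC P := by
    ext k
    rw [PowerSeries.coeff_map, PowerSeries.coeff_map, lubinTateExpC, PowerSeries.coeff_map]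
    rfl
  rw [hE]
  congr 2
  funext i
  have h1 : ∀ i, algebraMap (PadicAlgCl p) ℂ_[p]
      (if i < m then ω (m - i) / ((π : K) : PadicAlgCl p) ^ i else 0) =
      argumentCoeff (integerEmb K π) (fun i => (ω i : ℂ_[p])) m i := by
    intro i
    rw [argumentCoeff]
    split_ifs
    · rw [map_div₀, map_pow]
      rfl
    · exact map_zero _
  rw [Pi.sub_apply, map_sub, h1]
  rcases i with _ | i
  · rw [Pi.sub_apply]
    congr 1
  · rw [Pi.sub_apply]
    congr 1
    exact h1 i

lemma norm_coeff_rescale_le (hπ : IsUniformiser K π)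
    (hP : IsLubinTateSeries π (residueCard K) P) (k : ℕ) :
    ‖PowerSeries.coeff k (PowerSeries.rescale (integerEmb K π) (lubinTateExpC P))‖ ≤ 1 := by
  obtain ⟨l, h⟩ := exists_isExpLog_lubinTateExpC hπ hP
  obtain ⟨ε, -, hε⟩ := h.exists_rescale_eq integerEmb_injective hπ.ne_zero hπ.isUnit_one_sub
    hP.linear
  rw [hε, PowerSeries.coeff_C_mul, norm_mul]
  exact mul_le_one₀ (norm_integerEmb_le π) (norm_nonneg _) (norm_coeff_map_integerEmb_le ε k)

lemma norm_coeff_genericArgument_le (hπ : IsUniformiser K π)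
    (hP : IsLubinTateSeries π (residueCard K) P) {Q : PowerSeries (integerRing K)}
    (hQ0 : PowerSeries.constantCoeff Q = 0)
    (hQk : Q.map (IsLocalRing.residue (integerRing K)) = PowerSeries.X ^ residueCard K)
    (a k : ℕ) : ‖PowerSeries.coeff a (PowerSeries.coeff k (PowerSeries.subst
      (genericArgument (residueCard K) (integerEmb K π) (Q.map (integerEmb K)))
      ((lubinTateExpC P).map PowerSeries.C)))‖ ≤ 1 := by
  obtain ⟨l, h⟩ := exists_isExpLog_lubinTateExpC hπ hP
  obtain ⟨ℓ, f, _, hq⟩ := exists_residueCard_eq K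
  have hq1 : 1 < residueCard K := one_lt_residueCard
  obtain ⟨Y, hY⟩ := exists_map_eq_subst_genericArgument integerEmb_injective hπ.ne_zero
    hπ.residue_eq_zero_iff hπ.isUnit_one_sub (p := ℓ) (f := f) (by rwa [← hq])
    (fun c => by rw [← hq, pow_residueCard]) (P := P) (Q := Q) (by rwa [← hq]) hP.coeff_one_eq
    (by rw [← hq]; exact hP.map_eq ((hπ.residue_eq_zero_iff π).2 dvd_rfl)) hQ0 (by rwa [← hq])
    (lubinTateGroup P) h (isFormalExp_lubinTateExpC hπ hP)
  rw [hq, ← hY, PowerSeries.coeff_map]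
  exact norm_coeff_map_integerEmb_le _ _

variable {π' : integerRing K} {Q : PowerSeries (integerRing K)}

/-- The series `exp (∑ ω_{m-i} (X ^ (q ^ i) - X ^ (q ^ (i + 1))) / π ^ i)` is integral,
convergent on the closed unit disc, and takes values of positive valuation. -/
theorem isSmall_expSeriesC (hπ : IsUniformiser K π)
    (hπ' : IsUniformiser K π') (hP : IsLubinTateSeries π (residueCard K) P)
    (hQ : IsLubinTateSeries π' (residueCard K) Q) {ω : ℕ → PadicAlgCl p}
    (hω : IsCoherentRoots Q ω) {n : ℕ}
    (hcong : π - π' ∈ IsLocalRing.maximalIdeal (integerRing K) ^ (n + 1)) {m : ℕ} (hm : m ≤ n) :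
    IsSmall (expSeriesC π P ω m) := by
  have hq : 1 < residueCard K := one_lt_residueCard
  set ι := integerEmb K with hι
  have hc0 : ι π ≠ 0 := fun h0 => hπ.ne_zero (integerEmb_injective (by rw [← hι, h0, map_zero]))
  -- Q' has linear coefficient π instead of π' and is still congruent to X^q modulo π; it differs
  -- from Q by a term divisible by π^{n+1}.
  set Q' : PowerSeries (integerRing K) := Q + PowerSeries.C (π - π') * PowerSeries.X with hQ'
  have hQ0' : PowerSeries.constantCoeff Q' = 0 := by
    rw [hQ', map_add, hQ.constantCoeff_eq]
    simp
  have hQ1' : PowerSeries.coeff 1 Q' = π := by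
    rw [hQ', map_add, hQ.coeff_one_eq, PowerSeries.coeff_C_mul, PowerSeries.coeff_one_X]
    ring
  have hρ : IsLocalRing.residue (integerRing K) (π - π') = 0 := by
    rw [IsLocalRing.residue_eq_zero_iff]
    exact Ideal.pow_le_self (Nat.succ_ne_zero n) hcong
  have hQk' : Q'.map (IsLocalRing.residue (integerRing K)) = PowerSeries.X ^ residueCard K := by
    rw [hQ', map_add, map_mul, PowerSeries.map_C, hρ, map_zero, zero_mul, add_zero]
    exact hQ.map_eq ((hπ'.residue_eq_zero_iff π').2 dvd_rfl)
  -- The chain ω_m, ..., ω_1, 0, 0, ... of successive images under Q; Q(ω_1) = 0 gives the step into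
  -- the zeros.
  set w : ℕ → ℂ_[p] := fun j => if j < m then (ω (m - j) : ℂ_[p]) else 0 with hw
  have hwsmall : ‖w 0‖ < 1 := by
    rw [hw]
    simp only
    split_ifs with h0
    · rw [PadicComplex.norm_extends]
      exact hω.norm_lt_one _ (by omega)
    · simp
  have hw1 : ∀ j, j < m → w (j + 1) = value (Q.map ι) (w j) := by
    intro j hj
    rw [hw]
    simp only
    rw [if_pos hj]
    split_ifs with h1
    · have := hω.step (m - (j + 1)) (by omega)
      rw [show m - (j + 1) + 1 = m - j by omega] at this
      exact this.symm
    · have := hω.root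
      rw [show m - j = 1 by omega]
      exact this.symm
  have hw2 : ∀ j, m ≤ j → w j = 0 := fun j hj => if_neg (by omega)
  have hmain := isSmall_subst_chain hq hc0 hπ.norm_lt_one norm_coeff_lubinTateGroup_le
    (isFormalExp_lubinTateExpC hπ hP) (norm_coeff_rescale_le hπ hP)
    (constantCoeff_map' ι hQ.constantCoeff_eq) (norm_coeff_map_integerEmb_le Q)
    (constantCoeff_map' ι hQ0') (by rw [PowerSeries.coeff_map, hQ1'])
    (norm_coeff_map_integerEmb_le Q') (δ := ι (π - π'))
    (by rw [hQ', map_add, map_mul, PowerSeries.map_C, PowerSeries.map_X]) hm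
    (hπ.norm_le_of_mem_pow hcong) (norm_coeff_genericArgument_le hπ hP hQ0' hQk') hwsmall hw1 hw2
  have ha : argumentCoeff (ι π) (fun i => (ω i : ℂ_[p])) m = fun i => w i / ι π ^ i := by
    funext i
    rw [argumentCoeff, hw]
    simp only
    split_ifs
    · rfl
    · rw [zero_div]
  rw [expSeriesC_eq, ← hι, ha]
  exact hmain

lemma exists_norm_le_of_norm_lt_one {E : Type*} [SeminormedAddCommGroup E] (w : ℕ → E)
    (hw : ∀ i, 1 ≤ i → ‖w i‖ < 1) (n : ℕ) : ∃ r : ℝ, r < 1 ∧ ∀ i, 1 ≤ i → i ≤ n → ‖w i‖ ≤ r := by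
  induction n with
  | zero => exact ⟨0, zero_lt_one, fun i h1 h2 => by omega⟩
  | succ n ih =>
    obtain ⟨r, hr, h⟩ := ih
    refine ⟨max r ‖w (n + 1)‖, max_lt hr (hw _ (by omega)), fun i h1 h2 => ?_⟩
    rcases Nat.lt_or_ge n i with h3 | h3
    · rw [show i = n + 1 by omega]
      exact le_max_right _ _
    · exact (h i h1 h3).trans (le_max_left _ _)

end LubinTate

end LubinTateExp

end

/-! ### The main theorem -/

theorem proposition3 (p : ℕ) [Fact p.Prime]
    (K : IntermediateField ℚ_[p] (PadicAlgCl p)) [FiniteDimensional ℚ_[p] K]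
    (π π' : LubinTateExp.integerRing K)
    (hπ : LubinTateExp.IsUniformiser K π) (hπ' : LubinTateExp.IsUniformiser K π')
    (P Q : PowerSeries (LubinTateExp.integerRing K))
    (hP : LubinTateExp.IsLubinTateSeries π (LubinTateExp.residueCard K) P)
    (hQ : LubinTateExp.IsLubinTateSeries π' (LubinTateExp.residueCard K) Q)
    (ω : ℕ → PadicAlgCl p) (hω : LubinTateExp.IsCoherentRoots Q ω)
    (n : ℕ) (hn : 1 ≤ n)
    (hcong : π - π' ∈ IsLocalRing.maximalIdeal (LubinTateExp.integerRing K) ^ (n + 1))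
    (z : ℕ → PadicAlgCl p)
    (hz : ∀ i, i < n → z i = 0 ∨ z i ^ (LubinTateExp.residueCard K - 1) = 1)
    (hz0 : z 0 ≠ 0) :
    -- the series converge at the points in question, with values of positive valuation
    (LubinTateExp.ConvergesAt (LubinTateExp.expSeriesC π P ω n) 1 ∧
      ‖LubinTateExp.eval (LubinTateExp.expSeriesC π P ω n) 1‖ < 1) ∧
    (∀ i, i < n →
      LubinTateExp.ConvergesAt (LubinTateExp.expSeriesC π P ω (n - i)) (z i : ℂ_[p]) ∧
      ‖LubinTateExp.eval (LubinTateExp.expSeriesC π P ω (n - i)) (z i : ℂ_[p])‖ < 1) ∧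
    -- the sum of the `z i * π ^ i` is an element `u` of the valuation ring, and `[u]_P` acts so
    ∃ u : LubinTateExp.integerRing K,
      ((u : K) : PadicAlgCl p) = ∑ i ∈ Finset.range n, z i * ((π : K) : PadicAlgCl p) ^ i ∧
      LubinTateExp.eval ((LubinTateExp.mulSeries P u).map (LubinTateExp.integerEmb K))
          (LubinTateExp.eval (LubinTateExp.expSeriesC π P ω n) 1) =
        LubinTateExp.formalSum (LubinTateExp.groupSeries P)
          (fun i => LubinTateExp.eval (LubinTateExp.expSeriesC π P ω (n - i)) (z i : ℂ_[p])) n := by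
  have hq : 1 < LubinTateExp.residueCard K := LubinTateExp.one_lt_residueCard
  have hzq : ∀ i, i < n → z i ^ LubinTateExp.residueCard K = z i := by
    intro i hi
    rcases hz i hi with h | h
    · rw [h, zero_pow (by omega)]
    · rw [← Nat.sub_add_cancel hq.le, pow_succ, h, one_mul]
  -- Every digit is a root of X^q − X, hence lies in the valuation ring of K.
  have ht : ∀ i, ∃ t : LubinTateExp.integerRing K, i < n → ((t : K) : PadicAlgCl p) = z i := by
    intro i
    by_cases hi : i < n
    · obtain ⟨t, ht⟩ := hπ.exists_eq_of_pow_eq (hzq i hi)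
      exact ⟨t, fun _ => ht⟩
    · exact ⟨0, fun h => absurd h hi⟩
  choose t ht using ht
  have hzn : ∀ i, i < n → ‖(z i : ℂ_[p])‖ ≤ 1 := by
    intro i hi
    rw [PadicComplex.norm_extends, ← ht i hi]
    exact LubinTateExp.norm_integerRing_le (t i)
  have hsmall : ∀ m, m ≤ n → LubinTateExp.IsSmall (LubinTateExp.expSeriesC π P ω m) :=
    fun m hm => LubinTateExp.isSmall_expSeriesC hπ hπ' hP hQ hω hcong hm
  have hone : ‖(1 : ℂ_[p])‖ ≤ 1 := norm_one.le
  refine ⟨⟨LubinTateExp.summable_of_mem_tate (hsmall n le_rfl).mem_tate hone,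
    (hsmall n le_rfl).norm_value_lt hone⟩, fun i hi =>
    ⟨LubinTateExp.summable_of_mem_tate (hsmall _ (Nat.sub_le n i)).mem_tate (hzn i hi),
      (hsmall _ (Nat.sub_le n i)).norm_value_lt (hzn i hi)⟩,
    ∑ i ∈ Finset.range n, t i * π ^ i, ?_, ?_⟩
  · have h1 : ((algebraMap K (PadicAlgCl p)).comp (LubinTateExp.integerRing K).subtype)
        (∑ i ∈ Finset.range n, t i * π ^ i) =
          ∑ i ∈ Finset.range n, z i * ((π : K) : PadicAlgCl p) ^ i := by
      rw [map_sum]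
      refine Finset.sum_congr rfl fun i hi => ?_
      rw [map_mul, map_pow, ← ht i (Finset.mem_range.1 hi)]
      rfl
    exact h1
  · obtain ⟨l, hl⟩ := LubinTateExp.exists_isExpLog_lubinTateExpC hπ hP
    have hu : LubinTateExp.integerEmb K (∑ i ∈ Finset.range n, t i * π ^ i) =
        ∑ i ∈ Finset.range n, (z i : ℂ_[p]) * LubinTateExp.integerEmb K π ^ i := by
      rw [map_sum]
      refine Finset.sum_congr rfl fun i hi => ?_
      rw [map_mul, map_pow, ← ht i (Finset.mem_range.1 hi)]
      rfl
    obtain ⟨r, hr, hωr⟩ := LubinTateExp.exists_norm_le_of_norm_lt_one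
      (fun i => (ω i : ℂ_[p])) (fun i hi => by
        rw [PadicComplex.norm_extends]
        exact hω.norm_lt_one i hi) n
    -- For u = ∑ z_i π^i this is [u]_P(exp(X)) = exp(uX) over ℂ_p.
    have hG := LubinTateExp.IsExpLog.subst_exp_of_comm hl
      (hπ.map_pow_ne_self LubinTateExp.integerEmb_injective)
      (LubinTateExp.constantCoeff_map' _ hP.constantCoeff_eq)
      (by rw [PowerSeries.coeff_map, hP.coeff_one_eq])
      ((LubinTateExp.isMulSeries_mulSeries hπ hP (∑ i ∈ Finset.range n, t i * π ^ i)).map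
        hP.constantCoeff_eq (LubinTateExp.integerEmb K))
    rw [hu] at hG
    have hrel := LubinTateExp.value_relation hq
      (fun h0 => hπ.ne_zero (LubinTateExp.integerEmb_injective (by rw [h0, map_zero])))
      hπ.norm_lt_one
      LubinTateExp.norm_coeff_lubinTateGroup_le (LubinTateExp.isFormalExp_lubinTateExpC hπ hP)
      (LubinTateExp.norm_coeff_rescale_le hπ hP) hr (n := n) hωr
      (a := LubinTateExp.argumentCoeff (LubinTateExp.integerEmb K π) fun i => (ω i : ℂ_[p]))
      (fun m i => rfl)
      (fun m hm => by rw [← LubinTateExp.expSeriesC_eq]; exact hsmall m hm)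
      (z := fun i => (z i : ℂ_[p])) (fun i hi => ⟨by
        change algebraMap (PadicAlgCl p) ℂ_[p] (z i) ^ _ = algebraMap (PadicAlgCl p) ℂ_[p] (z i)
        rw [← map_pow, hzq i hi], hzn i hi⟩)
      (LubinTateExp.norm_coeff_map_integerEmb_le _) hG
      (s := LubinTateExp.formalSum (LubinTateExp.groupSeries P)
          (fun i => LubinTateExp.eval (LubinTateExp.expSeriesC π P ω (n - i)) (z i : ℂ_[p])))
      rfl (fun j _ => by
        rw [← LubinTateExp.expSeriesC_eq]
        rfl)
    rw [← LubinTateExp.expSeriesC_eq] at hrel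
    exact hrel
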